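/- Let $(M,g_0)$ be a closed (compact, without boundary) smooth Riemannian surface. For $u\in C^\infty(M)$ let $g_u=e^{2u}g_0$, with Gauss curvature $K_u$, area measure $dA_u$ and gradient $\nabla_u$. Let $\Gamma_1^{+}$ (resp. $\Gamma_1^{-}$) be the set of $u\in C^\infty(M)$ with $K_u>0$ (resp. $K_u<0$) on $M$; put $\sigma=1$ on $\Gamma_1^+$ and $\sigma=-1$ on $\Gamma_1^-$. The formal tangent space of $\Gamma_1^\pm$ at $u$ is $C^\infty(M)$, with the metric $$\langle\!\langle \phi,\psi\rangle\!\rangle_u=\int_M \phi\,\psi\,(\sigma K_u)\,dA_u .$$ For a path $u(t)$ in $\Gamma_1^{\pm}$ and a field $\alpha(t)\in C^\infty(M)$ along it, the formal Levi-Civita connection is given by the path derivative $$\frac{D}{\partial t}\alpha=\frac{\partial\alpha}{\partial t}+\frac1{K_u}\,g_u\Big(\nabla_u\alpha,\nabla_u\frac{\partial u}{\partial t}\Big).$$ For $u\in\Gamma_1^\pm$ and $\phi,\psi\in C^\infty(M)$ let $$K(\phi,\psi)=\Big\langle\!\!\Big\langle\Big(\frac{D}{\partial s}\frac{D}{\partial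 t}-\frac{D}{\partial t}\frac{D}{\partial s}\Big)\frac{\partial u}{\partial t},\frac{\partial u}{\partial s}\Big\rangle\!\!\Big\rangle_u\Big|_{s=t=0}$$ for a smooth two-parameter family $u(s,t)$ in $\Gamma_1^\pm$, defined for $(s,t)$ near $(0,0)$, with $u(0,0)=u$, $\frac{\partial u}{\partial s}(0,0)=\phi$, $\frac{\partial u}{\partial t}(0,0)=\psi$. This is the sectional curvature before division by the Gram determinant $\langle\!\langle\phi,\phi\rangle\!\rangle_u\langle\!\langle\psi,\psi\rangle\!\rangle_u-\langle\!\langle\phi,\psi\rangle\!\rangle_u^2$. Then such families exist (for instance $u+s\phi+t\psi$), $K(\phi,\psi)$ does not depend on the family, and $$K(\phi,\psi)=\int_M\frac1{\sigma K_u}\Big\{-|\nabla_u\phi|_u^2|\nabla_u\psi|_u^2+g_u(\nabla_u\phi,\nabla_u\psi)^2\Big\}dA_u=-\int_M\frac1{\sigma K_u}\,|d\phi\wedge d\psi|_u^2\,dA_u\le 0,$$ the integrand of the last integral being integrable. In particular, if $\phi,\psi$ are linearly independent, the Gram determinant is positive and the normalized sectional curvature of the plane spanned by $\phi,\psi$,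 namely $K(\phi,\psi)$ divided by the Gram determinant, is $\le 0$. -/

import Mathlib

open Set Filter Topology MeasureTheory
open scoped Manifold ContDiff

noncomputable section

namespace FormalCurvature

/-- The model plane `ℝ²`. -/
abbrev Plane : Type := EuclideanSpace ℝ (Fin 2)

/-- The standard basis vectors of `ℝ²`. -/
def basisVec (i : Fin 2) : Plane := EuclideanSpace.single i (1 : ℝ)

/-! ### Riemannian geometry of a metric on (an open subset of) the plane

A metric on a planar domain is a map `G : ℝ² → {bilinear forms on ℝ²}`. -/

/-- The area density `√(G₁₁ G₂₂ - G₁₂²)`. -/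
def planeAreaDensity (G : Plane → Plane →L[ℝ] Plane →L[ℝ] ℝ) (y : Plane) : ℝ :=
  Real.sqrt (G y (basisVec 0) (basisVec 0) * G y (basisVec 1) (basisVec 1)
    - G y (basisVec 0) (basisVec 1) ^ 2)

/-- The linear form
`z ↦ ½ (∂_v G(w, z) + ∂_w G(v, z) - ∂_z G(v, w))` (Christoffel symbols of the first kind). -/
def planeKoszul (G : Plane → Plane →L[ℝ] Plane →L[ℝ] ℝ) (y v w : Plane) : Plane →L[ℝ] ℝ :=
  (1 / 2 : ℝ) • (fderiv ℝ G y v w + fderiv ℝ G y w v - ((fderiv ℝ G y).flip v).flip w)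

/-- The Christoffel symbol of the second kind: the vector `Γ(v, w)` with
`G(Γ(v, w), z) = ½ (∂_v G(w, z) + ∂_w G(v, z) - ∂_z G(v, w))` for all `z`. -/
def planeChristoffel (G : Plane → Plane →L[ℝ] Plane →L[ℝ] ℝ) (y v w : Plane) : Plane :=
  (G y).inverse (planeKoszul G y v w)

/-- The Riemann curvature tensor `R(v, w) z = ∇_v ∇_w z - ∇_w ∇_v z` (for constant fields
`v, w, z` of the plane) of the Levi-Civita connection `∇_v X = ∂_v X + Γ(v, X)` of `G`. -/
def planeRiemann (G : Plane → Plane →L[ℝ] Plane →L[ℝ] ℝ) (y v w z : Plane) : Plane :=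
  fderiv ℝ (fun y' => planeChristoffel G y' w z) y v
    - fderiv ℝ (fun y' => planeChristoffel G y' v z) y w
    + planeChristoffel G y v (planeChristoffel G y w z)
    - planeChristoffel G y w (planeChristoffel G y v z)

/-- The Gauss curvature `G(R(∂₁, ∂₂)∂₂, ∂₁) / (G₁₁ G₂₂ - G₁₂²)`. -/
def planeGaussCurvature (G : Plane → Plane →L[ℝ] Plane →L[ℝ] ℝ) (y : Plane) : ℝ :=
  G y (planeRiemann G y (basisVec 0) (basisVec 1) (basisVec 1)) (basisVec 0) /
    (G y (basisVec 0) (basisVec 0) * G y (basisVec 1) (basisVec 1)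
      - G y (basisVec 0) (basisVec 1) ^ 2)

/-! ### Riemannian geometry of a metric on a surface -/

section Surface

variable {M : Type*} [TopologicalSpace M] [ChartedSpace Plane M]

/-- A field of bilinear forms on the tangent spaces of a surface. -/
abbrev FormField (M : Type*) [TopologicalSpace M] [ChartedSpace Plane M] : Type _ :=
  ∀ x : M, TangentSpace (𝓡 2) x →L[ℝ] TangentSpace (𝓡 2) x →L[ℝ] ℝ

/-- The coordinate expression of `h` in the chart at `p`, i.e. the pull-back of `h` by the inverse
of that chart: `(v, w) ↦ h(D(c⁻¹) v, D(c⁻¹) w)`. (Mathlib's tangent spaces of `M` are copies of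
the model plane, which is used here to state the types of `D` and `B`.) -/
def coordMetric (h : FormField M) (p : M) (y : Plane) : Plane →L[ℝ] Plane →L[ℝ] ℝ :=
  let q : M := (chartAt Plane p).symm y
  let D : Plane →L[ℝ] Plane := mfderiv 𝓘(ℝ, Plane) (𝓡 2) (chartAt Plane p).symm y
  let B : Plane →L[ℝ] Plane →L[ℝ] ℝ := h q
  B.bilinearComp D D

/-- The Gauss curvature of the metric `h` at `x`, computed in the chart at `x`. -/
def gaussCurvature (h : FormField M) (x : M) : ℝ :=
  planeGaussCurvature (coordMetric h x) (chartAt Plane x x)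

/-- The differential of a function at `x`. -/
def differential (f : M → ℝ) (x : M) : TangentSpace (𝓡 2) x →L[ℝ] ℝ :=
  mfderiv (𝓡 2) 𝓘(ℝ, ℝ) f x

/-- The gradient of `f` for `h`: the vector `∇f` with `h(∇f, v) = df(v)` for all `v`. -/
def surfaceGradient (h : FormField M) (f : M → ℝ) (x : M) : TangentSpace (𝓡 2) x :=
  (h x).inverse (differential f x)

/-- The function `h(∇f₁, ∇f₂)`. -/
def gradInner (h : FormField M) (f₁ f₂ : M → ℝ) (x : M) : ℝ :=
  h x (surfaceGradient h f₁ x) (surfaceGradient h f₂ x)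

/-- The wedge product `df₁ ∧ df₂` at `x`, evaluated on the tangent vectors `v, w`. -/
def wedgeDiff (f₁ f₂ : M → ℝ) (x : M) (v w : TangentSpace (𝓡 2) x) : ℝ :=
  differential f₁ x v * differential f₂ x w - differential f₁ x w * differential f₂ x v

/-- The squared norm `|df₁ ∧ df₂|²` for `h`. For a 2-form `ω` on a Euclidean plane and any basis
`v, w` of the plane, `|ω|² = ω(v, w)² / (h(v,v) h(w,w) - h(v,w)²)`; this is `ω(e₁, e₂)²` when
`e₁, e₂` is orthonormal. -/
def wedgeNormSq (h : FormField M) (f₁ f₂ : M → ℝ) (x : M) : ℝ :=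
  let v : TangentSpace (𝓡 2) x := basisVec 0
  let w : TangentSpace (𝓡 2) x := basisVec 1
  wedgeDiff f₁ f₂ x v w ^ 2 / (h x v v * h x w w - h x v w ^ 2)

/-- A smooth partition of unity `(ρ_p)` with `ρ_p` supported in the domain of the chart at `p`. -/
def chartPartition (M : Type*) [TopologicalSpace M] [ChartedSpace Plane M] [T2Space M]
    [CompactSpace M] [IsManifold (𝓡 2) ∞ M] : SmoothPartitionOfUnity M (𝓡 2) M univ :=
  (SmoothPartitionOfUnity.exists_isSubordinate_chartAt_source (𝓡 2) M).choose

/-- The Riemannian area measure `dA` of `h`, glued by a partition of unity from the measures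
`√(det h_ij) dy` in the charts:
`∫ f dA = ∑_p ∫ (ρ_p f)(c_p⁻¹ y) √(det h_ij(y)) dy`. -/
def areaMeasure [T2Space M] [CompactSpace M] [IsManifold (𝓡 2) ∞ M] [MeasurableSpace M]
    (h : FormField M) : Measure M :=
  Measure.sum fun p : M =>
    ((((volume : Measure Plane).restrict (chartAt Plane p).target).withDensity
        fun y => ENNReal.ofReal (planeAreaDensity (coordMetric h p) y)).map
      (chartAt Plane p).symm).withDensity
        fun x => ENNReal.ofReal (chartPartition M p x)

/-! ### The cones of conformal metrics of positive / negative curvature -/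

/-- A smooth Riemannian metric on the surface `M`. -/
abbrev SurfaceMetric (M : Type*) [TopologicalSpace M] [ChartedSpace Plane M]
    [IsManifold (𝓡 2) ∞ M] : Type _ :=
  Bundle.ContMDiffRiemannianMetric (𝓡 2) ∞ Plane (fun x : M => TangentSpace (𝓡 2) x)

variable [IsManifold (𝓡 2) ∞ M]

/-- The conformal metric `g_u = e^{2u} g₀`. -/
def conformal (g₀ : SurfaceMetric M) (u : M → ℝ) : FormField M :=
  fun x => Real.exp (2 * u x) • g₀.inner x

/-- The Gauss curvature `K_u` of `g_u`. -/
def curv (g₀ : SurfaceMetric M) (u : M → ℝ) (x : M) : ℝ :=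
  gaussCurvature (conformal g₀ u) x

/-- The smooth conformal factors `u` with `σ K_u > 0` everywhere: this is the positive cone
`Γ₁⁺` for `σ = 1`, and the negative cone `Γ₁⁻` for `σ = -1`. -/
def cone (g₀ : SurfaceMetric M) (σ : ℝ) : Set (M → ℝ) :=
  {u | ContMDiff (𝓡 2) 𝓘(ℝ, ℝ) ∞ u ∧ ∀ x, 0 < σ * curv g₀ u x}

/-- The path derivative
`Dα/∂t = ∂α/∂t + K_u⁻¹ g_u(∇_u α, ∇_u ∂u/∂t)` of a vector field `α` along the path `u` of conformal
factors (the formal Levi-Civita connection, the same formula on both cones). -/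
def pathDeriv (g₀ : SurfaceMetric M) (u α : ℝ → M → ℝ) (t : ℝ) (x : M) : ℝ :=
  deriv (fun t' => α t' x) t +
    1 / curv g₀ (u t) x *
      gradInner (conformal g₀ (u t)) (α t) (fun x' => deriv (fun t' => u t' x') t) x

/-- `∂u/∂s` for a two-parameter family `u = u(s, t)`. -/
def partialS (U : ℝ → ℝ → M → ℝ) (s t : ℝ) (x : M) : ℝ := deriv (fun s' => U s' t x) s

/-- `∂u/∂t` for a two-parameter family `u = u(s, t)`. -/
def partialT (U : ℝ → ℝ → M → ℝ) (s t : ℝ) (x : M) : ℝ := deriv (fun t' => U s t' x) t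

/-- `D/∂s` of a field `α = α(s, t)` along the two-parameter family `U = u(s, t)`. -/
def covDerivS (g₀ : SurfaceMetric M) (U α : ℝ → ℝ → M → ℝ) (s t : ℝ) : M → ℝ :=
  pathDeriv g₀ (fun s' => U s' t) (fun s' => α s' t) s

/-- `D/∂t` of a field `α = α(s, t)` along the two-parameter family `U = u(s, t)`. -/
def covDerivT (g₀ : SurfaceMetric M) (U α : ℝ → ℝ → M → ℝ) (s t : ℝ) : M → ℝ :=
  pathDeriv g₀ (U s) (α s) t

/-- The curvature operator `(D/∂s D/∂t - D/∂t D/∂s) α` along the family. -/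
def curvatureOperator (g₀ : SurfaceMetric M) (U α : ℝ → ℝ → M → ℝ) (s t : ℝ) (x : M) : ℝ :=
  covDerivS g₀ U (covDerivT g₀ U α) s t x - covDerivT g₀ U (covDerivS g₀ U α) s t x

/-- `U = u(s, t)` is a two-parameter family in the cone, smooth jointly in `(s, t, x)` near
`(s, t) = (0, 0)`, with `u(0,0) = u`, `∂u/∂s(0,0) = φ` and `∂u/∂t(0,0) = ψ`. -/
def IsFamily (g₀ : SurfaceMetric M) (σ : ℝ) (u φ ψ : M → ℝ) (U : ℝ → ℝ → M → ℝ) : Prop :=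
  (∃ V : Set (ℝ × ℝ), IsOpen V ∧ ((0, 0) : ℝ × ℝ) ∈ V ∧
    ContMDiffOn (𝓘(ℝ, ℝ × ℝ).prod (𝓡 2)) 𝓘(ℝ, ℝ) ∞
      (fun q : (ℝ × ℝ) × M => U q.1.1 q.1.2 q.2) (V ×ˢ univ) ∧
    ∀ p ∈ V, U p.1 p.2 ∈ cone g₀ σ) ∧
  U 0 0 = u ∧ partialS U 0 0 = φ ∧ partialT U 0 0 = ψ

variable [T2Space M] [CompactSpace M] [MeasurableSpace M]

/-- The area measure `dA_u` of `g_u`. -/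
def area (g₀ : SurfaceMetric M) (u : M → ℝ) : Measure M := areaMeasure (conformal g₀ u)

/-- The formal Riemannian metric `⟪φ, ψ⟫_u = ∫ φ ψ (σ K_u) dA_u`. -/
def pairing (g₀ : SurfaceMetric M) (σ : ℝ) (u φ ψ : M → ℝ) : ℝ :=
  ∫ x, φ x * ψ x * (σ * curv g₀ u x) ∂(area g₀ u)

/-- `⟪(D/∂s D/∂t - D/∂t D/∂s) ∂u/∂t, ∂u/∂s⟫_u` at `(s, t) = (0, 0)`. -/
def familyCurvature (g₀ : SurfaceMetric M) (σ : ℝ) (U : ℝ → ℝ → M → ℝ) : ℝ :=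
  pairing g₀ σ (U 0 0) (curvatureOperator g₀ U (partialT U) 0 0) (partialS U 0 0)

/-- The (unnormalized) sectional curvature `K(φ, ψ) = ⟪R(φ, ψ)ψ, φ⟫_u`, computed along the
two-parameter family `u + s φ + t ψ`. -/
def sectionalForm (g₀ : SurfaceMetric M) (σ : ℝ) (u φ ψ : M → ℝ) : ℝ :=
  familyCurvature g₀ σ fun s t x => u x + s * φ x + t * ψ x

/-- The Gram determinant `⟪φ, φ⟫_u ⟪ψ, ψ⟫_u - ⟪φ, ψ⟫_u²`. -/
def gram (g₀ : SurfaceMetric M) (σ : ℝ) (u φ ψ : M → ℝ) : ℝ :=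
  pairing g₀ σ u φ φ * pairing g₀ σ u ψ ψ - pairing g₀ σ u φ ψ ^ 2

/-- The normalized sectional curvature of the plane spanned by `φ, ψ`. -/
def sectionalCurvature (g₀ : SurfaceMetric M) (σ : ℝ) (u φ ψ : M → ℝ) : ℝ :=
  sectionalForm g₀ σ u φ ψ / gram g₀ σ u φ ψ

end Surface

end FormalCurvature

end

/-! The conformal factor disappears once everything is referred to `g₀`. Put `k = e^{2u} K_u`.
Liouville's equation reads `k = K₀ - Δ₀u`, so `k` is affine in `u`. Moreover `K_u dA_u = k dA₀`, and
`K_u⁻¹ g_u(∇_u α, ∇_u β) = k⁻¹ ⟨∇α, ∇β⟩` for the background metric. So the connection is `α_t +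
k⁻¹⟨∇α, ∇u_t⟩`, and differentiating `k` along a family gives `∂_s k = -Δ₀ u_s`.

In the commutator of the two path derivatives everything symmetric in `s` and `t` cancels. What
remains, applied to `u_t` and multiplied by `k`, is `div(k⁻¹|∇ψ|²∇φ) - div(k⁻¹⟨∇ψ,∇φ⟩∇ψ)`
(`curvatureOperator_eq`); it involves only `u, φ, ψ`, so the family does not matter. Pairing with
`φ` against `σ k dA₀` and integrating by parts (`green`) moves the gradient onto `φ` and leaves `σ
k⁻¹(⟨∇φ,∇ψ⟩² - |∇φ|²|∇ψ|²)` (`familyCurvature_eq`). Lagrange's identity in dimension two,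
`wedgeNormSq_conformal`, identifies this with `-σ k⁻¹|dφ ∧ dψ|²`, whence the sign.

Most of the work is to justify this calculus from coordinate definitions. The curvature at a point
is defined in the chart at that point, so its invariance is needed to see it as a smooth function in
one fixed chart (`planeGaussCurvature_pullback`). Liouville's equation comes from Brioschi's formula
(`planeGaussCurvature_conformal`). The Laplacian is handled as an explicit second-order operator
whose coefficients do not depend on the parameters, so it commutes with `∂_s` and `∂_t`. The area
measure is glued by a partition of unity, and integrals against it are reduced to integrals in
charts by the change of variables formula.

Linear families stay in the cone for small parameters because `k` is affine in `u` and `M` is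
compact. The Gram determinant is positive because the pairing is positive definite on continuous
functions. -/

noncomputable section

set_option maxSynthPendingDepth 3

namespace FormalCurvature

/-! ### Metrics on planar domains -/

/-- `G` is a smooth Riemannian metric on the open set `T`. -/
structure IsPlaneMetricOn (G : Plane → Plane →L[ℝ] Plane →L[ℝ] ℝ) (T : Set Plane) : Prop where
  isOpen : IsOpen T
  smooth : ContDiffOn ℝ ∞ G T
  symm : ∀ y ∈ T, ∀ v w, G y v w = G y w v
  pos : ∀ y ∈ T, ∀ v, v ≠ 0 → 0 < G y v v

/-- Definiteness gives injectivity, and the plane and its dual have the same dimension. This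
guarantees that `ContinuousLinearMap.inverse`, which is zero on non-invertible maps, is the true
inverse wherever a metric is involved. -/
theorem isInvertible_of_pos {B : Plane →L[ℝ] Plane →L[ℝ] ℝ} (hB : ∀ v, v ≠ 0 → 0 < B v v) :
    B.IsInvertible := by
  have hinj : Function.Injective (B : Plane →ₗ[ℝ] Plane →L[ℝ] ℝ) := by
    rw [injective_iff_map_eq_zero]
    intro v hv
    by_contra h
    have h1 := hB v h
    have h2 : B v = 0 := hv
    simp [h2] at h1
  have hdim : Module.finrank ℝ Plane = Module.finrank ℝ (Plane →L[ℝ] ℝ) := by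
    rw [← LinearEquiv.finrank_eq (LinearMap.toContinuousLinearMap (𝕜 := ℝ) (E := Plane) (F' := ℝ))]
    simp
  refine ⟨(LinearEquiv.ofInjectiveOfFinrankEq (B : Plane →ₗ[ℝ] Plane →L[ℝ] ℝ) hinj hdim
    ).toContinuousLinearEquiv, ?_⟩
  ext v w
  rfl

theorem apply_inverse_apply {B : Plane →L[ℝ] Plane →L[ℝ] ℝ} (hB : ∀ v, v ≠ 0 → 0 < B v v)
    (a : Plane →L[ℝ] ℝ) : B (B.inverse a) = a :=
  (isInvertible_of_pos hB).self_apply_inverse a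

theorem plane_eq (v : Plane) : v = v 0 • basisVec 0 + v 1 • basisVec 1 := by
  ext i
  fin_cases i <;> simp [basisVec]

theorem dual_apply (a : Plane →L[ℝ] ℝ) (v : Plane) :
    a v = v 0 * a (basisVec 0) + v 1 * a (basisVec 1) := by
  conv_lhs => rw [plane_eq v]
  simp

theorem bilin_apply (B : Plane →L[ℝ] Plane →L[ℝ] ℝ) (v w : Plane) :
    B v w = v 0 * w 0 * B (basisVec 0) (basisVec 0) + v 0 * w 1 * B (basisVec 0) (basisVec 1)
      + v 1 * w 0 * B (basisVec 1) (basisVec 0) + v 1 * w 1 * B (basisVec 1) (basisVec 1) := by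
  rw [dual_apply (B v) w]
  conv_lhs => rw [plane_eq v]
  simp
  ring

theorem two_le_infty : (2 : WithTop ℕ∞) ≤ ∞ := by
  exact WithTop.coe_le_coe.2 (le_top : (2 : ℕ∞) ≤ ⊤)

theorem basisVec_ne_zero (i : Fin 2) : basisVec i ≠ 0 := by
  simp [basisVec]

/-- With `E, F, H` the entries of the matrix, the vector `E e₁ - F e₀` has squared length `E (E H -
F²)`, and `E > 0`. -/
theorem det_pos {B : Plane →L[ℝ] Plane →L[ℝ] ℝ} (hs : ∀ v w, B v w = B w v)
    (hB : ∀ v, v ≠ 0 → 0 < B v v) :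
    0 < B (basisVec 0) (basisVec 0) * B (basisVec 1) (basisVec 1)
      - B (basisVec 0) (basisVec 1) ^ 2 := by
  have h0 := hB _ (basisVec_ne_zero 0)
  set E := B (basisVec 0) (basisVec 0) with hE
  set F := B (basisVec 0) (basisVec 1) with hF
  set H := B (basisVec 1) (basisVec 1) with hH
  have hv : E • basisVec 1 - F • basisVec 0 ≠ 0 := by
    intro h
    have := congrArg (fun v : Plane => v 1) h
    simp [basisVec] at this
    exact h0.ne' this
  have h1 := hB _ hv
  have h2 : B (E • basisVec 1 - F • basisVec 0) (E • basisVec 1 - F • basisVec 0)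
      = E * (E * H - F ^ 2) := by
    simp only [map_sub, map_smul, sub_apply, smul_apply,
      smul_eq_mul, hs (basisVec 1) (basisVec 0), ← hE, ← hF, ← hH]
    ring
  rw [h2] at h1
  exact (mul_pos_iff_of_pos_left h0).1 h1

/-- The inner product of covectors induced by an inner product on the plane. -/
theorem dual_inner_eq {B : Plane →L[ℝ] Plane →L[ℝ] ℝ} (hs : ∀ v w, B v w = B w v)
    (hB : ∀ v, v ≠ 0 → 0 < B v v) (a b : Plane →L[ℝ] ℝ) :
    B (B.inverse a) (B.inverse b) =
      (B (basisVec 1) (basisVec 1) * (a (basisVec 0) * b (basisVec 0))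
        - B (basisVec 0) (basisVec 1) *
          (a (basisVec 0) * b (basisVec 1) + a (basisVec 1) * b (basisVec 0))
        + B (basisVec 0) (basisVec 0) * (a (basisVec 1) * b (basisVec 1))) /
      (B (basisVec 0) (basisVec 0) * B (basisVec 1) (basisVec 1)
        - B (basisVec 0) (basisVec 1) ^ 2) := by
  have hD := det_pos hs hB
  have ha := apply_inverse_apply hB a
  have hb := apply_inverse_apply hB b
  set p := B.inverse a
  set q := B.inverse b
  -- Writing the covectors as `B p` and `B q` turns the claim into a polynomial identity in the
  -- coordinates of `p` and `q`.
  rw [eq_div_iff hD.ne', ← ha, ← hb]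
  rw [bilin_apply B p q, bilin_apply B p (basisVec 0), bilin_apply B p (basisVec 1),
    bilin_apply B q (basisVec 0), bilin_apply B q (basisVec 1), hs (basisVec 1) (basisVec 0)]
  simp [basisVec]
  ring

/-! ### Christoffel symbols as bilinear maps -/

/-- The Christoffel symbols of the first kind as a bilinear map. -/
def koszulMap (A : Plane →L[ℝ] Plane →L[ℝ] Plane →L[ℝ] ℝ) :
    Plane →L[ℝ] Plane →L[ℝ] Plane →L[ℝ] ℝ :=
  (1 / 2 : ℝ) • (A + A.flip -
    ((ContinuousLinearMap.flipₗᵢ ℝ Plane Plane ℝ).toContinuousLinearEquiv : _ →L[ℝ] _) ∘L A.flip)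

theorem koszulMap_apply (G : Plane → Plane →L[ℝ] Plane →L[ℝ] ℝ) (y v w : Plane) :
    koszulMap (fderiv ℝ G y) v w = planeKoszul G y v w := by
  ext z
  simp [koszulMap, planeKoszul]

/-- The Christoffel symbols of the second kind as a bilinear map. -/
def christoffelMap (G : Plane → Plane →L[ℝ] Plane →L[ℝ] ℝ) (y : Plane) :
    Plane →L[ℝ] Plane →L[ℝ] Plane :=
  (ContinuousLinearMap.compL ℝ Plane (Plane →L[ℝ] ℝ) Plane (G y).inverse) ∘L
    koszulMap (fderiv ℝ G y)

theorem christoffelMap_apply (G : Plane → Plane →L[ℝ] Plane →L[ℝ] ℝ) (y v w : Plane) :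
    christoffelMap G y v w = planeChristoffel G y v w := by
  simp [christoffelMap, planeChristoffel, koszulMap_apply]

namespace IsPlaneMetricOn

variable {G : Plane → Plane →L[ℝ] Plane →L[ℝ] ℝ} {T : Set Plane}

theorem contDiffAt (h : IsPlaneMetricOn G T) {y : Plane} (hy : y ∈ T) : ContDiffAt ℝ ∞ G y :=
  h.smooth.contDiffAt (h.isOpen.mem_nhds hy)

theorem contDiffAt_fderiv (h : IsPlaneMetricOn G T) {y : Plane} (hy : y ∈ T) :
    ContDiffAt ℝ ∞ (fderiv ℝ G) y :=
  (h.contDiffAt hy).fderiv_right (m := ∞) (by simp)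

theorem contDiffAt_christoffelMap (h : IsPlaneMetricOn G T) {y : Plane} (hy : y ∈ T) :
    ContDiffAt ℝ ∞ (christoffelMap G) y := by
  have h1 : ContDiffAt ℝ ∞ (fun y => (G y).inverse) y :=
    ((isInvertible_of_pos (h.pos y hy)).contDiffAt_map_inverse).comp y (h.contDiffAt hy)
  have h2 : ContDiffAt ℝ ∞ (fun y => koszulMap (fderiv ℝ G y)) y := by
    have h3 := h.contDiffAt_fderiv hy
    have h4 : ContDiffAt ℝ ∞ (fun y => (fderiv ℝ G y).flip) y :=
      (ContinuousLinearMap.flipₗᵢ ℝ Plane Plane (Plane →L[ℝ] ℝ)).contDiff.contDiffAt.comp y h3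
    exact ((h3.add h4).sub (contDiffAt_const.clm_comp h4)).const_smul _
  exact (((ContinuousLinearMap.compL ℝ Plane (Plane →L[ℝ] ℝ) Plane).contDiff.contDiffAt).comp y
    h1).clm_comp h2

theorem differentiableAt_christoffelMap (h : IsPlaneMetricOn G T) {y : Plane} (hy : y ∈ T) :
    DifferentiableAt ℝ (christoffelMap G) y :=
  (h.contDiffAt_christoffelMap hy).differentiableAt (by simp)

/-- Evaluation on constant vectors commutes with differentiation, so the curvature can be handled
through the derivative of the bundled map `christoffelMap`, whose trilinearity is then automatic. -/
theorem planeRiemann_eq (h : IsPlaneMetricOn G T) {y : Plane} (hy : y ∈ T) (v w z : Plane) :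
    planeRiemann G y v w z = fderiv ℝ (christoffelMap G) y v w z
      - fderiv ℝ (christoffelMap G) y w v z
      + christoffelMap G y v (christoffelMap G y w z)
      - christoffelMap G y w (christoffelMap G y v z) := by
  have key : ∀ v w z : Plane, fderiv ℝ (fun y' => planeChristoffel G y' w z) y v =
      fderiv ℝ (christoffelMap G) y v w z := by
    intro v w z
    have h1 := (((h.differentiableAt_christoffelMap hy).hasFDerivAt.clm_apply
      (hasFDerivAt_const w y)).clm_apply (hasFDerivAt_const z y)).fderiv
    simp only [christoffelMap_apply] at h1
    rw [h1]
    simp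
  simp only [planeRiemann, key, christoffelMap_apply]

theorem metric_christoffelMap (h : IsPlaneMetricOn G T) {y : Plane} (hy : y ∈ T) (v w z : Plane) :
    G y (christoffelMap G y v w) z =
      1 / 2 * (fderiv ℝ G y v w z + fderiv ℝ G y w v z - fderiv ℝ G y z v w) := by
  rw [christoffelMap_apply, planeChristoffel, apply_inverse_apply (h.pos y hy)]
  simp [planeKoszul]

theorem fderiv_symm (h : IsPlaneMetricOn G T) {y : Plane} (hy : y ∈ T) (v w z : Plane) :
    fderiv ℝ G y v w z = fderiv ℝ G y v z w := by
  have hd := ((h.contDiffAt hy).differentiableAt (by simp)).hasFDerivAt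
  have h1 := ((hd.clm_apply (hasFDerivAt_const w y)).clm_apply (hasFDerivAt_const z y))
  have h2 := ((hd.clm_apply (hasFDerivAt_const z y)).clm_apply (hasFDerivAt_const w y))
  have h3 : (fun y => G y w z) =ᶠ[𝓝 y] fun y => G y z w := by
    filter_upwards [h.isOpen.mem_nhds hy] with x hx using h.symm x hx w z
  have h4 := congrArg (fun L : Plane →L[ℝ] ℝ => L v) (h1.unique (h2.congr_of_eventuallyEq h3))
  simpa using h4

theorem christoffelMap_symm (h : IsPlaneMetricOn G T) {y : Plane} (hy : y ∈ T) (v w : Plane) :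
    christoffelMap G y v w = christoffelMap G y w v := by
  apply (isInvertible_of_pos (h.pos y hy)).injective
  ext z
  rw [h.metric_christoffelMap hy, h.metric_christoffelMap hy, h.fderiv_symm hy z v w]
  ring

/-- The metric is parallel. -/
theorem fderiv_eq (h : IsPlaneMetricOn G T) {y : Plane} (hy : y ∈ T) (v a b : Plane) :
    fderiv ℝ G y v a b = G y (christoffelMap G y v a) b + G y (christoffelMap G y v b) a := by
  rw [h.metric_christoffelMap hy, h.metric_christoffelMap hy, h.fderiv_symm hy v b a]
  ring

theorem fderiv_fderiv_comm (h : IsPlaneMetricOn G T) {y : Plane} (hy : y ∈ T) (v w : Plane) :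
    fderiv ℝ (fderiv ℝ G) y v w = fderiv ℝ (fderiv ℝ G) y w v :=
  ((h.contDiffAt hy).isSymmSndFDerivAt (by simp; exact two_le_infty)) v w

theorem hasFDerivAt_fderiv_apply (h : IsPlaneMetricOn G T) {y : Plane} (hy : y ∈ T)
    (v w z : Plane) :
    HasFDerivAt (fun y => fderiv ℝ G y v w z)
      ((((fderiv ℝ (fderiv ℝ G) y).flip v).flip w).flip z) y := by
  have hd := ((h.contDiffAt_fderiv hy).differentiableAt (by simp)).hasFDerivAt
  have h1 := (((hd.clm_apply (hasFDerivAt_const v y)).clm_apply (hasFDerivAt_const w y)).clm_apply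
    (hasFDerivAt_const z y))
  refine h1.congr_fderiv ?_
  ext u
  simp

theorem fderiv_fderiv_symm (h : IsPlaneMetricOn G T) {y : Plane} (hy : y ∈ T) (v w a b : Plane) :
    fderiv ℝ (fderiv ℝ G) y v w a b = fderiv ℝ (fderiv ℝ G) y v w b a := by
  have h1 := h.hasFDerivAt_fderiv_apply hy w a b
  have h2 := h.hasFDerivAt_fderiv_apply hy w b a
  have h3 : (fun y => fderiv ℝ G y w a b) =ᶠ[𝓝 y] fun y => fderiv ℝ G y w b a := by
    filter_upwards [h.isOpen.mem_nhds hy] with x hx using h.fderiv_symm hx w a b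
  have h4 := congrArg (fun L : Plane →L[ℝ] ℝ => L v) (h1.unique (h2.congr_of_eventuallyEq h3))
  simpa using h4

/-- Differentiating the implicit description of the Christoffel symbols in `metric_christoffelMap`
avoids differentiating the inverse metric. -/
theorem metric_fderiv_christoffelMap (h : IsPlaneMetricOn G T) {y : Plane} (hy : y ∈ T)
    (v w z u : Plane) :
    G y (fderiv ℝ (christoffelMap G) y v w z) u =
      1 / 2 * (fderiv ℝ (fderiv ℝ G) y v w z u + fderiv ℝ (fderiv ℝ G) y v z w u
        - fderiv ℝ (fderiv ℝ G) y v u w z)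
      - fderiv ℝ G y v (christoffelMap G y w z) u := by
  have hd := ((h.contDiffAt hy).differentiableAt (by simp)).hasFDerivAt
  have hc := (h.differentiableAt_christoffelMap hy).hasFDerivAt
  have h1 := (hd.clm_apply ((hc.clm_apply (hasFDerivAt_const w y)).clm_apply
    (hasFDerivAt_const z y))).clm_apply (hasFDerivAt_const u y)
  have h2 := (((h.hasFDerivAt_fderiv_apply hy w z u).add
    (h.hasFDerivAt_fderiv_apply hy z w u)).sub (h.hasFDerivAt_fderiv_apply hy u w z)).const_mul
    (1 / 2)
  have h3 : (fun y => G y (christoffelMap G y w z) u) =ᶠ[𝓝 y] fun y =>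
      1 / 2 * (fderiv ℝ G y w z u + fderiv ℝ G y z w u - fderiv ℝ G y u w z) := by
    filter_upwards [h.isOpen.mem_nhds hy] with x hx using h.metric_christoffelMap hx w z u
  have h4 := congrArg (fun L : Plane →L[ℝ] ℝ => L v) (h1.unique (h2.congr_of_eventuallyEq h3))
  simp at h4
  linarith

/-- The curvature tensor in terms of the second derivatives of the metric. -/
theorem metric_planeRiemann (h : IsPlaneMetricOn G T) {y : Plane} (hy : y ∈ T) (v w z u : Plane) :
    G y (planeRiemann G y v w z) u =
      1 / 2 * (fderiv ℝ (fderiv ℝ G) y v z w u - fderiv ℝ (fderiv ℝ G) y v u w z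
        - fderiv ℝ (fderiv ℝ G) y w z v u + fderiv ℝ (fderiv ℝ G) y w u v z)
      - G y (christoffelMap G y v u) (christoffelMap G y w z)
      + G y (christoffelMap G y w u) (christoffelMap G y v z) := by
  rw [h.planeRiemann_eq hy]
  simp only [map_add, map_sub, add_apply, sub_apply]
  -- Since the metric is parallel, `∂_v G(Γ(w,z), u)` splits into `G(Γ(v,Γ(w,z)), u)`, which cancels
  -- a quadratic term of the curvature, and `G(Γ(v,u), Γ(w,z))`, which stays.
  rw [h.metric_fderiv_christoffelMap hy, h.metric_fderiv_christoffelMap hy,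
    h.fderiv_eq hy v _ u, h.fderiv_eq hy w _ u, h.fderiv_fderiv_comm hy v w]
  ring

end IsPlaneMetricOn

/-! ### Invariance of the Gauss curvature under coordinate changes -/

/-- Alternating forms on a plane are multiples of the determinant. Linearity in the first slot
suffices, since antisymmetry carries it to the second. -/
theorem antisymm_apply {f : Plane → Plane → ℝ} (hl : ∀ w, IsLinearMap ℝ fun v => f v w)
    (hf : ∀ v w, f v w = -f w v) (v w : Plane) :
    f v w = (v 0 * w 1 - v 1 * w 0) * f (basisVec 0) (basisVec 1) := by
  have hr : ∀ u v : Plane, f v u = v 0 * f (basisVec 0) u + v 1 * f (basisVec 1) u := by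
    intro u v
    conv_lhs => rw [plane_eq v]
    rw [(hl u).map_add, (hl u).map_smul, (hl u).map_smul, smul_eq_mul, smul_eq_mul]
  have h0 : ∀ v, f v v = 0 := fun v => by linarith [hf v v]
  rw [hr w v, hf (basisVec 0) w, hf (basisVec 1) w, hr _ w, hr _ w, h0, h0,
    hf (basisVec 1) (basisVec 0)]
  ring

/-- A Gram determinant scales by the square of the determinant of the vectors. This governs both the
denominator of the Gauss curvature and the area density under coordinate changes. -/
theorem pullback_det (B : Plane →L[ℝ] Plane →L[ℝ] ℝ) (hs : ∀ v w, B v w = B w v) (v w : Plane) :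
    B v v * B w w - B v w ^ 2 = (v 0 * w 1 - v 1 * w 0) ^ 2 *
      (B (basisVec 0) (basisVec 0) * B (basisVec 1) (basisVec 1)
        - B (basisVec 0) (basisVec 1) ^ 2) := by
  rw [bilin_apply B v v, bilin_apply B w w, bilin_apply B v w, hs (basisVec 1) (basisVec 0)]
  ring

namespace IsPlaneMetricOn

variable {G G' : Plane → Plane →L[ℝ] Plane →L[ℝ] ℝ} {T T' : Set Plane}

theorem mono (h : IsPlaneMetricOn G T) (hT : T' ⊆ T) (ho : IsOpen T') : IsPlaneMetricOn G T' :=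
  ⟨ho, h.smooth.mono hT, fun y hy => h.symm y (hT hy), fun y hy => h.pos y (hT hy)⟩

/-- The curvature tensor is alternating in `v, w` by construction and in `u, z` by the formula of
`metric_planeRiemann`, so in dimension two it has a single component. -/
theorem metric_planeRiemann_eq (h : IsPlaneMetricOn G T) {y : Plane} (hy : y ∈ T)
    (v w z u : Plane) :
    G y (planeRiemann G y v w z) u = (v 0 * w 1 - v 1 * w 0) * (u 0 * z 1 - u 1 * z 0) *
      G y (planeRiemann G y (basisVec 0) (basisVec 1) (basisVec 1)) (basisVec 0) := by
  have h1 := antisymm_apply (f := fun v w => G y (planeRiemann G y v w z) u)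
    (fun w => ⟨fun a b => by
        simp only [h.planeRiemann_eq hy, map_add, map_sub, add_apply, sub_apply]; ring,
      fun c a => by
        simp only [h.planeRiemann_eq hy, map_add, map_sub, map_smul, add_apply, sub_apply,
          smul_apply, smul_eq_mul]; ring⟩)
    (fun v w => by
      simp only [h.planeRiemann_eq hy, map_add, map_sub, add_apply, sub_apply]; ring) v w
  have h2 := antisymm_apply
    (f := fun u z => G y (planeRiemann G y (basisVec 0) (basisVec 1) z) u)
    (fun w => ⟨fun a b => map_add _ _ _, fun c a => map_smul _ _ _⟩)
    (fun u z => by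
      simp only [h.metric_planeRiemann hy]
      simp only [h.symm y hy (christoffelMap G y (basisVec 0) u),
        h.symm y hy (christoffelMap G y (basisVec 1) u)]
      rw [h.fderiv_fderiv_symm hy _ _ (basisVec 1) u, h.fderiv_fderiv_symm hy _ _ (basisVec 1) z,
        h.fderiv_fderiv_symm hy _ _ (basisVec 0) u, h.fderiv_fderiv_symm hy _ _ (basisVec 0) z]
      ring) u z
  simp only at h1 h2
  rw [h1, h2]
  ring

/-- The transformation law of the Christoffel symbols. -/
theorem christoffelMap_pullback (h : IsPlaneMetricOn G T) (h' : IsPlaneMetricOn G' T')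
    {Φ : Plane → Plane} (hm : MapsTo Φ T' T) (hΦ : ContDiffOn ℝ ∞ Φ T')
    (hJ : ∀ y ∈ T', (fderiv ℝ Φ y).IsInvertible)
    (hp : ∀ y ∈ T', ∀ v w, G' y v w = G (Φ y) (fderiv ℝ Φ y v) (fderiv ℝ Φ y w))
    {y : Plane} (hy : y ∈ T') (v w : Plane) :
    fderiv ℝ Φ y (christoffelMap G' y v w) = fderiv ℝ (fderiv ℝ Φ) y v w +
      christoffelMap G (Φ y) (fderiv ℝ Φ y v) (fderiv ℝ Φ y w) := by
  have hΦy : ContDiffAt ℝ ∞ Φ y := hΦ.contDiffAt (h'.isOpen.mem_nhds hy)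
  have hd1 : HasFDerivAt Φ (fderiv ℝ Φ y) y := (hΦy.differentiableAt (by simp)).hasFDerivAt
  have hd2 : HasFDerivAt (fderiv ℝ Φ) (fderiv ℝ (fderiv ℝ Φ) y) y :=
    ((hΦy.fderiv_right (m := ∞) (by simp)).differentiableAt (by simp)).hasFDerivAt
  have hG := ((h.contDiffAt (hm hy)).differentiableAt (by simp)).hasFDerivAt
  have hG' := ((h'.contDiffAt hy).differentiableAt (by simp)).hasFDerivAt
  -- This differentiates the pull-back relation `hp`; inserting it three times into the Koszul
  -- formula leaves only one second derivative of `Φ`.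
  have key : ∀ u a b : Plane, fderiv ℝ G' y u a b =
      fderiv ℝ G (Φ y) (fderiv ℝ Φ y u) (fderiv ℝ Φ y a) (fderiv ℝ Φ y b)
        + G (Φ y) (fderiv ℝ (fderiv ℝ Φ) y u a) (fderiv ℝ Φ y b)
        + G (Φ y) (fderiv ℝ Φ y a) (fderiv ℝ (fderiv ℝ Φ) y u b) := by
    intro u a b
    have h1 := ((hG'.clm_apply (hasFDerivAt_const a y)).clm_apply (hasFDerivAt_const b y))
    have h2 := (((hG.comp y hd1).clm_apply (hd2.clm_apply (hasFDerivAt_const a y))).clm_apply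
      (hd2.clm_apply (hasFDerivAt_const b y)))
    have h3 : (fun y => G' y a b) =ᶠ[𝓝 y]
        fun y => (G ∘ Φ) y (fderiv ℝ Φ y a) (fderiv ℝ Φ y b) := by
      filter_upwards [h'.isOpen.mem_nhds hy] with x hx using hp x hx a b
    have h4 := congrArg (fun L : Plane →L[ℝ] ℝ => L u) (h1.unique (h2.congr_of_eventuallyEq h3))
    simp at h4
    rw [h4]
    ring
  have hsym : ∀ a b, fderiv ℝ (fderiv ℝ Φ) y a b = fderiv ℝ (fderiv ℝ Φ) y b a :=
    fun a b => (hΦy.isSymmSndFDerivAt (by simp; exact two_le_infty)) a b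
  apply (isInvertible_of_pos (h.pos _ (hm hy))).injective
  ext z'
  obtain ⟨z, rfl⟩ := (hJ y hy).surjective z'
  rw [← hp y hy, h'.metric_christoffelMap hy, map_add, add_apply,
    h.metric_christoffelMap (hm hy), key, key, key, hsym w v, hsym z v, hsym z w,
    h.symm _ (hm hy) (fderiv ℝ Φ y w), h.symm _ (hm hy) (fderiv ℝ Φ y v)]
  ring

/-- The transformation law of the curvature tensor. -/
theorem planeRiemann_pullback (h : IsPlaneMetricOn G T) (h' : IsPlaneMetricOn G' T')
    {Φ : Plane → Plane} (hm : MapsTo Φ T' T) (hΦ : ContDiffOn ℝ ∞ Φ T')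
    (hJ : ∀ y ∈ T', (fderiv ℝ Φ y).IsInvertible)
    (hp : ∀ y ∈ T', ∀ v w, G' y v w = G (Φ y) (fderiv ℝ Φ y v) (fderiv ℝ Φ y w))
    {y : Plane} (hy : y ∈ T') (v w z : Plane) :
    fderiv ℝ Φ y (planeRiemann G' y v w z) =
      planeRiemann G (Φ y) (fderiv ℝ Φ y v) (fderiv ℝ Φ y w) (fderiv ℝ Φ y z) := by
  have hΦy : ContDiffAt ℝ ∞ Φ y := hΦ.contDiffAt (h'.isOpen.mem_nhds hy)
  have hd1 : HasFDerivAt Φ (fderiv ℝ Φ y) y := (hΦy.differentiableAt (by simp)).hasFDerivAt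
  have hs2 := hΦy.fderiv_right (m := ∞) (by simp)
  have hd2 := (hs2.differentiableAt (by simp)).hasFDerivAt
  have hd3 := ((hs2.fderiv_right (m := ∞) (by simp)).differentiableAt (by simp)).hasFDerivAt
  have hG := (h.differentiableAt_christoffelMap (hm hy)).hasFDerivAt
  have hG' := (h'.differentiableAt_christoffelMap hy).hasFDerivAt
  have hsym : ∀ a b, fderiv ℝ (fderiv ℝ Φ) y a b = fderiv ℝ (fderiv ℝ Φ) y b a :=
    fun a b => (hΦy.isSymmSndFDerivAt (by simp; exact two_le_infty)) a b
  have hsym3 : ∀ a b, fderiv ℝ (fderiv ℝ (fderiv ℝ Φ)) y a b =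
      fderiv ℝ (fderiv ℝ (fderiv ℝ Φ)) y b a :=
    fun a b => (hs2.isSymmSndFDerivAt (by simp; exact two_le_infty)) a b
  have hC := h.christoffelMap_symm (hm hy)
  -- This differentiates the transformation law of the Christoffel symbols once more.
  -- Antisymmetrizing in `v, w` removes the third derivatives of `Φ`, and the quadratic terms of the
  -- curvature absorb its second derivatives.
  have key : ∀ u a b : Plane,
      fderiv ℝ (fderiv ℝ Φ) y u (christoffelMap G' y a b)
        + fderiv ℝ Φ y (fderiv ℝ (christoffelMap G') y u a b) =
      fderiv ℝ (fderiv ℝ (fderiv ℝ Φ)) y u a b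
        + fderiv ℝ (christoffelMap G) (Φ y) (fderiv ℝ Φ y u) (fderiv ℝ Φ y a) (fderiv ℝ Φ y b)
        + christoffelMap G (Φ y) (fderiv ℝ (fderiv ℝ Φ) y u a) (fderiv ℝ Φ y b)
        + christoffelMap G (Φ y) (fderiv ℝ Φ y a) (fderiv ℝ (fderiv ℝ Φ) y u b) := by
    intro u a b
    have h1 := hd2.clm_apply
      ((hG'.clm_apply (hasFDerivAt_const a y)).clm_apply (hasFDerivAt_const b y))
    have h2 := ((hd3.clm_apply (hasFDerivAt_const a y)).clm_apply (hasFDerivAt_const b y)).add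
      (((hG.comp y hd1).clm_apply (hd2.clm_apply (hasFDerivAt_const a y))).clm_apply
        (hd2.clm_apply (hasFDerivAt_const b y)))
    have h3 : (fun y => fderiv ℝ Φ y (christoffelMap G' y a b)) =ᶠ[𝓝 y]
        fun y => fderiv ℝ (fderiv ℝ Φ) y a b +
          (christoffelMap G ∘ Φ) y (fderiv ℝ Φ y a) (fderiv ℝ Φ y b) := by
      filter_upwards [h'.isOpen.mem_nhds hy] with x hx
        using h.christoffelMap_pullback h' hm hΦ hJ hp hx a b
    have h4 := congrArg (fun L : Plane →L[ℝ] Plane => L u)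
      (h1.unique (h2.congr_of_eventuallyEq h3))
    simp at h4
    rw [add_comm, h4]
    abel
  have e1 := key v w z
  have e2 := key w v z
  rw [h'.planeRiemann_eq hy, h.planeRiemann_eq (hm hy)]
  simp only [map_add, map_sub]
  rw [h.christoffelMap_pullback h' hm hΦ hJ hp hy v (christoffelMap G' y w z),
    h.christoffelMap_pullback h' hm hΦ hJ hp hy w (christoffelMap G' y v z),
    h.christoffelMap_pullback h' hm hΦ hJ hp hy v z, h.christoffelMap_pullback h' hm hΦ hJ hp hy w z,
    eq_sub_of_add_eq' e1, eq_sub_of_add_eq' e2, hsym3 w v, hsym w v]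
  simp only [map_add]
  abel

/-- Numerator and denominator both acquire the squared Jacobian determinant, the numerator by
`metric_planeRiemann_eq` and the denominator by `pullback_det`. -/
theorem planeGaussCurvature_pullback (h : IsPlaneMetricOn G T) (h' : IsPlaneMetricOn G' T')
    {Φ : Plane → Plane} (hm : MapsTo Φ T' T) (hΦ : ContDiffOn ℝ ∞ Φ T')
    (hJ : ∀ y ∈ T', (fderiv ℝ Φ y).IsInvertible)
    (hp : ∀ y ∈ T', ∀ v w, G' y v w = G (Φ y) (fderiv ℝ Φ y v) (fderiv ℝ Φ y w))
    {y : Plane} (hy : y ∈ T') :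
    planeGaussCurvature G' y = planeGaussCurvature G (Φ y) := by
  have hD := det_pos (h.symm _ (hm hy)) (h.pos _ (hm hy))
  have hD' := det_pos (h'.symm _ hy) (h'.pos _ hy)
  rw [hp y hy, hp y hy, hp y hy, pullback_det _ (h.symm _ (hm hy))] at hD'
  -- The squared Jacobian is the ratio of two positive metric determinants.
  have hJ2 := (pos_iff_pos_of_mul_pos hD').2 hD
  rw [planeGaussCurvature, planeGaussCurvature, hp y hy, hp y hy, hp y hy, hp y hy,
    pullback_det _ (h.symm _ (hm hy)), h.planeRiemann_pullback h' hm hΦ hJ hp hy,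
    h.metric_planeRiemann_eq (hm hy), ← sq, mul_div_mul_left _ _ hJ2.ne']

end IsPlaneMetricOn

/-! ### Second-order operators -/

section Operators

variable {Z : Type*} [NormedAddCommGroup Z] [NormedSpace ℝ Z]

/-- The derivative in the direction of a constant vector field. -/
def dirDeriv (v : Z) (f : Z → ℝ) (z : Z) : ℝ := fderiv ℝ f z v

/-- The coefficients of the operator
`a ∂₀∂₀ + 2 b ∂₀∂₁ + c ∂₁∂₁ + p ∂₀ + q ∂₁`, where `∂ᵢ` is the derivative along `eᵢ`. -/
structure SecondOrder (Z : Type*) where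
  (a b c p q : Z → ℝ)
  (e₀ e₁ : Z)

namespace SecondOrder

/-- The differential operator with the given coefficients. -/
def op (L : SecondOrder Z) (f : Z → ℝ) (z : Z) : ℝ :=
  L.a z * dirDeriv L.e₀ (dirDeriv L.e₀ f) z + 2 * L.b z * dirDeriv L.e₀ (dirDeriv L.e₁ f) z
    + L.c z * dirDeriv L.e₁ (dirDeriv L.e₁ f) z + L.p z * dirDeriv L.e₀ f z
    + L.q z * dirDeriv L.e₁ f z

/-- The principal symbol applied to two differentials. -/
def pair (L : SecondOrder Z) (f g : Z → ℝ) (z : Z) : ℝ :=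
  L.a z * (dirDeriv L.e₀ f z * dirDeriv L.e₀ g z)
    + L.b z * (dirDeriv L.e₀ f z * dirDeriv L.e₁ g z + dirDeriv L.e₁ f z * dirDeriv L.e₀ g z)
    + L.c z * (dirDeriv L.e₁ f z * dirDeriv L.e₁ g z)

/-- Smoothness of the coefficients. -/
structure SmoothOn (L : SecondOrder Z) (W : Set Z) : Prop where
  a : ContDiffOn ℝ ∞ L.a W
  b : ContDiffOn ℝ ∞ L.b W
  c : ContDiffOn ℝ ∞ L.c W
  p : ContDiffOn ℝ ∞ L.p W
  q : ContDiffOn ℝ ∞ L.q W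

end SecondOrder

variable {W : Set Z} {f g : Z → ℝ}

theorem contDiffOn_dirDeriv (hW : IsOpen W) (hf : ContDiffOn ℝ ∞ f W) (v : Z) :
    ContDiffOn ℝ ∞ (dirDeriv v f) W :=
  (hf.fderiv_of_isOpen hW (m := ∞) (by simp)).clm_apply contDiffOn_const

theorem differentiableAt_of_smoothOn (hW : IsOpen W) (hf : ContDiffOn ℝ ∞ f W) {z : Z}
    (hz : z ∈ W) : DifferentiableAt ℝ f z :=
  (hf.contDiffAt (hW.mem_nhds hz)).differentiableAt (by simp)

theorem dirDeriv_congr (hW : IsOpen W) (h : EqOn f g W) (v : Z) :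
    EqOn (dirDeriv v f) (dirDeriv v g) W := fun z hz => by
  have : f =ᶠ[𝓝 z] g := by filter_upwards [hW.mem_nhds hz] with x hx using h hx
  rw [dirDeriv, dirDeriv, this.fderiv_eq]

theorem dirDeriv_add (hf : DifferentiableAt ℝ f z) (hg : DifferentiableAt ℝ g z) (v : Z) :
    dirDeriv v (fun x => f x + g x) z = dirDeriv v f z + dirDeriv v g z := by
  simp [dirDeriv, fderiv_fun_add hf hg]

theorem dirDeriv_sub (hf : DifferentiableAt ℝ f z) (hg : DifferentiableAt ℝ g z) (v : Z) :
    dirDeriv v (fun x => f x - g x) z = dirDeriv v f z - dirDeriv v g z := by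
  simp [dirDeriv, fderiv_fun_sub hf hg]

theorem dirDeriv_mul (hf : DifferentiableAt ℝ f z) (hg : DifferentiableAt ℝ g z) (v : Z) :
    dirDeriv v (fun x => f x * g x) z = dirDeriv v f z * g z + f z * dirDeriv v g z := by
  simp [dirDeriv, fderiv_fun_mul hf hg]
  ring

theorem dirDeriv_const_mul (hf : DifferentiableAt ℝ f z) (c : ℝ) (v : Z) :
    dirDeriv v (fun x => c * f x) z = c * dirDeriv v f z := by
  simp [dirDeriv, fderiv_const_mul hf]

theorem dirDeriv_inv (hf : DifferentiableAt ℝ f z) (h0 : f z ≠ 0) (v : Z) :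
    dirDeriv v (fun x => (f x)⁻¹) z = -dirDeriv v f z / f z ^ 2 := by
  have h : fderiv ℝ (fun x => (f x)⁻¹) z = _ :=
    ((hasDerivAt_inv h0).comp_hasFDerivAt z hf.hasFDerivAt).fderiv
  simp [dirDeriv, h]
  ring

theorem dirDeriv_comm (hW : IsOpen W) (hf : ContDiffOn ℝ ∞ f W) {z : Z} (hz : z ∈ W) (v w : Z) :
    dirDeriv v (dirDeriv w f) z = dirDeriv w (dirDeriv v f) z := by
  have h1 := hf.contDiffAt (hW.mem_nhds hz)
  have h2 := ((h1.fderiv_right (m := ∞) (by simp)).differentiableAt (by simp)).hasFDerivAt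
  have h3 := (h2.clm_apply (hasFDerivAt_const v z)).fderiv
  have h4 := (h2.clm_apply (hasFDerivAt_const w z)).fderiv
  have h5 : fderiv ℝ (fderiv ℝ f) z v w = fderiv ℝ (fderiv ℝ f) z w v :=
    (h1.isSymmSndFDerivAt (by simp; exact two_le_infty)) v w
  unfold dirDeriv
  rw [h3, h4]
  simpa using h5

namespace SecondOrder

variable {L : SecondOrder Z}

theorem contDiffOn_pair (hL : L.SmoothOn W) (hW : IsOpen W) (hf : ContDiffOn ℝ ∞ f W)
    (hg : ContDiffOn ℝ ∞ g W) : ContDiffOn ℝ ∞ (L.pair f g) W := by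
  have f0 := contDiffOn_dirDeriv hW hf L.e₀
  have f1 := contDiffOn_dirDeriv hW hf L.e₁
  have g0 := contDiffOn_dirDeriv hW hg L.e₀
  have g1 := contDiffOn_dirDeriv hW hg L.e₁
  exact ((hL.a.mul (f0.mul g0)).add (hL.b.mul ((f0.mul g1).add (f1.mul g0)))).add
    (hL.c.mul (f1.mul g1))

theorem contDiffOn_op (hL : L.SmoothOn W) (hW : IsOpen W) (hf : ContDiffOn ℝ ∞ f W) :
    ContDiffOn ℝ ∞ (L.op f) W := by
  have f0 := contDiffOn_dirDeriv hW hf L.e₀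
  have f1 := contDiffOn_dirDeriv hW hf L.e₁
  have f00 := contDiffOn_dirDeriv hW f0 L.e₀
  have f01 := contDiffOn_dirDeriv hW f1 L.e₀
  have f11 := contDiffOn_dirDeriv hW f1 L.e₁
  exact ((((hL.a.mul f00).add ((contDiffOn_const.mul hL.b).mul f01)).add (hL.c.mul f11)).add
    (hL.p.mul f0)).add (hL.q.mul f1)

theorem pair_congr {f' g' : Z → ℝ} (hW : IsOpen W) (hf : EqOn f f' W) (hg : EqOn g g' W) :
    EqOn (L.pair f g) (L.pair f' g') W := fun z hz => by
  simp only [pair, dirDeriv_congr hW hf _ hz, dirDeriv_congr hW hg _ hz]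

theorem op_congr {f' : Z → ℝ} (hW : IsOpen W) (hf : EqOn f f' W) :
    EqOn (L.op f) (L.op f') W := fun z hz => by
  simp only [op, dirDeriv_congr hW hf _ hz, dirDeriv_congr hW (dirDeriv_congr hW hf _) _ hz]

theorem pair_mul_right {h : Z → ℝ} {z : Z} (hg : DifferentiableAt ℝ g z)
    (hh : DifferentiableAt ℝ h z) :
    L.pair f (fun x => g x * h x) z = L.pair f g z * h z + g z * L.pair f h z := by
  simp only [pair, dirDeriv_mul hg hh]
  ring

theorem pair_add_left {h : Z → ℝ} {z : Z} (hf : DifferentiableAt ℝ f z)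
    (hg : DifferentiableAt ℝ g z) :
    L.pair (fun x => f x + g x) h z = L.pair f h z + L.pair g h z := by
  simp only [pair, dirDeriv_add hf hg]
  ring

theorem op_add (hW : IsOpen W) (hf : ContDiffOn ℝ ∞ f W) (hg : ContDiffOn ℝ ∞ g W) {z : Z}
    (hz : z ∈ W) : L.op (fun x => f x + g x) z = L.op f z + L.op g z := by
  have h : ∀ v, EqOn (dirDeriv v fun x => f x + g x) (fun x => dirDeriv v f x + dirDeriv v g x) W :=
    fun v x hx => dirDeriv_add (differentiableAt_of_smoothOn hW hf hx)
      (differentiableAt_of_smoothOn hW hg hx) v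
  have h2 : ∀ v w, dirDeriv w (dirDeriv v fun x => f x + g x) z =
      dirDeriv w (dirDeriv v f) z + dirDeriv w (dirDeriv v g) z := fun v w => by
    rw [dirDeriv_congr hW (h v) w hz, dirDeriv_add
      (differentiableAt_of_smoothOn hW (contDiffOn_dirDeriv hW hf v) hz)
      (differentiableAt_of_smoothOn hW (contDiffOn_dirDeriv hW hg v) hz)]
  simp only [op, h2, h _ hz]
  ring

theorem op_const_mul (hW : IsOpen W) (hf : ContDiffOn ℝ ∞ f W) (c : ℝ) {z : Z}
    (hz : z ∈ W) : L.op (fun x => c * f x) z = c * L.op f z := by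
  have h : ∀ v, EqOn (dirDeriv v fun x => c * f x) (fun x => c * dirDeriv v f x) W :=
    fun v x hx => dirDeriv_const_mul (differentiableAt_of_smoothOn hW hf hx) c v
  have h2 : ∀ v w, dirDeriv w (dirDeriv v fun x => c * f x) z =
      c * dirDeriv w (dirDeriv v f) z := fun v w => by
    rw [dirDeriv_congr hW (h v) w hz, dirDeriv_const_mul
      (differentiableAt_of_smoothOn hW (contDiffOn_dirDeriv hW hf v) hz)]
  simp only [op, h2, h _ hz]
  ring

/-- A direction along which the coefficients are constant commutes with the principal symbol. -/
theorem dirDeriv_pair (hL : L.SmoothOn W) (hW : IsOpen W) (hf : ContDiffOn ℝ ∞ f W)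
    (hg : ContDiffOn ℝ ∞ g W) {z : Z} (hz : z ∈ W) {v : Z} (ha : dirDeriv v L.a z = 0)
    (hb : dirDeriv v L.b z = 0) (hc : dirDeriv v L.c z = 0) :
    dirDeriv v (L.pair f g) z = L.pair (dirDeriv v f) g z + L.pair f (dirDeriv v g) z := by
  have d : ∀ {k : Z → ℝ}, ContDiffOn ℝ ∞ k W → DifferentiableAt ℝ k z :=
    fun hk => differentiableAt_of_smoothOn hW hk hz
  have f0 := d (contDiffOn_dirDeriv hW hf L.e₀)
  have f1 := d (contDiffOn_dirDeriv hW hf L.e₁)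
  have g0 := d (contDiffOn_dirDeriv hW hg L.e₀)
  have g1 := d (contDiffOn_dirDeriv hW hg L.e₁)
  have a := d hL.a
  have b := d hL.b
  have c := d hL.c
  have e : L.pair f g = fun z => L.a z * (dirDeriv L.e₀ f z * dirDeriv L.e₀ g z)
    + L.b z * (dirDeriv L.e₀ f z * dirDeriv L.e₁ g z + dirDeriv L.e₁ f z * dirDeriv L.e₀ g z)
    + L.c z * (dirDeriv L.e₁ f z * dirDeriv L.e₁ g z) := rfl
  rw [e, dirDeriv_add ((a.fun_mul (f0.fun_mul g0)).fun_add (b.fun_mul ((f0.fun_mul g1).fun_add (f1.fun_mul g0))))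
      (c.fun_mul (f1.fun_mul g1)), dirDeriv_add (a.fun_mul (f0.fun_mul g0)) (b.fun_mul ((f0.fun_mul g1).fun_add (f1.fun_mul g0))),
    dirDeriv_mul a (f0.fun_mul g0), dirDeriv_mul b ((f0.fun_mul g1).fun_add (f1.fun_mul g0)),
    dirDeriv_mul c (f1.fun_mul g1), dirDeriv_add (f0.fun_mul g1) (f1.fun_mul g0), dirDeriv_mul f0 g0,
    dirDeriv_mul f1 g0, dirDeriv_mul f0 g1, dirDeriv_mul f1 g1, ha, hb, hc]
  simp only [pair, dirDeriv_comm hW hf hz _ v, dirDeriv_comm hW hg hz _ v]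
  ring

/-- A direction along which the coefficients are constant commutes with the operator. -/
theorem dirDeriv_op (hL : L.SmoothOn W) (hW : IsOpen W) (hf : ContDiffOn ℝ ∞ f W)
    {z : Z} (hz : z ∈ W) {v : Z} (ha : dirDeriv v L.a z = 0)
    (hb : dirDeriv v L.b z = 0) (hc : dirDeriv v L.c z = 0) (hp : dirDeriv v L.p z = 0)
    (hq : dirDeriv v L.q z = 0) :
    dirDeriv v (L.op f) z = L.op (dirDeriv v f) z := by
  have d : ∀ {k : Z → ℝ}, ContDiffOn ℝ ∞ k W → DifferentiableAt ℝ k z :=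
    fun hk => differentiableAt_of_smoothOn hW hk hz
  have hf0 := contDiffOn_dirDeriv hW hf L.e₀
  have hf1 := contDiffOn_dirDeriv hW hf L.e₁
  have f0 := d hf0
  have f1 := d hf1
  have f00 := d (contDiffOn_dirDeriv hW hf0 L.e₀)
  have f01 := d (contDiffOn_dirDeriv hW hf1 L.e₀)
  have f11 := d (contDiffOn_dirDeriv hW hf1 L.e₁)
  have a := d hL.a
  have b := d hL.b
  have c := d hL.c
  have p := d hL.p
  have q := d hL.q
  have b2 : DifferentiableAt ℝ (fun z => 2 * L.b z) z := b.const_mul 2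
  have e : L.op f = fun z => L.a z * dirDeriv L.e₀ (dirDeriv L.e₀ f) z
    + 2 * L.b z * dirDeriv L.e₀ (dirDeriv L.e₁ f) z
    + L.c z * dirDeriv L.e₁ (dirDeriv L.e₁ f) z + L.p z * dirDeriv L.e₀ f z
    + L.q z * dirDeriv L.e₁ f z := rfl
  -- The inner exchange of derivatives must hold near `z`, not only at `z`, before it is
  -- differentiated; hence the passage through `dirDeriv_congr`.
  have s : ∀ w w', dirDeriv v (dirDeriv w (dirDeriv w' f)) z =
      dirDeriv w (dirDeriv w' (dirDeriv v f)) z := fun w w' => by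
    rw [dirDeriv_comm hW (contDiffOn_dirDeriv hW hf w') hz]
    exact dirDeriv_congr hW (fun x hx => dirDeriv_comm hW hf hx _ _) w hz
  rw [e, dirDeriv_add ((((a.fun_mul f00).fun_add (b2.fun_mul f01)).fun_add (c.fun_mul f11)).fun_add (p.fun_mul f0))
      (q.fun_mul f1), dirDeriv_add (((a.fun_mul f00).fun_add (b2.fun_mul f01)).fun_add (c.fun_mul f11)) (p.fun_mul f0),
    dirDeriv_add ((a.fun_mul f00).fun_add (b2.fun_mul f01)) (c.fun_mul f11),
    dirDeriv_add (a.fun_mul f00) (b2.fun_mul f01), dirDeriv_mul a f00, dirDeriv_mul b2 f01,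
    dirDeriv_mul c f11, dirDeriv_mul p f0, dirDeriv_mul q f1, dirDeriv_const_mul b, ha, hb, hc,
    hp, hq, s, s, s]
  simp only [op, dirDeriv_comm hW hf hz _ v]
  ring

end SecondOrder

end Operators

/-! ### The Laplacian of a planar metric and the conformal change of the Gauss curvature -/

/-- A component of a planar metric. -/
def metricComp (G : Plane → Plane →L[ℝ] Plane →L[ℝ] ℝ) (i j : Fin 2) (y : Plane) : ℝ :=
  G y (basisVec i) (basisVec j)

/-- The determinant of a planar metric. -/
def metricDet (G : Plane → Plane →L[ℝ] Plane →L[ℝ] ℝ) (y : Plane) : ℝ :=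
  metricComp G 0 0 y * metricComp G 1 1 y - metricComp G 0 1 y ^ 2

/-- The derivative along a basis vector. -/
abbrev partialDeriv (i : Fin 2) (f : Plane → ℝ) : Plane → ℝ := dirDeriv (basisVec i) f

/-- The Laplace-Beltrami operator of a planar metric. -/
def planeLaplacian (G : Plane → Plane →L[ℝ] Plane →L[ℝ] ℝ) : SecondOrder Plane where
  a y := metricComp G 1 1 y / metricDet G y
  b y := -metricComp G 0 1 y / metricDet G y
  c y := metricComp G 0 0 y / metricDet G y
  p y := (partialDeriv 0 (metricComp G 1 1) y - partialDeriv 1 (metricComp G 0 1) y) / metricDet G y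
    - (partialDeriv 0 (metricDet G) y * metricComp G 1 1 y
      - partialDeriv 1 (metricDet G) y * metricComp G 0 1 y) / (2 * metricDet G y ^ 2)
  q y := (partialDeriv 1 (metricComp G 0 0) y - partialDeriv 0 (metricComp G 0 1) y) / metricDet G y
    - (partialDeriv 1 (metricDet G) y * metricComp G 0 0 y
      - partialDeriv 0 (metricDet G) y * metricComp G 0 1 y) / (2 * metricDet G y ^ 2)
  e₀ := basisVec 0
  e₁ := basisVec 1

theorem dirDeriv_exp_mul {w f : Plane → ℝ} {y : Plane} (hw : DifferentiableAt ℝ w y)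
    (hf : DifferentiableAt ℝ f y) (v : Plane) :
    dirDeriv v (fun x => Real.exp (2 * w x) * f x) y =
      Real.exp (2 * w y) * (2 * dirDeriv v w y * f y + dirDeriv v f y) := by
  have h : dirDeriv v (fun x => Real.exp (2 * w x)) y =
      Real.exp (2 * w y) * (2 * dirDeriv v w y) := by
    have h : fderiv ℝ (fun x => Real.exp (2 * w x)) y = _ :=
      ((hw.hasFDerivAt.const_mul 2).exp).fderiv
    simp [dirDeriv, h]
  rw [dirDeriv_mul ((hw.const_mul 2).exp) hf, h]
  ring

theorem dirDeriv_sqrt {f : Plane → ℝ} {y : Plane} (hf : DifferentiableAt ℝ f y)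
    (h0 : f y ≠ 0) (v : Plane) :
    dirDeriv v (fun x => √(f x)) y = dirDeriv v f y / (2 * √(f y)) := by
  have h : fderiv ℝ (fun x => √(f x)) y = _ := (hf.hasFDerivAt.sqrt h0).fderiv
  simp [dirDeriv, h]
  ring

namespace IsPlaneMetricOn

variable {G : Plane → Plane →L[ℝ] Plane →L[ℝ] ℝ} {T : Set Plane}

theorem contDiffOn_metricComp (h : IsPlaneMetricOn G T) (i j : Fin 2) :
    ContDiffOn ℝ ∞ (metricComp G i j) T :=
  (h.smooth.clm_apply contDiffOn_const).clm_apply contDiffOn_const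

theorem contDiffOn_metricDet (h : IsPlaneMetricOn G T) : ContDiffOn ℝ ∞ (metricDet G) T :=
  ((h.contDiffOn_metricComp 0 0).mul (h.contDiffOn_metricComp 1 1)).sub
    ((h.contDiffOn_metricComp 0 1).pow 2)

theorem metricDet_pos (h : IsPlaneMetricOn G T) {y : Plane} (hy : y ∈ T) : 0 < metricDet G y :=
  det_pos (h.symm y hy) (h.pos y hy)

theorem smoothOn_planeLaplacian (h : IsPlaneMetricOn G T) : (planeLaplacian G).SmoothOn T := by
  have c := h.contDiffOn_metricComp
  have d := h.contDiffOn_metricDet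
  have c' := fun i j k => contDiffOn_dirDeriv h.isOpen (c i j) (basisVec k)
  have d' := fun k => contDiffOn_dirDeriv h.isOpen d (basisVec k)
  have d0 : ∀ y ∈ T, metricDet G y ≠ 0 := fun y hy => (h.metricDet_pos hy).ne'
  have d2 : ∀ y ∈ T, 2 * metricDet G y ^ 2 ≠ 0 := fun y hy => by simp [d0 y hy]
  exact ⟨(c 1 1).div d d0, (c 0 1).neg.div d d0, (c 0 0).div d d0,
    (((c' 1 1 0).sub (c' 0 1 1)).div d d0).sub
      ((((d' 0).mul (c 1 1)).sub ((d' 1).mul (c 0 1))).div (contDiffOn_const.mul (d.pow 2)) d2),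
    (((c' 0 0 1).sub (c' 0 1 0)).div d d0).sub
      ((((d' 1).mul (c 0 0)).sub ((d' 0).mul (c 0 1))).div (contDiffOn_const.mul (d.pow 2)) d2)⟩

theorem fderiv_apply (h : IsPlaneMetricOn G T) {y : Plane} (hy : y ∈ T) (v : Plane)
    (i j : Fin 2) :
    fderiv ℝ G y v (basisVec i) (basisVec j) = dirDeriv v (metricComp G i j) y := by
  have hG := ((h.contDiffAt hy).differentiableAt (by simp)).hasFDerivAt
  have h1 : fderiv ℝ (metricComp G i j) y = _ := ((hG.clm_apply (hasFDerivAt_const _ y)).clm_apply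
    (hasFDerivAt_const _ y)).fderiv
  simp [dirDeriv, h1]

theorem fderiv_fderiv_apply (h : IsPlaneMetricOn G T) {y : Plane} (hy : y ∈ T) (v w : Plane)
    (i j : Fin 2) : fderiv ℝ (fderiv ℝ G) y v w (basisVec i) (basisVec j) =
      dirDeriv v (dirDeriv w (metricComp G i j)) y := by
  have h1 := (h.hasFDerivAt_fderiv_apply hy w (basisVec i) (basisVec j)).fderiv
  rw [← dirDeriv_congr h.isOpen (fun x hx => h.fderiv_apply hx w i j) v hy, dirDeriv, h1]
  simp

/-- `Γ` is the vector dual to the Koszul form, so its inner products are those of covectors. This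
expresses the quadratic part of the curvature in first derivatives of the metric. -/
theorem metric_christoffel_christoffel (h : IsPlaneMetricOn G T) {y : Plane} (hy : y ∈ T)
    (v w v' w' : Plane) :
    G y (christoffelMap G y v w) (christoffelMap G y v' w') =
      (metricComp G 1 1 y * (planeKoszul G y v w (basisVec 0) * planeKoszul G y v' w' (basisVec 0))
        - metricComp G 0 1 y *
          (planeKoszul G y v w (basisVec 0) * planeKoszul G y v' w' (basisVec 1)
          + planeKoszul G y v w (basisVec 1) * planeKoszul G y v' w' (basisVec 0))
        + metricComp G 0 0 y *
          (planeKoszul G y v w (basisVec 1) * planeKoszul G y v' w' (basisVec 1))) /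
      metricDet G y := by
  rw [christoffelMap_apply, christoffelMap_apply]
  exact dual_inner_eq (h.symm y hy) (h.pos y hy) _ _

theorem planeKoszul_apply (h : IsPlaneMetricOn G T) {y : Plane} (hy : y ∈ T) (i j k : Fin 2) :
    planeKoszul G y (basisVec i) (basisVec j) (basisVec k) =
      1 / 2 * (partialDeriv i (metricComp G j k) y + partialDeriv j (metricComp G i k) y
        - partialDeriv k (metricComp G i j) y) := by
  simp only [partialDeriv, ← h.fderiv_apply hy]
  simp [planeKoszul]

theorem partialDeriv_metricComp_symm (h : IsPlaneMetricOn G T) {y : Plane} (hy : y ∈ T) (v : Plane) :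
    dirDeriv v (metricComp G 1 0) y = dirDeriv v (metricComp G 0 1) y :=
  dirDeriv_congr h.isOpen (fun x hx => h.symm x hx _ _) v hy

/-- Brioschi's formula for the Gauss curvature. -/
theorem planeGaussCurvature_eq (h : IsPlaneMetricOn G T) {y : Plane} (hy : y ∈ T) :
    planeGaussCurvature G y =
      (partialDeriv 0 (partialDeriv 1 (metricComp G 0 1)) y
        - 1 / 2 * partialDeriv 0 (partialDeriv 0 (metricComp G 1 1)) y
        - 1 / 2 * partialDeriv 1 (partialDeriv 1 (metricComp G 0 0)) y
        - (metricComp G 1 1 y * (1 / 2 * partialDeriv 0 (metricComp G 0 0) y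
              * (partialDeriv 1 (metricComp G 0 1) y - 1 / 2 * partialDeriv 0 (metricComp G 1 1) y))
            - metricComp G 0 1 y * (1 / 2 * partialDeriv 0 (metricComp G 0 0) y
                * (1 / 2 * partialDeriv 1 (metricComp G 1 1) y)
              + (partialDeriv 0 (metricComp G 0 1) y - 1 / 2 * partialDeriv 1 (metricComp G 0 0) y)
                * (partialDeriv 1 (metricComp G 0 1) y
                  - 1 / 2 * partialDeriv 0 (metricComp G 1 1) y))
            + metricComp G 0 0 y * ((partialDeriv 0 (metricComp G 0 1) y
                - 1 / 2 * partialDeriv 1 (metricComp G 0 0) y)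
              * (1 / 2 * partialDeriv 1 (metricComp G 1 1) y))) / metricDet G y
        + (metricComp G 1 1 y * (1 / 2 * partialDeriv 1 (metricComp G 0 0) y) ^ 2
            - metricComp G 0 1 y * (2 * (1 / 2 * partialDeriv 1 (metricComp G 0 0) y
                * (1 / 2 * partialDeriv 0 (metricComp G 1 1) y)))
            + metricComp G 0 0 y * (1 / 2 * partialDeriv 0 (metricComp G 1 1) y) ^ 2)
          / metricDet G y) / metricDet G y := by
  have hD : G y (basisVec 0) (basisVec 0) * G y (basisVec 1) (basisVec 1)
      - G y (basisVec 0) (basisVec 1) ^ 2 = metricDet G y := rfl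
  rw [planeGaussCurvature, hD, h.metric_planeRiemann hy]
  simp only [h.metric_christoffel_christoffel hy, h.planeKoszul_apply hy]
  rw [h.fderiv_fderiv_symm hy (basisVec 0) (basisVec 1) (basisVec 1) (basisVec 0),
    h.fderiv_fderiv_comm hy (basisVec 1) (basisVec 0)]
  simp only [h.fderiv_fderiv_apply hy, partialDeriv, h.partialDeriv_metricComp_symm hy]
  ring

/-- A conformal change of a metric. -/
theorem conformal (h : IsPlaneMetricOn G T) {w : Plane → ℝ} (hw : ContDiffOn ℝ ∞ w T) :
    IsPlaneMetricOn (fun y => Real.exp (2 * w y) • G y) T where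
  isOpen := h.isOpen
  smooth := (contDiffOn_const.mul hw).exp.smul h.smooth
  symm y hy v v' := by simp [h.symm y hy v v']
  pos y hy v hv := by
    have := h.pos y hy v hv
    simp only [smul_apply, smul_eq_mul]
    positivity

/-- The conformal change of the Gauss curvature. -/
theorem planeGaussCurvature_conformal (h : IsPlaneMetricOn G T) {w : Plane → ℝ}
    (hw : ContDiffOn ℝ ∞ w T) {y : Plane} (hy : y ∈ T) :
    Real.exp (2 * w y) * planeGaussCurvature (fun y => Real.exp (2 * w y) • G y) y =
      planeGaussCurvature G y - (planeLaplacian G).op w y := by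
  have hD := h.metricDet_pos hy
  have hc : ∀ i j, metricComp (fun y => Real.exp (2 * w y) • G y) i j =
      fun y => Real.exp (2 * w y) * metricComp G i j y := fun i j => by
    ext x
    simp [metricComp]
  have hD' : metricDet (fun y => Real.exp (2 * w y) • G y) y =
      Real.exp (2 * w y) ^ 2 * metricDet G y := by
    simp only [metricDet, hc]
    ring
  have dw : ∀ {x}, x ∈ T → DifferentiableAt ℝ w x :=
    fun hx => differentiableAt_of_smoothOn h.isOpen hw hx
  have dw' : ∀ v, DifferentiableAt ℝ (dirDeriv v w) y :=
    fun v => differentiableAt_of_smoothOn h.isOpen (contDiffOn_dirDeriv h.isOpen hw v) hy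
  have dc : ∀ {x}, x ∈ T → ∀ i j, DifferentiableAt ℝ (metricComp G i j) x :=
    fun hx i j => differentiableAt_of_smoothOn h.isOpen (h.contDiffOn_metricComp i j) hx
  have dc' : ∀ v i j, DifferentiableAt ℝ (dirDeriv v (metricComp G i j)) y :=
    fun v i j => differentiableAt_of_smoothOn h.isOpen
      (contDiffOn_dirDeriv h.isOpen (h.contDiffOn_metricComp i j) v) hy
  have h1 : ∀ v i j, EqOn (dirDeriv v fun x => Real.exp (2 * w x) * metricComp G i j x)
      (fun x => Real.exp (2 * w x) *
        (2 * dirDeriv v w x * metricComp G i j x + dirDeriv v (metricComp G i j) x)) T :=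
    fun v i j x hx => dirDeriv_exp_mul (dw hx) (dc hx i j) v
  have h2 : ∀ u v i j, dirDeriv u (dirDeriv v fun x => Real.exp (2 * w x) * metricComp G i j x) y =
      Real.exp (2 * w y) * (2 * dirDeriv u w y *
        (2 * dirDeriv v w y * metricComp G i j y + dirDeriv v (metricComp G i j) y)
        + (2 * dirDeriv u (dirDeriv v w) y * metricComp G i j y
          + 2 * dirDeriv v w y * dirDeriv u (metricComp G i j) y
          + dirDeriv u (dirDeriv v (metricComp G i j)) y)) := fun u v i j => by
    rw [dirDeriv_congr h.isOpen (h1 v i j) u hy, dirDeriv_exp_mul (dw hy)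
        ((((dw' v).const_mul 2).fun_mul (dc hy i j)).fun_add (dc' v i j)),
      dirDeriv_add (((dw' v).const_mul 2).fun_mul (dc hy i j)) (dc' v i j),
      dirDeriv_mul ((dw' v).const_mul 2) (dc hy i j), dirDeriv_const_mul (dw' v)]
  have h3 : ∀ i, partialDeriv i (metricDet G) y =
      partialDeriv i (metricComp G 0 0) y * metricComp G 1 1 y
        + metricComp G 0 0 y * partialDeriv i (metricComp G 1 1) y
        - 2 * metricComp G 0 1 y * partialDeriv i (metricComp G 0 1) y := fun i => by
    have e : metricDet G = fun y => metricComp G 0 0 y * metricComp G 1 1 y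
        - metricComp G 0 1 y * metricComp G 0 1 y := by
      ext x
      rw [metricDet, sq]
    rw [partialDeriv, e, dirDeriv_sub ((dc hy 0 0).fun_mul (dc hy 1 1))
      ((dc hy 0 1).fun_mul (dc hy 0 1)), dirDeriv_mul (dc hy 0 0) (dc hy 1 1),
      dirDeriv_mul (dc hy 0 1) (dc hy 0 1)]
    ring
  rw [(h.conformal hw).planeGaussCurvature_eq hy, h.planeGaussCurvature_eq hy, hD']
  -- Brioschi's formula on both sides now involves only derivatives of `w` and of the components of
  -- `G`. With the exponential and the determinant treated as atoms, the claim is an identity of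
  -- rational functions.
  simp only [SecondOrder.op, planeLaplacian, hc, partialDeriv, h2, h1 _ _ _ hy] at h3 ⊢
  rw [h3, h3]
  have hdet : metricDet G y = metricComp G 0 0 y * metricComp G 1 1 y - metricComp G 0 1 y ^ 2 :=
    rfl
  have hexp := Real.exp_pos (2 * w y)
  generalize Real.exp (2 * w y) = X at *
  generalize hd : metricDet G y = D at *
  field_simp
  rw [hdet]
  ring

/-- The principal symbol of the Laplacian is the inverse metric. -/
theorem metric_gradient (h : IsPlaneMetricOn G T) {y : Plane} (hy : y ∈ T) (f g : Plane → ℝ) :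
    G y ((G y).inverse (fderiv ℝ f y)) ((G y).inverse (fderiv ℝ g y)) =
      (planeLaplacian G).pair f g y := by
  have hD := h.metricDet_pos hy
  rw [dual_inner_eq (h.symm y hy) (h.pos y hy)]
  simp only [SecondOrder.pair, planeLaplacian, dirDeriv]
  change (metricComp G 1 1 y * _ - metricComp G 0 1 y * _ + metricComp G 0 0 y * _) /
    metricDet G y = _
  ring

/-- The Laplacian in divergence form. -/
theorem sqrt_det_mul_op_add_pair (h : IsPlaneMetricOn G T) {y : Plane} (hy : y ∈ T)
    {f g : Plane → ℝ} (hf : ContDiffOn ℝ ∞ f T) (hg : ContDiffOn ℝ ∞ g T) :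
    √(metricDet G y) * (f y * (planeLaplacian G).op g y + (planeLaplacian G).pair f g y) =
      partialDeriv 0 (fun x => f x * ((metricComp G 1 1 x * partialDeriv 0 g x
        - metricComp G 0 1 x * partialDeriv 1 g x) * (√(metricDet G x))⁻¹)) y
      + partialDeriv 1 (fun x => f x * ((metricComp G 0 0 x * partialDeriv 1 g x
        - metricComp G 0 1 x * partialDeriv 0 g x) * (√(metricDet G x))⁻¹)) y := by
  have hD := h.metricDet_pos hy
  have d : ∀ {k : Plane → ℝ}, ContDiffOn ℝ ∞ k T → DifferentiableAt ℝ k y :=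
    fun hk => differentiableAt_of_smoothOn h.isOpen hk hy
  have dc := fun i j => d (h.contDiffOn_metricComp i j)
  have dg := fun i => d (contDiffOn_dirDeriv h.isOpen hg (basisVec i))
  have dD := d h.contDiffOn_metricDet
  have dS := dD.sqrt hD.ne'
  have hS : √(metricDet G y) ≠ 0 := (Real.sqrt_pos.2 hD).ne'
  have dI : DifferentiableAt ℝ (fun x => (√(metricDet G x))⁻¹) y := dS.fun_inv hS
  have hcomm := dirDeriv_comm h.isOpen hg hy (basisVec 1) (basisVec 0)
  have hsq := Real.sq_sqrt hD.le
  -- The flux components `f √det g^{ij} ∂_j g` have this form for `(i, j, k) = (1, 0, 1)` and `(0,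
  -- 1, 0)`. The derivatives falling on `g_ij / √det` produce the first-order coefficients of
  -- `planeLaplacian`.
  have e : ∀ i j k : Fin 2, ∀ v, dirDeriv v (fun x => f x * ((metricComp G i i x * partialDeriv j g x
        - metricComp G 0 1 x * partialDeriv k g x) * (√(metricDet G x))⁻¹)) y =
      dirDeriv v f y * ((metricComp G i i y * partialDeriv j g y
        - metricComp G 0 1 y * partialDeriv k g y) * (√(metricDet G y))⁻¹)
      + f y * ((dirDeriv v (metricComp G i i) y * partialDeriv j g y
          + metricComp G i i y * dirDeriv v (partialDeriv j g) y
          - (dirDeriv v (metricComp G 0 1) y * partialDeriv k g y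
          + metricComp G 0 1 y * dirDeriv v (partialDeriv k g) y)) * (√(metricDet G y))⁻¹
        + (metricComp G i i y * partialDeriv j g y - metricComp G 0 1 y * partialDeriv k g y)
          * (-(dirDeriv v (metricDet G) y / (2 * √(metricDet G y))) / √(metricDet G y) ^ 2)) := by
    intro i j k v
    have d1 := ((dc i i).fun_mul (dg j)).fun_sub ((dc 0 1).fun_mul (dg k))
    rw [dirDeriv_mul (d hf) (d1.fun_mul dI), dirDeriv_mul d1 dI,
      dirDeriv_sub ((dc i i).fun_mul (dg j)) ((dc 0 1).fun_mul (dg k)),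
      dirDeriv_mul (dc i i) (dg j), dirDeriv_mul (dc 0 1) (dg k), dirDeriv_inv dS hS,
      dirDeriv_sqrt dD hD.ne']
  refine Eq.trans ?_ (congrArg₂ (· + ·) (e 1 0 1 _) (e 0 1 0 _)).symm
  clear e dI dS
  simp only [SecondOrder.op, SecondOrder.pair, planeLaplacian, partialDeriv] at hcomm ⊢
  rw [hcomm]
  generalize √(metricDet G y) = S at *
  rw [← hsq]
  field_simp
  ring

end IsPlaneMetricOn

/-! ### Charts -/

section Charts

variable {M : Type*} [TopologicalSpace M] [ChartedSpace Plane M]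

/-- A form field, with the tangent spaces identified with the model plane. -/
def FormField.at (h : FormField M) (x : M) : Plane →L[ℝ] Plane →L[ℝ] ℝ := h x

/-- The differential of the inverse of the chart at `p`. -/
def chartSymmDeriv (p : M) (y : Plane) : Plane →L[ℝ] Plane :=
  mfderiv 𝓘(ℝ, Plane) (𝓡 2) (chartAt Plane p).symm y

/-- The transition map from the chart at `p` to the chart at `q`. -/
def transition (p q : M) (y : Plane) : Plane := chartAt Plane q ((chartAt Plane p).symm y)

/-- The domain of the transition map. -/
def transitionDomain (p q : M) : Set Plane :=
  (chartAt Plane p).target ∩ (chartAt Plane p).symm ⁻¹' (chartAt Plane q).source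

theorem isOpen_transitionDomain (p q : M) : IsOpen (transitionDomain p q) :=
  (chartAt Plane p).isOpen_inter_preimage_symm (chartAt Plane q).open_source

theorem mapsTo_transition (p q : M) :
    MapsTo (transition p q) (transitionDomain p q) (transitionDomain q p) := fun y hy => by
  refine ⟨(chartAt Plane q).map_source hy.2, ?_⟩
  simp only [transition, mem_preimage, (chartAt Plane q).left_inv hy.2]
  exact (chartAt Plane p).map_target hy.1

theorem transition_transition {p q : M} {y : Plane} (hy : y ∈ transitionDomain p q) :
    transition q p (transition p q y) = y := by
  rw [transition, transition, (chartAt Plane q).left_inv hy.2, (chartAt Plane p).right_inv hy.1]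

theorem symm_transition {p q : M} {y : Plane} (hy : y ∈ transitionDomain p q) :
    (chartAt Plane q).symm (transition p q y) = (chartAt Plane p).symm y :=
  (chartAt Plane q).left_inv hy.2

theorem coordMetric_apply (h : FormField M) (p : M) (y v w : Plane) :
    coordMetric h p y v w =
      h.at ((chartAt Plane p).symm y) (chartSymmDeriv p y v) (chartSymmDeriv p y w) := rfl

variable [IsManifold (𝓡 2) ∞ M]

theorem mdifferentiableAt_chart_symm (p : M) {y : Plane} (hy : y ∈ (chartAt Plane p).target) :
    MDifferentiableAt 𝓘(ℝ, Plane) (𝓡 2) (chartAt Plane p).symm y :=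
  have : IsManifold (𝓡 2) 1 M := .of_le (n := ∞) (by simp)
  (mdifferentiable_chart (I := 𝓡 2) p).mdifferentiableAt_symm hy

theorem mdifferentiableAt_chart (p : M) {x : M} (hx : x ∈ (chartAt Plane p).source) :
    MDifferentiableAt (𝓡 2) 𝓘(ℝ, Plane) (chartAt Plane p) x :=
  have : IsManifold (𝓡 2) 1 M := .of_le (n := ∞) (by simp)
  (mdifferentiable_chart (I := 𝓡 2) p).mdifferentiableAt hx

theorem isInvertible_chartSymmDeriv (p : M) {y : Plane} (hy : y ∈ (chartAt Plane p).target) :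
    (chartSymmDeriv p y).IsInvertible :=
  have : IsManifold (𝓡 2) 1 M := .of_le (n := ∞) (by simp)
  ⟨(mdifferentiable_chart (I := 𝓡 2) p).symm.mfderiv hy, rfl⟩

theorem contDiffOn_transition (p q : M) :
    ContDiffOn ℝ ∞ (transition p q) (transitionDomain p q) := by
  rw [← contMDiffOn_iff_contDiffOn]
  exact (contMDiffOn_chart (I := 𝓡 2) (n := ∞) (x := q)).comp
    ((contMDiffOn_chart_symm (I := 𝓡 2) (n := ∞) (x := p)).mono inter_subset_left)
    fun y hy => hy.2

theorem chartSymmDeriv_transition {p q : M} {y : Plane} (hy : y ∈ transitionDomain p q)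
    (v : Plane) :
    chartSymmDeriv q (transition p q y) (fderiv ℝ (transition p q) y v) =
      chartSymmDeriv p y v := by
  have hd : DifferentiableAt ℝ (transition p q) y :=
    ((contDiffOn_transition p q).contDiffAt
      ((isOpen_transitionDomain p q).mem_nhds hy)).differentiableAt (by simp)
  have h1 : MDifferentiableAt 𝓘(ℝ, Plane) 𝓘(ℝ, Plane) (transition p q) y :=
    hd.mdifferentiableAt
  have h2 := mdifferentiableAt_chart_symm q (mapsTo_transition p q hy).1
  have h3 := mfderiv_comp y h2 h1
  have h4 : (chartAt Plane q).symm ∘ transition p q =ᶠ[𝓝 y] (chartAt Plane p).symm := by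
    filter_upwards [(isOpen_transitionDomain p q).mem_nhds hy] with x hx using symm_transition hx
  have h5 : mfderiv 𝓘(ℝ, Plane) (𝓡 2) ((chartAt Plane q).symm ∘ transition p q) y =
    mfderiv 𝓘(ℝ, Plane) (𝓡 2) (chartAt Plane p).symm y := h4.mfderiv_eq
  rw [mfderiv_eq_fderiv] at h3
  have h6 := h3.symm.trans h5
  exact congrArg (fun L : Plane →L[ℝ] Plane => L v) h6

theorem coordMetric_transition (h : FormField M) {p q : M} {y : Plane}
    (hy : y ∈ transitionDomain p q) (v w : Plane) :
    coordMetric h p y v w = coordMetric h q (transition p q y)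
      (fderiv ℝ (transition p q) y v) (fderiv ℝ (transition p q) y w) := by
  rw [coordMetric_apply, coordMetric_apply, chartSymmDeriv_transition hy,
    chartSymmDeriv_transition hy, symm_transition hy]

/-- The derivative of the reverse transition is a two-sided inverse. Both identities are checked
after applying the injective differential of an inverse chart, where they follow from
`chartSymmDeriv_transition`. -/
theorem isInvertible_fderiv_transition {p q : M} {y : Plane} (hy : y ∈ transitionDomain p q) :
    (fderiv ℝ (transition p q) y).IsInvertible := by
  have hy' := mapsTo_transition p q hy
  have e : ∀ v, fderiv ℝ (transition q p) (transition p q y) (fderiv ℝ (transition p q) y v) =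
      v := fun v => by
    apply (isInvertible_chartSymmDeriv p hy.1).injective
    have := chartSymmDeriv_transition hy' (fderiv ℝ (transition p q) y v)
    rw [transition_transition hy] at this
    rw [this, chartSymmDeriv_transition hy]
  have e' : ∀ v, fderiv ℝ (transition p q) y (fderiv ℝ (transition q p) (transition p q y) v) =
      v := fun v => by
    apply (isInvertible_chartSymmDeriv q hy'.1).injective
    have := chartSymmDeriv_transition hy' v
    rw [transition_transition hy] at this
    rw [chartSymmDeriv_transition hy, this]
  exact ⟨.equivOfInverse _ _ e e', rfl⟩

/-- Smoothness of `g₀` is given as smoothness of a bundle section. Evaluating it on the coordinate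
vector fields, which are smooth sections along the inverse chart, gives smooth component functions.
-/
theorem contDiffOn_coordMetric (g₀ : SurfaceMetric M) (p : M) :
    ContDiffOn ℝ ∞ (coordMetric g₀.inner p) (chartAt Plane p).target := by
  have : IsManifold (𝓡 2) 1 M := .of_le (n := ∞) (by simp)
  set T := (chartAt Plane p).target with hT
  have hTo : IsOpen T := (chartAt Plane p).open_target
  have hc : ContMDiffOn 𝓘(ℝ, Plane) (𝓡 2) ∞ (chartAt Plane p).symm T :=
    contMDiffOn_chart_symm (I := 𝓡 2) (n := ∞) (x := p)
  have hu : UniqueMDiffOn 𝓘(ℝ, Plane) T := hTo.uniqueMDiffOn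
  have hvec : ∀ v : Plane, ContMDiffOn 𝓘(ℝ, Plane) ((𝓡 2).prod 𝓘(ℝ, Plane)) ∞
      (fun y => Bundle.TotalSpace.mk' Plane (E := fun x : M => TangentSpace (𝓡 2) x)
        ((chartAt Plane p).symm y) (chartSymmDeriv p y v)) T := by
    intro v
    -- The coordinate field is the tangent map of the inverse chart applied to the constant section
    -- `y ↦ (y, v)`.
    have h1 := hc.contMDiffOn_tangentMapWithin (m := ∞) (by simp) hu
    have h2 : ContMDiffOn 𝓘(ℝ, Plane) (𝓘(ℝ, Plane).prod 𝓘(ℝ, Plane)) ∞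
        (fun y => Bundle.TotalSpace.mk' Plane
          (E := fun x : Plane => TangentSpace 𝓘(ℝ, Plane) x) y v) T :=
      contMDiffOn_vectorSpace_iff_contDiffOn.2 contDiffOn_const
    refine (h1.comp h2 fun y hy => hy).congr fun y hy => ?_
    have := tangentMapWithin_eq_tangentMap (p := (⟨y, v⟩ : TangentBundle 𝓘(ℝ, Plane) Plane))
      (hu y hy) (mdifferentiableAt_chart_symm p hy)
    exact this.symm
  have hcomp : ∀ v w : Plane, ContDiffOn ℝ ∞ (fun y => coordMetric g₀.inner p y v w) T := by
    intro v w
    rw [← contMDiffOn_iff_contDiffOn]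
    have h1 : ContMDiffOn 𝓘(ℝ, Plane) ((𝓡 2).prod 𝓘(ℝ, ℝ)) ∞
        (fun y => Bundle.TotalSpace.mk' ℝ (E := Bundle.Trivial M ℝ) ((chartAt Plane p).symm y)
          (g₀.inner ((chartAt Plane p).symm y) (chartSymmDeriv p y v)
            (chartSymmDeriv p y w) : ℝ)) T := by
      refine ContMDiffOn.clm_bundle_apply₂ (F₁ := Plane) (F₂ := Plane) (F₃ := ℝ)
        (E₁ := fun x : M => TangentSpace (𝓡 2) x) (E₂ := fun x : M => TangentSpace (𝓡 2) x)
        (E₃ := Bundle.Trivial M ℝ) ?_ (hvec v) (hvec w)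
      exact g₀.contMDiff.comp_contMDiffOn hc
    intro y hy
    have h2 := h1 y hy
    rw [Bundle.contMDiffWithinAt_totalSpace] at h2
    exact h2.2
  -- In finite dimension, smoothness of an operator-valued map can be tested on fixed vectors.
  rw [contDiffOn_clm_apply]
  intro v
  rw [contDiffOn_clm_apply]
  exact hcomp v

theorem isPlaneMetricOn_coordMetric (g₀ : SurfaceMetric M) (p : M) :
    IsPlaneMetricOn (coordMetric g₀.inner p) (chartAt Plane p).target where
  isOpen := (chartAt Plane p).open_target
  smooth := contDiffOn_coordMetric g₀ p
  symm _ _ _ _ := g₀.symm _ _ _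
  pos _ hy _ hv := g₀.pos _ _ fun h => hv <|
    (isInvertible_chartSymmDeriv p hy).injective (h.trans (map_zero _).symm)

end Charts

/-! ### Functions, gradients and curvature in charts -/

namespace IsPlaneMetricOn

theorem contDiffOn_planeGaussCurvature {G : Plane → Plane →L[ℝ] Plane →L[ℝ] ℝ} {T : Set Plane}
    (h : IsPlaneMetricOn G T) : ContDiffOn ℝ ∞ (planeGaussCurvature G) T := by
  have hC : ContDiffOn ℝ ∞ (christoffelMap G) T :=
    fun y hy => (h.contDiffAt_christoffelMap hy).contDiffWithinAt
  have hC' := hC.fderiv_of_isOpen h.isOpen (m := ∞) (by simp)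
  have c : ∀ v : Plane, ContDiffOn ℝ ∞ (fun _ : Plane => v) T := fun v => contDiffOn_const
  have hR : ContDiffOn ℝ ∞
      (fun y => planeRiemann G y (basisVec 0) (basisVec 1) (basisVec 1)) T := by
    refine ContDiffOn.congr ?_ fun y hy => h.planeRiemann_eq hy _ _ _
    have a1 := fun v w z => ((hC'.clm_apply (c v)).clm_apply (c w)).clm_apply (c z)
    have a2 := fun v w z => (hC.clm_apply (c v)).clm_apply ((hC.clm_apply (c w)).clm_apply (c z))
    exact (((a1 _ _ _).sub (a1 _ _ _)).add (a2 _ _ _)).sub (a2 _ _ _)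
  exact ((h.smooth.clm_apply hR).clm_apply (c _)).div h.contDiffOn_metricDet
    fun y hy => (h.metricDet_pos hy).ne'

end IsPlaneMetricOn

section Charts

variable {M : Type*} [TopologicalSpace M] [ChartedSpace Plane M]

/-- The coordinate expression of a function in the chart at `p`. -/
def pull (p : M) (f : M → ℝ) (y : Plane) : ℝ := f ((chartAt Plane p).symm y)

theorem pull_chart (p : M) (f : M → ℝ) {x : M} (hx : x ∈ (chartAt Plane p).source) :
    pull p f (chartAt Plane p x) = f x := by
  rw [pull, (chartAt Plane p).left_inv hx]

/-- The differential, with the tangent space identified with the model plane. -/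
def differentialAt (f : M → ℝ) (x : M) : Plane →L[ℝ] ℝ := differential f x

/-- The gradient, with the tangent space identified with the model plane. -/
def gradientAt (h : FormField M) (f : M → ℝ) (x : M) : Plane := surfaceGradient h f x

theorem gradInner_eq (h : FormField M) (f g : M → ℝ) (x : M) :
    gradInner h f g x = h.at x (gradientAt h f x) (gradientAt h g x) := rfl

theorem apply_gradientAt {h : FormField M} {x : M} (hB : ∀ v, v ≠ 0 → 0 < h.at x v v)
    (f : M → ℝ) : h.at x (gradientAt h f x) = differentialAt f x :=
  apply_inverse_apply hB (differentialAt f x)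

variable [IsManifold (𝓡 2) ∞ M]

theorem contDiffOn_pull {f : M → ℝ} (hf : ContMDiff (𝓡 2) 𝓘(ℝ, ℝ) ∞ f) (p : M) :
    ContDiffOn ℝ ∞ (pull p f) (chartAt Plane p).target := by
  rw [← contMDiffOn_iff_contDiffOn]
  exact hf.comp_contMDiffOn (contMDiffOn_chart_symm (I := 𝓡 2) (n := ∞) (x := p))

theorem contMDiff_of_contDiffOn_pull {f : M → ℝ}
    (hf : ∀ p, ContDiffOn ℝ ∞ (pull p f) (chartAt Plane p).target) :
    ContMDiff (𝓡 2) 𝓘(ℝ, ℝ) ∞ f := by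
  intro p
  have h1 : ContMDiffOn (𝓡 2) 𝓘(ℝ, ℝ) ∞ (pull p f ∘ chartAt Plane p) (chartAt Plane p).source :=
    (contMDiffOn_iff_contDiffOn.2 (hf p)).comp
      (contMDiffOn_chart (I := 𝓡 2) (n := ∞) (x := p)) fun x hx => (chartAt Plane p).map_source hx
  refine (h1.congr fun x hx => (pull_chart p f hx).symm).contMDiffAt
    ((chartAt Plane p).open_source.mem_nhds (mem_chart_source _ p))

theorem mdifferentiableAt_of_pull {f : M → ℝ} {p : M} {y : Plane}
    (hy : y ∈ (chartAt Plane p).target) (hf : DifferentiableAt ℝ (pull p f) y) :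
    MDifferentiableAt (𝓡 2) 𝓘(ℝ, ℝ) f ((chartAt Plane p).symm y) := by
  have hx := (chartAt Plane p).map_target hy
  have h1 : MDifferentiableAt 𝓘(ℝ, Plane) 𝓘(ℝ, ℝ) (pull p f)
      (chartAt Plane p ((chartAt Plane p).symm y)) := by
    rw [(chartAt Plane p).right_inv hy]
    exact hf.mdifferentiableAt
  refine (h1.comp _ (mdifferentiableAt_chart p hx)).congr_of_eventuallyEq ?_
  filter_upwards [(chartAt Plane p).open_source.mem_nhds hx] with x hx
  exact (pull_chart p f hx).symm

theorem differentialAt_chartSymmDeriv {f : M → ℝ} {p : M} {y : Plane}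
    (hy : y ∈ (chartAt Plane p).target) (hf : DifferentiableAt ℝ (pull p f) y) (v : Plane) :
    differentialAt f ((chartAt Plane p).symm y) (chartSymmDeriv p y v) =
      fderiv ℝ (pull p f) y v := by
  have h1 := mfderiv_comp y (mdifferentiableAt_of_pull hy hf) (mdifferentiableAt_chart_symm p hy)
  have h2 : mfderiv 𝓘(ℝ, Plane) 𝓘(ℝ, ℝ) (f ∘ (chartAt Plane p).symm) y =
    fderiv ℝ (pull p f) y := mfderiv_eq_fderiv
  exact congrArg (fun L : Plane →L[ℝ] ℝ => L v) (h1.symm.trans h2)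

theorem at_pos (g₀ : SurfaceMetric M) (x : M) (v : Plane) (hv : v ≠ 0) :
    0 < FormField.at g₀.inner x v v := g₀.pos x v hv

theorem conformal_at (g₀ : SurfaceMetric M) (u : M → ℝ) (x : M) :
    (conformal g₀ u).at x = Real.exp (2 * u x) • FormField.at g₀.inner x := rfl

theorem conformal_at_pos (g₀ : SurfaceMetric M) (u : M → ℝ) (x : M) (v : Plane) (hv : v ≠ 0) :
    0 < (conformal g₀ u).at x v v :=
  mul_pos (Real.exp_pos _) (at_pos g₀ x v hv)

/-- The differential of the inverse chart carries the coordinate gradient to the gradient on `M`.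
Only differentiability at `y` is required, so the lemma also applies to functions not yet known to
be smooth on `M`. -/
theorem gradInner_symm (g₀ : SurfaceMetric M) {f g : M → ℝ} {p : M} {y : Plane}
    (hy : y ∈ (chartAt Plane p).target) (hf : DifferentiableAt ℝ (pull p f) y)
    (hg : DifferentiableAt ℝ (pull p g) y) :
    gradInner g₀.inner f g ((chartAt Plane p).symm y) =
      (planeLaplacian (coordMetric g₀.inner p)).pair (pull p f) (pull p g) y := by
  have hG := isPlaneMetricOn_coordMetric g₀ p
  rw [← hG.metric_gradient hy]
  have key : ∀ k : M → ℝ, DifferentiableAt ℝ (pull p k) y →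
      chartSymmDeriv p y ((coordMetric g₀.inner p y).inverse (fderiv ℝ (pull p k) y)) =
        gradientAt g₀.inner k ((chartAt Plane p).symm y) := by
    intro k hk
    apply (isInvertible_of_pos (at_pos g₀ ((chartAt Plane p).symm y))).injective
    rw [apply_gradientAt (at_pos g₀ _)]
    ext z'
    obtain ⟨z, rfl⟩ := (isInvertible_chartSymmDeriv p hy).surjective z'
    rw [differentialAt_chartSymmDeriv hy hk, ← coordMetric_apply,
      apply_inverse_apply (hG.pos y hy)]
  rw [coordMetric_apply, key f hf, key g hg, gradInner_eq]

/-- The gradient scales by `e^{-2u}` and the metric by `e^{2u}`; two gradients and one metric leave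
`e^{-2u}`. -/
theorem gradInner_conformal (g₀ : SurfaceMetric M) (u f g : M → ℝ) (x : M) :
    gradInner (conformal g₀ u) f g x = Real.exp (-(2 * u x)) * gradInner g₀.inner f g x := by
  have hexp : Real.exp (2 * u x) * Real.exp (-(2 * u x)) = 1 := by
    rw [← Real.exp_add, add_neg_cancel, Real.exp_zero]
  have key : ∀ k : M → ℝ, gradientAt (conformal g₀ u) k x =
      Real.exp (-(2 * u x)) • gradientAt g₀.inner k x := by
    intro k
    apply (isInvertible_of_pos (conformal_at_pos g₀ u x)).injective
    rw [apply_gradientAt (conformal_at_pos g₀ u x), conformal_at, smul_apply, map_smul,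
      apply_gradientAt (at_pos g₀ x), smul_smul, hexp, one_smul]
  rw [gradInner_eq, gradInner_eq, key, key, conformal_at]
  simp only [map_smul, smul_apply, smul_eq_mul]
  linear_combination (Real.exp (-(2 * u x)) * FormField.at g₀.inner x (gradientAt g₀.inner f x)
    (gradientAt g₀.inner g x)) * hexp

theorem coordMetric_conformal (g₀ : SurfaceMetric M) (u : M → ℝ) (p : M) :
    coordMetric (conformal g₀ u) p =
      fun y => Real.exp (2 * pull p u y) • coordMetric g₀.inner p y := rfl

theorem isPlaneMetricOn_conformal (g₀ : SurfaceMetric M) {u : M → ℝ}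
    (hu : ContMDiff (𝓡 2) 𝓘(ℝ, ℝ) ∞ u) (p : M) :
    IsPlaneMetricOn (coordMetric (conformal g₀ u) p) (chartAt Plane p).target :=
  (isPlaneMetricOn_coordMetric g₀ p).conformal (contDiffOn_pull hu p)

/-- The Gauss curvature may be computed in any chart. -/
theorem curv_symm (g₀ : SurfaceMetric M) {u : M → ℝ} (hu : ContMDiff (𝓡 2) 𝓘(ℝ, ℝ) ∞ u)
    {p : M} {y : Plane} (hy : y ∈ (chartAt Plane p).target) :
    curv g₀ u ((chartAt Plane p).symm y) = planeGaussCurvature (coordMetric (conformal g₀ u) p) y := by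
  set x := (chartAt Plane p).symm y with hx
  -- The definition of the curvature at `x` uses the chart at `x`, so the chart at `p` is compared
  -- with that one.
  have hy' : y ∈ transitionDomain p x := ⟨hy, mem_chart_source _ x⟩
  have h := (isPlaneMetricOn_conformal g₀ hu x).planeGaussCurvature_pullback
    ((isPlaneMetricOn_conformal g₀ hu p).mono inter_subset_left (isOpen_transitionDomain p x))
    (fun z hz => (mapsTo_transition p x hz).1) (contDiffOn_transition p x)
    (fun z hz => isInvertible_fderiv_transition hz)
    (fun z hz => coordMetric_transition (conformal g₀ u) hz) hy'
  exact h.symm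

/-- The function `e^{2u} K_u`, the density of `K_u dA_u` with respect to `dA_0`. -/
def curvDensity (g₀ : SurfaceMetric M) (u : M → ℝ) (x : M) : ℝ :=
  Real.exp (2 * u x) * curv g₀ u x

/-- The Laplace-Beltrami operator of `g₀`. -/
def laplacian (g₀ : SurfaceMetric M) (f : M → ℝ) (x : M) : ℝ :=
  curvDensity g₀ (fun _ => 0) x - curvDensity g₀ f x

/-- Liouville's equation in an arbitrary chart. -/
theorem curvDensity_symm (g₀ : SurfaceMetric M) {u : M → ℝ} (hu : ContMDiff (𝓡 2) 𝓘(ℝ, ℝ) ∞ u)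
    {p : M} {y : Plane} (hy : y ∈ (chartAt Plane p).target) :
    curvDensity g₀ u ((chartAt Plane p).symm y) =
      planeGaussCurvature (coordMetric g₀.inner p) y
        - (planeLaplacian (coordMetric g₀.inner p)).op (pull p u) y := by
  rw [← (isPlaneMetricOn_coordMetric g₀ p).planeGaussCurvature_conformal (contDiffOn_pull hu p) hy,
    curvDensity, curv_symm g₀ hu hy]
  rfl

/-- By Liouville's equation the difference of curvature densities is the coordinate Laplacian in
every chart. Since `laplacian` is defined through the curvature, its independence of the chart needs
no separate argument. -/
theorem laplacian_symm (g₀ : SurfaceMetric M) {f : M → ℝ} (hf : ContMDiff (𝓡 2) 𝓘(ℝ, ℝ) ∞ f)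
    {p : M} {y : Plane} (hy : y ∈ (chartAt Plane p).target) :
    laplacian g₀ f ((chartAt Plane p).symm y) =
      (planeLaplacian (coordMetric g₀.inner p)).op (pull p f) y := by
  rw [laplacian, curvDensity_symm g₀ hf hy, curvDensity_symm g₀ contMDiff_const hy]
  have h : (planeLaplacian (coordMetric g₀.inner p)).op (pull p fun _ => 0) y = 0 := by
    have h0 : ∀ v : Plane, dirDeriv v (fun _ : Plane => (0 : ℝ)) = fun _ => 0 := fun v => by
      ext z
      simp [dirDeriv]
    have e : (pull p fun _ : M => (0 : ℝ)) = fun _ => 0 := rfl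
    simp [e, SecondOrder.op, h0]
  rw [h]
  ring

theorem curvDensity_eq (g₀ : SurfaceMetric M) (u : M → ℝ) (x : M) :
    curvDensity g₀ u x = curvDensity g₀ (fun _ => 0) x - laplacian g₀ u x := by
  rw [laplacian]
  ring

theorem contMDiff_curvDensity (g₀ : SurfaceMetric M) {u : M → ℝ}
    (hu : ContMDiff (𝓡 2) 𝓘(ℝ, ℝ) ∞ u) : ContMDiff (𝓡 2) 𝓘(ℝ, ℝ) ∞ (curvDensity g₀ u) := by
  refine contMDiff_of_contDiffOn_pull fun p => ?_
  have h := isPlaneMetricOn_coordMetric g₀ p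
  exact (h.contDiffOn_planeGaussCurvature.sub (SecondOrder.contDiffOn_op h.smoothOn_planeLaplacian
    h.isOpen (contDiffOn_pull hu p))).congr fun y hy => curvDensity_symm g₀ hu hy

theorem contMDiff_laplacian (g₀ : SurfaceMetric M) {u : M → ℝ}
    (hu : ContMDiff (𝓡 2) 𝓘(ℝ, ℝ) ∞ u) : ContMDiff (𝓡 2) 𝓘(ℝ, ℝ) ∞ (laplacian g₀ u) :=
  (contMDiff_curvDensity g₀ contMDiff_const).sub (contMDiff_curvDensity g₀ hu)

theorem gradInner_symm' (g₀ : SurfaceMetric M) {f g : M → ℝ}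
    (hf : ContMDiff (𝓡 2) 𝓘(ℝ, ℝ) ∞ f) (hg : ContMDiff (𝓡 2) 𝓘(ℝ, ℝ) ∞ g) {p : M} {y : Plane}
    (hy : y ∈ (chartAt Plane p).target) :
    gradInner g₀.inner f g ((chartAt Plane p).symm y) =
      (planeLaplacian (coordMetric g₀.inner p)).pair (pull p f) (pull p g) y :=
  gradInner_symm g₀ hy
    (differentiableAt_of_smoothOn (chartAt Plane p).open_target (contDiffOn_pull hf p) hy)
    (differentiableAt_of_smoothOn (chartAt Plane p).open_target (contDiffOn_pull hg p) hy)

theorem contMDiff_gradInner (g₀ : SurfaceMetric M) {f g : M → ℝ}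
    (hf : ContMDiff (𝓡 2) 𝓘(ℝ, ℝ) ∞ f) (hg : ContMDiff (𝓡 2) 𝓘(ℝ, ℝ) ∞ g) :
    ContMDiff (𝓡 2) 𝓘(ℝ, ℝ) ∞ (gradInner g₀.inner f g) := by
  refine contMDiff_of_contDiffOn_pull fun p => ?_
  have h := isPlaneMetricOn_coordMetric g₀ p
  exact (SecondOrder.contDiffOn_pair h.smoothOn_planeLaplacian
    h.isOpen (contDiffOn_pull hf p) (contDiffOn_pull hg p)).congr
      fun y hy => gradInner_symm' g₀ hf hg hy

/-- `|dφ ∧ dψ|² = |∇φ|² |∇ψ|² - ⟨∇φ, ∇ψ⟩²`. -/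
theorem wedgeNormSq_conformal (g₀ : SurfaceMetric M) (u f g : M → ℝ) (x : M) :
    wedgeNormSq (conformal g₀ u) f g x =
      gradInner (conformal g₀ u) f f x * gradInner (conformal g₀ u) g g x
        - gradInner (conformal g₀ u) f g x ^ 2 := by
  have hs : ∀ v w, (conformal g₀ u).at x v w = (conformal g₀ u).at x w v :=
    fun v w => congrArg (Real.exp (2 * u x) * ·) (g₀.symm x v w)
  have hD := det_pos hs (conformal_at_pos g₀ u x)
  have e : ∀ k l : M → ℝ, gradInner (conformal g₀ u) k l x = _ :=
    fun k l => dual_inner_eq hs (conformal_at_pos g₀ u x) (differentialAt k x) (differentialAt l x)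
  have e' : wedgeNormSq (conformal g₀ u) f g x =
      (differentialAt f x (basisVec 0) * differentialAt g x (basisVec 1)
        - differentialAt f x (basisVec 1) * differentialAt g x (basisVec 0)) ^ 2 /
      ((conformal g₀ u).at x (basisVec 0) (basisVec 0) *
      (conformal g₀ u).at x (basisVec 1) (basisVec 1)
        - (conformal g₀ u).at x (basisVec 0) (basisVec 1) ^ 2) := rfl
  rw [e, e, e, e']
  have hD' := hD.ne'
  field_simp
  ring

end Charts

/-! ### Families depending on two parameters -/

/-- The product of the parameter plane and the model plane. -/
abbrev ParamPlane : Type := (ℝ × ℝ) × Plane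

/-- The first parameter direction. -/
def dirS : ParamPlane := ((1, 0), 0)

/-- The second parameter direction. -/
def dirT : ParamPlane := ((0, 1), 0)

/-- An operator on the plane, acting on functions that depend on two parameters. -/
def SecondOrder.lift (L : SecondOrder Plane) : SecondOrder ParamPlane where
  a z := L.a z.2
  b z := L.b z.2
  c z := L.c z.2
  p z := L.p z.2
  q z := L.q z.2
  e₀ := (0, L.e₀)
  e₁ := (0, L.e₁)

/-- The restriction of a function to a value of the parameters. -/
def slice (r : ℝ × ℝ) (f : ParamPlane → ℝ) (y : Plane) : ℝ := f (r, y)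

section Slices

variable {V : Set (ℝ × ℝ)} {T : Set Plane} {f g : ParamPlane → ℝ} {L : SecondOrder Plane}

theorem SecondOrder.SmoothOn.lift (hL : L.SmoothOn T) : L.lift.SmoothOn (V ×ˢ T) := by
  have h : ∀ {k : Plane → ℝ}, ContDiffOn ℝ ∞ k T →
      ContDiffOn ℝ ∞ (fun z : ParamPlane => k z.2) (V ×ˢ T) :=
    fun hk => hk.comp contDiffOn_snd fun z hz => hz.2
  exact ⟨h hL.a, h hL.b, h hL.c, h hL.p, h hL.q⟩

/-- Coefficients lifted from the plane are constant in the parameters; this is the hypothesis under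
which `dirDeriv_op` and `dirDeriv_pair` let `∂_s` and `∂_t` pass through the lifted operator. -/
theorem dirDeriv_param (k : Plane → ℝ) {z : ParamPlane} (hk : DifferentiableAt ℝ k z.2)
    (r : ℝ × ℝ) : dirDeriv (r, 0) (fun z : ParamPlane => k z.2) z = 0 := by
  have h : fderiv ℝ (fun z : ParamPlane => k z.2) z = _ :=
    (hk.hasFDerivAt.comp z hasFDerivAt_snd).fderiv
  simp [dirDeriv, h]

theorem contDiffOn_slice (hf : ContDiffOn ℝ ∞ f (V ×ˢ T)) {r : ℝ × ℝ} (hr : r ∈ V) :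
    ContDiffOn ℝ ∞ (slice r f) T :=
  hf.comp (contDiffOn_const.prodMk contDiffOn_id) fun _ hy => ⟨hr, hy⟩

theorem dirDeriv_slice (hV : IsOpen V) (hT : IsOpen T) (hf : ContDiffOn ℝ ∞ f (V ×ˢ T))
    {r : ℝ × ℝ} (hr : r ∈ V) (v : Plane) :
    EqOn (dirDeriv v (slice r f)) (slice r (dirDeriv (0, v) f)) T := fun y hy => by
  have hd := differentiableAt_of_smoothOn (hV.prod hT) hf (show (r, y) ∈ V ×ˢ T from ⟨hr, hy⟩)
  have h : fderiv ℝ (slice r f) y = _ :=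
    (hd.hasFDerivAt.comp y ((hasFDerivAt_const r y).prodMk (hasFDerivAt_id y))).fderiv
  rw [dirDeriv, h]
  simp [slice, dirDeriv]

theorem pair_slice (hV : IsOpen V) (hT : IsOpen T) (hf : ContDiffOn ℝ ∞ f (V ×ˢ T))
    (hg : ContDiffOn ℝ ∞ g (V ×ˢ T)) {r : ℝ × ℝ} (hr : r ∈ V) :
    EqOn (L.pair (slice r f) (slice r g)) (slice r (L.lift.pair f g)) T := fun y hy => by
  simp only [SecondOrder.pair, dirDeriv_slice hV hT hf hr _ hy, dirDeriv_slice hV hT hg hr _ hy]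
  rfl

theorem op_slice (hV : IsOpen V) (hT : IsOpen T) (hf : ContDiffOn ℝ ∞ f (V ×ˢ T))
    {r : ℝ × ℝ} (hr : r ∈ V) :
    EqOn (L.op (slice r f)) (slice r (L.lift.op f)) T := fun y hy => by
  have h2 : ∀ v w, dirDeriv v (dirDeriv w (slice r f)) y =
      slice r (dirDeriv (0, v) (dirDeriv (0, w) f)) y := fun v w => by
    rw [dirDeriv_congr hT (dirDeriv_slice hV hT hf hr w) v hy,
      dirDeriv_slice hV hT (contDiffOn_dirDeriv (hV.prod hT) hf _) hr v hy]
  simp only [SecondOrder.op, h2, dirDeriv_slice hV hT hf hr _ hy]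
  rfl

theorem deriv_dirS {s t : ℝ} {y : Plane} (hf : DifferentiableAt ℝ f ((s, t), y)) :
    deriv (fun s' => f ((s', t), y)) s = dirDeriv dirS f ((s, t), y) := by
  have h : HasDerivAt (fun s' : ℝ => (((s', t), y) : ParamPlane)) dirS s :=
    ((hasDerivAt_id s).prodMk (hasDerivAt_const s t)).prodMk (hasDerivAt_const s y)
  exact (hf.hasFDerivAt.comp_hasDerivAt s h).deriv

theorem deriv_dirT {s t : ℝ} {y : Plane} (hf : DifferentiableAt ℝ f ((s, t), y)) :
    deriv (fun t' => f ((s, t'), y)) t = dirDeriv dirT f ((s, t), y) := by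
  have h : HasDerivAt (fun t' : ℝ => (((s, t'), y) : ParamPlane)) dirT t :=
    ((hasDerivAt_const t s).prodMk (hasDerivAt_id t)).prodMk (hasDerivAt_const t y)
  exact (hf.hasFDerivAt.comp_hasDerivAt t h).deriv

end Slices

/-! ### Path derivatives and their commutator in coordinates -/

section PlanarConnection

variable {V : Set (ℝ × ℝ)} {T : Set Plane} {L : SecondOrder Plane} {k F A : ParamPlane → ℝ}

/-- The coordinate expression of the path derivative in the parameter direction `d`, for the
family `F` with curvature density `k`. -/
def planarCovDeriv (L : SecondOrder Plane) (k F : ParamPlane → ℝ) (d : ParamPlane)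
    (A : ParamPlane → ℝ) (z : ParamPlane) : ℝ :=
  dirDeriv d A z + (k z)⁻¹ * L.lift.pair A (dirDeriv d F) z

theorem contDiffOn_planarCovDeriv (hV : IsOpen V) (hT : IsOpen T) (hL : L.SmoothOn T)
    (hk : ContDiffOn ℝ ∞ k (V ×ˢ T)) (hk0 : ∀ z ∈ V ×ˢ T, k z ≠ 0)
    (hF : ContDiffOn ℝ ∞ F (V ×ˢ T)) (hA : ContDiffOn ℝ ∞ A (V ×ˢ T)) (d : ParamPlane) :
    ContDiffOn ℝ ∞ (planarCovDeriv L k F d A) (V ×ˢ T) :=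
  (contDiffOn_dirDeriv (hV.prod hT) hA d).add ((hk.inv hk0).mul
    (SecondOrder.contDiffOn_pair hL.lift (hV.prod hT) hA (contDiffOn_dirDeriv (hV.prod hT) hF d)))

theorem planarCovDeriv_congr {B : ParamPlane → ℝ} (hV : IsOpen V) (hT : IsOpen T)
    (h : EqOn A B (V ×ˢ T)) (d : ParamPlane) :
    EqOn (planarCovDeriv L k F d A) (planarCovDeriv L k F d B) (V ×ˢ T) := fun z hz => by
  rw [planarCovDeriv, planarCovDeriv, dirDeriv_congr (hV.prod hT) h d hz,
    SecondOrder.pair_congr (hV.prod hT) h (fun _ _ => rfl) hz]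

/-- The second path derivative, expanded. -/
theorem planarCovDeriv_planarCovDeriv (hV : IsOpen V) (hT : IsOpen T) (hL : L.SmoothOn T)
    {K : Plane → ℝ} (hK : ContDiffOn ℝ ∞ K T)
    (hF : ContDiffOn ℝ ∞ F (V ×ˢ T)) (hA : ContDiffOn ℝ ∞ A (V ×ˢ T))
    (hk : k = fun z => K z.2 - L.lift.op F z) (hk0 : ∀ z ∈ V ×ˢ T, k z ≠ 0)
    (r r' : ℝ × ℝ) {z : ParamPlane} (hz : z ∈ V ×ˢ T) :
    planarCovDeriv L k F (r, 0) (planarCovDeriv L k F (r', 0) A) z =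
      dirDeriv (r, 0) (dirDeriv (r', 0) A) z
      + L.lift.op (dirDeriv (r, 0) F) z / k z ^ 2 * L.lift.pair A (dirDeriv (r', 0) F) z
      + (k z)⁻¹ * (L.lift.pair (dirDeriv (r, 0) A) (dirDeriv (r', 0) F) z
        + L.lift.pair A (dirDeriv (r, 0) (dirDeriv (r', 0) F)) z)
      + (k z)⁻¹ * (L.lift.pair (dirDeriv (r', 0) A) (dirDeriv (r, 0) F) z
        + L.lift.pair (fun z => (k z)⁻¹ * L.lift.pair A (dirDeriv (r', 0) F) z)
          (dirDeriv (r, 0) F) z) := by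
  have hW := hV.prod hT
  have d : ∀ {f : ParamPlane → ℝ}, ContDiffOn ℝ ∞ f (V ×ˢ T) → DifferentiableAt ℝ f z :=
    fun hf => differentiableAt_of_smoothOn hW hf hz
  have hLL := hL.lift (V := V)
  have hop := SecondOrder.contDiffOn_op hLL hW hF
  have hK' : ContDiffOn ℝ ∞ (fun z : ParamPlane => K z.2) (V ×ˢ T) :=
    hK.comp contDiffOn_snd fun z hz => hz.2
  have hks : ContDiffOn ℝ ∞ k (V ×ˢ T) := by
    rw [hk]
    exact hK'.sub hop
  have hFr := contDiffOn_dirDeriv hW hF (r, 0)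
  have hFr' := contDiffOn_dirDeriv hW hF (r', 0)
  have hAr' := contDiffOn_dirDeriv hW hA (r', 0)
  have hN := SecondOrder.contDiffOn_pair hLL hW hA hFr'
  have hki : ContDiffOn ℝ ∞ (fun z => (k z)⁻¹) (V ×ˢ T) := hks.inv hk0
  have p : ∀ {f : Plane → ℝ}, ContDiffOn ℝ ∞ f T →
      dirDeriv (r, 0) (fun z : ParamPlane => f z.2) z = 0 := fun hf =>
    dirDeriv_param _ (differentiableAt_of_smoothOn hT hf hz.2) r
  -- Because `k` is affine in `F`, its parameter derivative is minus the operator applied to that of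
  -- `F`.
  have hdk : dirDeriv (r, 0) k z = -L.lift.op (dirDeriv (r, 0) F) z := by
    rw [hk, dirDeriv_sub (d hK') (d hop), p hK, SecondOrder.dirDeriv_op hLL hW hF hz (p hL.a)
      (p hL.b) (p hL.c) (p hL.p) (p hL.q)]
    ring
  have e : planarCovDeriv L k F (r', 0) A = fun z => dirDeriv (r', 0) A z +
    (k z)⁻¹ * L.lift.pair A (dirDeriv (r', 0) F) z := rfl
  rw [planarCovDeriv, e, dirDeriv_add (d hAr') ((d hki).fun_mul (d hN)),
    dirDeriv_mul (d hki) (d hN), dirDeriv_inv (d hks) (hk0 z hz), hdk,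
    SecondOrder.dirDeriv_pair hLL hW hA hFr' hz (p hL.a) (p hL.b) (p hL.c),
    SecondOrder.pair_add_left (d hAr') ((d hki).fun_mul (d hN))]
  ring

/-- The curvature operator in coordinates. -/
theorem planarCovDeriv_commutator (hV : IsOpen V) (hT : IsOpen T) (hL : L.SmoothOn T)
    {K : Plane → ℝ} (hK : ContDiffOn ℝ ∞ K T)
    (hF : ContDiffOn ℝ ∞ F (V ×ˢ T)) (hA : ContDiffOn ℝ ∞ A (V ×ˢ T))
    (hk : k = fun z => K z.2 - L.lift.op F z) (hk0 : ∀ z ∈ V ×ˢ T, k z ≠ 0)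
    (r r' : ℝ × ℝ) {z : ParamPlane} (hz : z ∈ V ×ˢ T) :
    planarCovDeriv L k F (r, 0) (planarCovDeriv L k F (r', 0) A) z
      - planarCovDeriv L k F (r', 0) (planarCovDeriv L k F (r, 0) A) z =
      (L.lift.op (dirDeriv (r, 0) F) z * L.lift.pair A (dirDeriv (r', 0) F) z
        - L.lift.op (dirDeriv (r', 0) F) z * L.lift.pair A (dirDeriv (r, 0) F) z) / k z ^ 2
      + (k z)⁻¹ * (L.lift.pair (fun z => (k z)⁻¹ * L.lift.pair A (dirDeriv (r', 0) F) z)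
          (dirDeriv (r, 0) F) z
        - L.lift.pair (fun z => (k z)⁻¹ * L.lift.pair A (dirDeriv (r, 0) F) z)
          (dirDeriv (r', 0) F) z) := by
  have hW := hV.prod hT
  -- The mixed derivatives of `A` and of `F` agree, and the two terms pairing a derivative of `A`
  -- with one of `F` are exchanged, so all of these drop out.
  rw [planarCovDeriv_planarCovDeriv hV hT hL hK hF hA hk hk0 r r' hz,
    planarCovDeriv_planarCovDeriv hV hT hL hK hF hA hk hk0 r' r hz,
    dirDeriv_comm hW hA hz (r, 0) (r', 0),
    SecondOrder.pair_congr hW (fun _ _ => rfl)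
      (fun x hx => dirDeriv_comm hW hF hx (r, 0) (r', 0)) hz]
  ring

end PlanarConnection

/-! ### Two-parameter families on the surface, read in charts -/

section Families

variable {M : Type*} [TopologicalSpace M] [ChartedSpace Plane M]

/-- The coordinate expression of a two-parameter family of functions in the chart at `p`. -/
def total (p : M) (α : ℝ → ℝ → M → ℝ) (z : ParamPlane) : ℝ :=
  α z.1.1 z.1.2 ((chartAt Plane p).symm z.2)

theorem slice_total (p : M) (α : ℝ → ℝ → M → ℝ) (r : ℝ × ℝ) :
    slice r (total p α) = pull p (α r.1 r.2) := rfl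

theorem total_partialS {V : Set (ℝ × ℝ)} (hV : IsOpen V) {p : M} {α : ℝ → ℝ → M → ℝ}
    (hA : ContDiffOn ℝ ∞ (total p α) (V ×ˢ (chartAt Plane p).target)) :
    EqOn (total p (partialS α)) (dirDeriv dirS (total p α)) (V ×ˢ (chartAt Plane p).target) :=
  fun _ hz => deriv_dirS (differentiableAt_of_smoothOn
    (hV.prod (chartAt Plane p).open_target) hA hz)

theorem total_partialT {V : Set (ℝ × ℝ)} (hV : IsOpen V) {p : M} {α : ℝ → ℝ → M → ℝ}
    (hA : ContDiffOn ℝ ∞ (total p α) (V ×ˢ (chartAt Plane p).target)) :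
    EqOn (total p (partialT α)) (dirDeriv dirT (total p α)) (V ×ˢ (chartAt Plane p).target) :=
  fun _ hz => deriv_dirT (differentiableAt_of_smoothOn
    (hV.prod (chartAt Plane p).open_target) hA hz)

variable [IsManifold (𝓡 2) ∞ M]

theorem contDiffOn_total {U : ℝ → ℝ → M → ℝ} {V : Set (ℝ × ℝ)}
    (hU : ContMDiffOn (𝓘(ℝ, ℝ × ℝ).prod (𝓡 2)) 𝓘(ℝ, ℝ) ∞
      (fun q : (ℝ × ℝ) × M => U q.1.1 q.1.2 q.2) (V ×ˢ univ)) (p : M) :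
    ContDiffOn ℝ ∞ (total p U) (V ×ˢ (chartAt Plane p).target) := by
  rw [← contMDiffOn_iff_contDiffOn]
  refine hU.comp (t := V ×ˢ univ) (f := fun z : ParamPlane =>
    ((z.1, (chartAt Plane p).symm z.2) : (ℝ × ℝ) × M)) ?_ fun z hz => ⟨hz.1, mem_univ _⟩
  exact contDiffOn_fst.contMDiffOn.prodMk ((contMDiffOn_chart_symm (I := 𝓡 2) (n := ∞) (x := p)).comp
    contDiffOn_snd.contMDiffOn fun z hz => hz.2)

variable {g₀ : SurfaceMetric M} {U : ℝ → ℝ → M → ℝ} {V : Set (ℝ × ℝ)}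

/-- The coordinate expression of the curvature density along a family. -/
def totalDensity (g₀ : SurfaceMetric M) (p : M) (U : ℝ → ℝ → M → ℝ) (z : ParamPlane) : ℝ :=
  planeGaussCurvature (coordMetric g₀.inner p) z.2
    - (planeLaplacian (coordMetric g₀.inner p)).lift.op (total p U) z

theorem totalDensity_eq (hV : IsOpen V) {p : M}
    (hF : ContDiffOn ℝ ∞ (total p U) (V ×ˢ (chartAt Plane p).target))
    (hU : ∀ r ∈ V, ContMDiff (𝓡 2) 𝓘(ℝ, ℝ) ∞ (U r.1 r.2)) {z : ParamPlane}
    (hz : z ∈ V ×ˢ (chartAt Plane p).target) :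
    totalDensity g₀ p U z = curvDensity g₀ (U z.1.1 z.1.2) ((chartAt Plane p).symm z.2) := by
  rw [curvDensity_symm g₀ (hU z.1 hz.1) hz.2, ← slice_total,
    op_slice hV (chartAt Plane p).open_target hF hz.1 hz.2]
  rfl

/-- The factors `e^{-2u}` of `K_u` and of the gradient product cancel, so the connection depends on
`u` only through the curvature density. -/
theorem inv_curv_mul_gradInner (g₀ : SurfaceMetric M) (u f g : M → ℝ) (x : M) :
    1 / curv g₀ u x * gradInner (conformal g₀ u) f g x =
      (curvDensity g₀ u x)⁻¹ * gradInner g₀.inner f g x := by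
  rw [gradInner_conformal, curvDensity, mul_inv, Real.exp_neg]
  ring

theorem gradInner_total (hV : IsOpen V) {p : M} {α β : ℝ → ℝ → M → ℝ} {B : ParamPlane → ℝ}
    (hA : ContDiffOn ℝ ∞ (total p α) (V ×ˢ (chartAt Plane p).target))
    (hB : ContDiffOn ℝ ∞ B (V ×ˢ (chartAt Plane p).target))
    (hβ : EqOn (total p β) B (V ×ˢ (chartAt Plane p).target)) {z : ParamPlane}
    (hz : z ∈ V ×ˢ (chartAt Plane p).target) :
    gradInner g₀.inner (α z.1.1 z.1.2) (β z.1.1 z.1.2) ((chartAt Plane p).symm z.2) =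
      (planeLaplacian (coordMetric g₀.inner p)).lift.pair (total p α) B z := by
  have hT := (chartAt Plane p).open_target
  have hβ' := hB.congr hβ
  rw [gradInner_symm g₀ (f := α z.1.1 z.1.2) (g := β z.1.1 z.1.2) hz.2
    (differentiableAt_of_smoothOn hT (contDiffOn_slice hA hz.1) hz.2)
    (differentiableAt_of_smoothOn hT (contDiffOn_slice hβ' hz.1) hz.2)]
  refine (pair_slice hV hT hA hβ' hz.1 hz.2).trans ?_
  exact SecondOrder.pair_congr (hV.prod hT) (fun _ _ => rfl) hβ hz

theorem total_covDerivS (hV : IsOpen V) {p : M}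
    (hF : ContDiffOn ℝ ∞ (total p U) (V ×ˢ (chartAt Plane p).target))
    (hU : ∀ r ∈ V, ContMDiff (𝓡 2) 𝓘(ℝ, ℝ) ∞ (U r.1 r.2)) {α : ℝ → ℝ → M → ℝ}
    (hA : ContDiffOn ℝ ∞ (total p α) (V ×ˢ (chartAt Plane p).target)) :
    EqOn (total p (covDerivS g₀ U α)) (planarCovDeriv (planeLaplacian (coordMetric g₀.inner p))
      (totalDensity g₀ p U) (total p U) dirS (total p α)) (V ×ˢ (chartAt Plane p).target) := by
  intro z hz
  have h1 := total_partialS hV hA hz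
  have h2 := gradInner_total (g₀ := g₀) hV hA
    (contDiffOn_dirDeriv (hV.prod (chartAt Plane p).open_target) hF dirS)
    (total_partialS hV hF) hz
  rw [planarCovDeriv, ← h1, ← h2, totalDensity_eq hV hF hU hz, ← inv_curv_mul_gradInner]
  rfl

theorem total_covDerivT (hV : IsOpen V) {p : M}
    (hF : ContDiffOn ℝ ∞ (total p U) (V ×ˢ (chartAt Plane p).target))
    (hU : ∀ r ∈ V, ContMDiff (𝓡 2) 𝓘(ℝ, ℝ) ∞ (U r.1 r.2)) {α : ℝ → ℝ → M → ℝ}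
    (hA : ContDiffOn ℝ ∞ (total p α) (V ×ˢ (chartAt Plane p).target)) :
    EqOn (total p (covDerivT g₀ U α)) (planarCovDeriv (planeLaplacian (coordMetric g₀.inner p))
      (totalDensity g₀ p U) (total p U) dirT (total p α)) (V ×ˢ (chartAt Plane p).target) := by
  intro z hz
  have h1 := total_partialT hV hA hz
  have h2 := gradInner_total (g₀ := g₀) hV hA
    (contDiffOn_dirDeriv (hV.prod (chartAt Plane p).open_target) hF dirT)
    (total_partialT hV hF) hz
  rw [planarCovDeriv, ← h1, ← h2, totalDensity_eq hV hF hU hz, ← inv_curv_mul_gradInner]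
  rfl

/-- The curvature operator applied to `∂u/∂t`. -/
theorem curvatureOperator_eq {σ : ℝ} {u φ ψ : M → ℝ}
    (hφ : ContMDiff (𝓡 2) 𝓘(ℝ, ℝ) ∞ φ) (hψ : ContMDiff (𝓡 2) 𝓘(ℝ, ℝ) ∞ ψ)
    (hU : IsFamily g₀ σ u φ ψ U) (x : M) :
    curvatureOperator g₀ U (partialT U) 0 0 x =
      (laplacian g₀ φ x * gradInner g₀.inner ψ ψ x - laplacian g₀ ψ x * gradInner g₀.inner ψ φ x)
        / curvDensity g₀ u x ^ 2
      + (curvDensity g₀ u x)⁻¹ *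
        (gradInner g₀.inner (fun x => (curvDensity g₀ u x)⁻¹ * gradInner g₀.inner ψ ψ x) φ x
        - gradInner g₀.inner (fun x => (curvDensity g₀ u x)⁻¹ * gradInner g₀.inner ψ φ x) ψ x) := by
  obtain ⟨⟨V, hV, hV0, hsm, hcone⟩, hu0, hφ0, hψ0⟩ := hU
  set T := (chartAt Plane x).target with hTdef
  have hT : IsOpen T := (chartAt Plane x).open_target
  have hW := hV.prod hT
  set y := chartAt Plane x x with hy
  have hyT : y ∈ T := mem_chart_target _ x
  have hx : (chartAt Plane x).symm y = x := (chartAt Plane x).left_inv (mem_chart_source _ x)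
  have hz : ((0, 0), y) ∈ V ×ˢ T := ⟨hV0, hyT⟩
  have hF : ContDiffOn ℝ ∞ (total x U) (V ×ˢ T) := contDiffOn_total hsm x
  have hUs : ∀ r ∈ V, ContMDiff (𝓡 2) 𝓘(ℝ, ℝ) ∞ (U r.1 r.2) := fun r hr => (hcone r hr).1
  have hG := isPlaneMetricOn_coordMetric g₀ x
  have hL := hG.smoothOn_planeLaplacian
  have hK := hG.contDiffOn_planeGaussCurvature
  set L := planeLaplacian (coordMetric g₀.inner x) with hLdef
  set F := total x U with hFdef
  set k := totalDensity g₀ x U with hkdef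
  have hks : ContDiffOn ℝ ∞ k (V ×ˢ T) :=
    (hK.comp contDiffOn_snd fun z hz => hz.2).sub (SecondOrder.contDiffOn_op hL.lift hW hF)
  have hk0 : ∀ z ∈ V ×ˢ T, k z ≠ 0 := fun z hz => by
    rw [hkdef, totalDensity_eq hV hF hUs hz]
    have := (hcone z.1 hz.1).2 ((chartAt Plane x).symm z.2)
    exact mul_ne_zero (Real.exp_pos _).ne' (right_ne_zero_of_mul this.ne')
  have hFs := contDiffOn_dirDeriv hW hF dirS
  have hFt := contDiffOn_dirDeriv hW hF dirT
  have hαt : EqOn (total x (partialT U)) (dirDeriv dirT F) (V ×ˢ T) := total_partialT hV hF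
  have hαs : EqOn (total x (partialS U)) (dirDeriv dirS F) (V ×ˢ T) := total_partialS hV hF
  have hA : ContDiffOn ℝ ∞ (total x (partialT U)) (V ×ˢ T) := hFt.congr hαt
  have h1 := total_covDerivT (g₀ := g₀) hV hF hUs hA
  have h2 := total_covDerivS (g₀ := g₀) hV hF hUs hA
  have c := fun d => contDiffOn_planarCovDeriv hV hT hL hks hk0 hF hA d
  have h3 := total_covDerivS (g₀ := g₀) hV hF hUs ((c dirT).congr h1) hz
  have h4 := total_covDerivT (g₀ := g₀) hV hF hUs ((c dirS).congr h2) hz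
  -- The inner path derivative agrees with its coordinate expression on the open set `V ×ˢ T`, which
  -- is enough to replace it under the outer one.
  rw [planarCovDeriv_congr hV hT h1 dirS hz] at h3
  rw [planarCovDeriv_congr hV hT h2 dirT hz] at h4
  have h5 := planarCovDeriv_commutator hV hT hL hK hF hA (k := k) rfl hk0 (1, 0) (0, 1) hz
  have h6 : curvatureOperator g₀ U (partialT U) 0 0 x =
      total x (covDerivS g₀ U (covDerivT g₀ U (partialT U))) ((0, 0), y)
        - total x (covDerivT g₀ U (covDerivS g₀ U (partialT U))) ((0, 0), y) := by
    simp only [total, hx, curvatureOperator]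
  rw [h6, h3, h4]
  refine h5.trans ?_
  change (L.lift.op (dirDeriv dirS F) _ * L.lift.pair _ (dirDeriv dirT F) _
        - L.lift.op (dirDeriv dirT F) _ * L.lift.pair _ (dirDeriv dirS F) _) / _
      + _ * (L.lift.pair (fun z => (k z)⁻¹ * L.lift.pair _ (dirDeriv dirT F) z)
          (dirDeriv dirS F) _
        - L.lift.pair (fun z => (k z)⁻¹ * L.lift.pair _ (dirDeriv dirS F) z)
          (dirDeriv dirT F) _) = _
  -- At the parameter value `(0, 0)` the planar quantities become the coordinate expressions of `φ`,
  -- `ψ` and the density of `u`; the planar commutator then reads as an identity on `M`.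
  have sS : EqOn (slice (0, 0) (dirDeriv dirS F)) (pull x φ) T := fun y' hy' => by
    rw [← hφ0]
    exact (hαs (show ((0, 0), y') ∈ V ×ˢ T from ⟨hV0, hy'⟩)).symm
  have sT : EqOn (slice (0, 0) (dirDeriv dirT F)) (pull x ψ) T := fun y' hy' => by
    rw [← hψ0]
    exact (hαt (show ((0, 0), y') ∈ V ×ˢ T from ⟨hV0, hy'⟩)).symm
  have sA : EqOn (slice (0, 0) (total x (partialT U))) (pull x ψ) T := fun y' hy' => by
    rw [← hψ0]
    rfl
  have sk : EqOn (slice (0, 0) k) (pull x (curvDensity g₀ u)) T := fun y' hy' => by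
    have := totalDensity_eq (g₀ := g₀) hV hF hUs (show ((0, 0), y') ∈ V ×ˢ T from ⟨hV0, hy'⟩)
    rw [← hu0]
    exact this
  have eop : ∀ {f : ParamPlane → ℝ} {f' : M → ℝ}, ContDiffOn ℝ ∞ f (V ×ˢ T) →
      ContMDiff (𝓡 2) 𝓘(ℝ, ℝ) ∞ f' → EqOn (slice (0, 0) f) (pull x f') T →
      L.lift.op f ((0, 0), y) = laplacian g₀ f' x := by
    intro f f' hf hf' he
    have e1 := laplacian_symm g₀ hf' hyT
    rw [hx] at e1
    rw [e1, ← SecondOrder.op_congr hT he hyT]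
    exact (op_slice hV hT hf hV0 hyT).symm
  -- Differentiability of the functions on `M` is inherited from the slices, so this also covers the
  -- quotients in `sQ`. It is stated at all points of `T` because those quotients are differentiated
  -- again.
  have epair : ∀ {f f₁ : ParamPlane → ℝ} {f' f₁' : M → ℝ}, ContDiffOn ℝ ∞ f (V ×ˢ T) →
      ContDiffOn ℝ ∞ f₁ (V ×ˢ T) → EqOn (slice (0, 0) f) (pull x f') T →
      EqOn (slice (0, 0) f₁) (pull x f₁') T → ∀ y' ∈ T, L.lift.pair f f₁ ((0, 0), y') =
        gradInner g₀.inner f' f₁' ((chartAt Plane x).symm y') := by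
    intro f f₁ f' f₁' hf hf₁ he he₁ y' hy'
    have d : ∀ {f : ParamPlane → ℝ} {f' : M → ℝ}, ContDiffOn ℝ ∞ f (V ×ˢ T) →
        EqOn (slice (0, 0) f) (pull x f') T → DifferentiableAt ℝ (pull x f') y' :=
      fun hf he => differentiableAt_of_smoothOn hT
        ((contDiffOn_slice hf hV0).congr fun w hw => (he hw).symm) hy'
    rw [gradInner_symm g₀ hy' (d hf he) (d hf₁ he₁), ← SecondOrder.pair_congr hT he he₁ hy']
    exact (pair_slice hV hT hf hf₁ hV0 hy').symm
  have sQ : ∀ {f : ParamPlane → ℝ} {f' : M → ℝ}, ContDiffOn ℝ ∞ f (V ×ˢ T) →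
      EqOn (slice (0, 0) f) (pull x f') T →
      EqOn (slice (0, 0) fun z => (k z)⁻¹ * L.lift.pair (total x (partialT U)) f z)
        (pull x fun x => (curvDensity g₀ u x)⁻¹ * gradInner g₀.inner ψ f' x) T := by
    intro f f' hf he y' hy'
    have e1 := sk hy'
    simp only [slice, pull] at e1 ⊢
    rw [e1, epair hA hf sA he y' hy']
  have cQ : ∀ {f : ParamPlane → ℝ}, ContDiffOn ℝ ∞ f (V ×ˢ T) → ContDiffOn ℝ ∞
      (fun z => (k z)⁻¹ * L.lift.pair (total x (partialT U)) f z) (V ×ˢ T) :=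
    fun hf => (hks.inv hk0).mul (SecondOrder.contDiffOn_pair hL.lift hW hA hf)
  have ek : k ((0, 0), y) = curvDensity g₀ u x := by
    have := sk hyT
    rwa [slice, pull, hx] at this
  rw [eop hFs hφ sS, eop hFt hψ sT, epair hA hFt sA sT y hyT, epair hA hFs sA sS y hyT,
    epair (cQ hFt) hFs (sQ hFt sT) sS y hyT, epair (cQ hFs) hFt (sQ hFs sS) sT y hyT, hx, ek]

end Families

/-! ### Integration in charts -/

theorem det_plane (J : Plane →L[ℝ] Plane) :
    J.det = J (basisVec 0) 0 * J (basisVec 1) 1 - J (basisVec 0) 1 * J (basisVec 1) 0 := by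
  rw [ContinuousLinearMap.det,
    ← LinearMap.det_toMatrix (EuclideanSpace.basisFun (Fin 2) ℝ).toBasis, Matrix.det_fin_two]
  simp [LinearMap.toMatrix_apply, basisVec]
  ring

section Integration

variable {M : Type*} [TopologicalSpace M] [ChartedSpace Plane M]

/-- A form field that is a smooth Riemannian metric in all charts. -/
def IsChartMetric (h : FormField M) : Prop :=
  ∀ p : M, IsPlaneMetricOn (coordMetric h p) (chartAt Plane p).target

theorem planeAreaDensity_eq (G : Plane → Plane →L[ℝ] Plane →L[ℝ] ℝ) (y : Plane) :
    planeAreaDensity G y = √(metricDet G y) := rfl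

theorem IsPlaneMetricOn.contDiffOn_planeAreaDensity {G : Plane → Plane →L[ℝ] Plane →L[ℝ] ℝ}
    {T : Set Plane} (h : IsPlaneMetricOn G T) : ContDiffOn ℝ ∞ (planeAreaDensity G) T :=
  h.contDiffOn_metricDet.sqrt fun _ hy => (h.metricDet_pos hy).ne'

theorem IsPlaneMetricOn.planeAreaDensity_pos {G : Plane → Plane →L[ℝ] Plane →L[ℝ] ℝ}
    {T : Set Plane} (h : IsPlaneMetricOn G T) {y : Plane} (hy : y ∈ T) :
    0 < planeAreaDensity G y :=
  Real.sqrt_pos.2 (h.metricDet_pos hy)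

/-- The integral of a function over the domain of the chart at `p`. -/
def chartIntegral (h : FormField M) (p : M) (f : M → ℝ) : ℝ :=
  ∫ y in (chartAt Plane p).target, planeAreaDensity (coordMetric h p) y * pull p f y

theorem continuousOn_pull {f : M → ℝ} (hf : Continuous f) (p : M) :
    ContinuousOn (pull p f) (chartAt Plane p).target :=
  hf.comp_continuousOn (chartAt Plane p).continuousOn_symm

theorem isCompact_chart_image [CompactSpace M] {f : M → ℝ} {p : M}
    (hf : tsupport f ⊆ (chartAt Plane p).source) : IsCompact (chartAt Plane p '' tsupport f) :=
  ((isClosed_tsupport f).isCompact).image_of_continuousOn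
    ((chartAt Plane p).continuousOn.mono hf)

theorem chart_image_subset {f : M → ℝ} {p : M} (hf : tsupport f ⊆ (chartAt Plane p).source) :
    chartAt Plane p '' tsupport f ⊆ (chartAt Plane p).target := by
  rintro _ ⟨x, hx, rfl⟩
  exact (chartAt Plane p).map_source (hf hx)

theorem pull_eq_zero {f : M → ℝ} {p : M} {y : Plane} (hy : y ∈ (chartAt Plane p).target)
    (hy' : y ∉ chartAt Plane p '' tsupport f) : pull p f y = 0 := by
  by_contra h
  exact hy' ⟨(chartAt Plane p).symm y, subset_tsupport _ h, (chartAt Plane p).right_inv hy⟩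

/-- The weight may blow up at the boundary of the chart target, but the product vanishes off the
compact image of the support, on which it is continuous. -/
theorem integrableOn_mul_pull [CompactSpace M] {f : M → ℝ} (hf : Continuous f) {p : M}
    (hs : tsupport f ⊆ (chartAt Plane p).source) {D : Plane → ℝ}
    (hD : ContinuousOn D (chartAt Plane p).target) :
    IntegrableOn (fun y => D y * pull p f y) (chartAt Plane p).target := by
  have hK := isCompact_chart_image hs
  have hKT := chart_image_subset hs
  have h1 : IntegrableOn (fun y => D y * pull p f y) (chartAt Plane p '' tsupport f) :=
    ((hD.mul (continuousOn_pull hf p)).mono hKT).integrableOn_compact hK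
  refine h1.of_forall_sdiff_eq_zero (chartAt Plane p).open_target.measurableSet fun y hy => ?_
  rw [pull_eq_zero hy.1 hy.2, mul_zero]

theorem chartIntegral_sum [CompactSpace M] {h : FormField M} (hh : IsChartMetric h) {p : M}
    {ι : Type*} (s : Finset ι) {f : ι → M → ℝ} (hf : ∀ i, Continuous (f i))
    (hs : ∀ i, tsupport (f i) ⊆ (chartAt Plane p).source) :
    chartIntegral h p (fun x => ∑ i ∈ s, f i x) = ∑ i ∈ s, chartIntegral h p (f i) := by
  simp only [chartIntegral]
  rw [← integral_finsetSum]
  · simp only [pull, Finset.mul_sum]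
  · exact fun i _ => integrableOn_mul_pull (hf i) (hs i) (hh p).contDiffOn_planeAreaDensity.continuousOn

variable [IsManifold (𝓡 2) ∞ M]

theorem isChartMetric_conformal (g₀ : SurfaceMetric M) {u : M → ℝ}
    (hu : ContMDiff (𝓡 2) 𝓘(ℝ, ℝ) ∞ u) : IsChartMetric (conformal g₀ u) :=
  isPlaneMetricOn_conformal g₀ hu

theorem isChartMetric_inner (g₀ : SurfaceMetric M) : IsChartMetric g₀.inner :=
  isPlaneMetricOn_coordMetric g₀

theorem planeAreaDensity_transition {h : FormField M} (hh : IsChartMetric h) {p q : M} {y : Plane}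
    (hy : y ∈ transitionDomain p q) :
    planeAreaDensity (coordMetric h p) y = |(fderiv ℝ (transition p q) y).det| *
      planeAreaDensity (coordMetric h q) (transition p q y) := by
  have e : metricDet (coordMetric h p) y = (fderiv ℝ (transition p q) y).det ^ 2 *
      metricDet (coordMetric h q) (transition p q y) := by
    simp only [metricDet, metricComp, coordMetric_transition h hy]
    rw [pullback_det _ ((hh q).symm _ (mapsTo_transition p q hy).1), det_plane]
  rw [planeAreaDensity_eq, planeAreaDensity_eq, e, Real.sqrt_mul (sq_nonneg _), Real.sqrt_sq_eq_abs]

/-- The integral of a function supported in the domains of two charts may be computed in either. -/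
theorem chartIntegral_eq {h : FormField M} (hh : IsChartMetric h) {p q : M} {f : M → ℝ}
    (hp : ∀ x, f x ≠ 0 → x ∈ (chartAt Plane p).source)
    (hq : ∀ x, f x ≠ 0 → x ∈ (chartAt Plane q).source) :
    chartIntegral h p f = chartIntegral h q f := by
  -- Off the overlap the integrand is zero; on it, the transition map is a change of variables whose
  -- Jacobian matches the area densities.
  have key : ∀ p q : M, (∀ x, f x ≠ 0 → x ∈ (chartAt Plane q).source) →
      chartIntegral h p f = ∫ y in transitionDomain p q,
        planeAreaDensity (coordMetric h p) y * pull p f y := by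
    intro p q hq
    refine setIntegral_eq_of_subset_of_forall_sdiff_eq_zero
      (chartAt Plane p).open_target.measurableSet inter_subset_left fun y hy => ?_
    have : pull p f y = 0 := by
      by_contra h0
      exact hy.2 ⟨hy.1, hq _ h0⟩
    rw [this, mul_zero]
  rw [key p q hq, key q p hp]
  have him : transition p q '' transitionDomain p q = transitionDomain q p := by
    ext z
    constructor
    · rintro ⟨y, hy, rfl⟩
      exact mapsTo_transition p q hy
    · intro hz
      exact ⟨_, mapsTo_transition q p hz, transition_transition hz⟩
  have hinj : InjOn (transition p q) (transitionDomain p q) := fun y hy z hz e => by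
    rw [← transition_transition hy, e, transition_transition hz]
  have hder : ∀ y ∈ transitionDomain p q, HasFDerivWithinAt (transition p q)
      (fderiv ℝ (transition p q) y) (transitionDomain p q) y := fun y hy =>
    (((contDiffOn_transition p q).contDiffAt ((isOpen_transitionDomain p q).mem_nhds hy)
      ).differentiableAt (by simp)).hasFDerivAt.hasFDerivWithinAt
  rw [← him, integral_image_eq_integral_abs_det_fderiv_smul volume
    (isOpen_transitionDomain p q).measurableSet hder hinj]
  refine setIntegral_congr_fun (isOpen_transitionDomain p q).measurableSet fun y hy => ?_
  simp only [smul_eq_mul]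
  rw [planeAreaDensity_transition hh hy, pull, pull, symm_transition hy]
  ring

variable [T2Space M] [CompactSpace M]

theorem chartPartition_isSubordinate :
    (chartPartition M).IsSubordinate fun p => (chartAt Plane p).source :=
  (SmoothPartitionOfUnity.exists_isSubordinate_chartAt_source (𝓡 2) M).choose_spec

variable (M) in
/-- The finite set of charts that carry the partition of unity. -/
def chartIndex : Finset M :=
  (chartPartition M).locallyFinite.finite_nonempty_of_compact.toFinset

theorem chartPartition_eq_zero {p : M} (hp : p ∉ chartIndex M) (x : M) :
    chartPartition M p x = 0 := by
  by_contra h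
  exact hp (by rw [chartIndex, Finite.mem_toFinset]; exact ⟨x, h⟩)

theorem sum_chartPartition (x : M) : ∑ p ∈ chartIndex M, chartPartition M p x = 1 := by
  refine (chartPartition M).sum_finsupport' x (mem_univ x) fun p hp => ?_
  by_contra h
  exact ((chartPartition M).mem_finsupport x).1 hp (chartPartition_eq_zero h x)

theorem continuous_chartPartition (p : M) : Continuous (chartPartition M p) :=
  (chartPartition M p).contMDiff.continuous

theorem tsupport_chartPartition_mul (p : M) (f : M → ℝ) :
    tsupport (fun x => chartPartition M p x * f x) ⊆ (chartAt Plane p).source :=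
  (tsupport_mul_subset_left (f := chartPartition M p) (g := f)).trans
    (chartPartition_isSubordinate p)

variable [MeasurableSpace M]

/-- The part of the area measure that belongs to the chart at `p`. -/
def areaPiece (h : FormField M) (p : M) : Measure M :=
  ((((volume : Measure Plane).restrict (chartAt Plane p).target).withDensity
      fun y => ENNReal.ofReal (planeAreaDensity (coordMetric h p) y)).map
    (chartAt Plane p).symm).withDensity
      fun x => ENNReal.ofReal (chartPartition M p x)

/-- By compactness only finitely many functions of the locally finite partition are nonzero, and the
other pieces have density zero. -/
theorem areaMeasure_eq (h : FormField M) : areaMeasure h = ∑ p ∈ chartIndex M, areaPiece h p := by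
  ext s hs
  rw [areaMeasure, Measure.sum_apply _ hs, Measure.coe_finsetSum, Finset.sum_apply]
  refine tsum_eq_sum fun p hp => ?_
  have : (fun x => ENNReal.ofReal (chartPartition M p x)) = 0 := by
    ext x
    simp [chartPartition_eq_zero hp x]
  rw [this, withDensity_zero]
  rfl

variable [BorelSpace M]

/-- The density, image and restriction are unwound one at a time. Almost everywhere measurability is
used for the inverse chart and the area density because they are controlled only on the chart
target. -/
theorem areaPiece_integral {h : FormField M} (hh : IsChartMetric h) (p : M) {f : M → ℝ}
    (hf : Continuous f) : Integrable f (areaPiece h p) ∧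
      ∫ x, f x ∂(areaPiece h p) = chartIntegral h p fun x => chartPartition M p x * f x := by
  have hTm := (chartAt Plane p).open_target.measurableSet
  have hD := (hh p).contDiffOn_planeAreaDensity.continuousOn
  have hρ := continuous_chartPartition p
  have hρ' : Measurable fun x => ENNReal.ofReal (chartPartition M p x) :=
    hρ.measurable.ennreal_ofReal
  have hD' : AEMeasurable (fun y => ENNReal.ofReal (planeAreaDensity (coordMetric h p) y))
      ((volume : Measure Plane).restrict (chartAt Plane p).target) :=
    (hD.aemeasurable hTm).ennreal_ofReal
  have hc : AEMeasurable (chartAt Plane p).symm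
      (((volume : Measure Plane).restrict (chartAt Plane p).target).withDensity
        fun y => ENNReal.ofReal (planeAreaDensity (coordMetric h p) y)) :=
    ((chartAt Plane p).continuousOn_symm.aemeasurable hTm).mono_ac
      (withDensity_absolutelyContinuous _ _)
  have hcont : Continuous fun x => (ENNReal.ofReal (chartPartition M p x)).toReal • f x := by
    simp only [ENNReal.toReal_ofReal ((chartPartition M).nonneg p _)]
    exact hρ.smul hf
  have hae := hcont.aestronglyMeasurable (μ := Measure.map (chartAt Plane p).symm
    (((volume : Measure Plane).restrict (chartAt Plane p).target).withDensity
        fun y => ENNReal.ofReal (planeAreaDensity (coordMetric h p) y)))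
  have hfun : ∀ y, (ENNReal.ofReal (planeAreaDensity (coordMetric h p) y)).toReal •
      (ENNReal.ofReal (chartPartition M p ((chartAt Plane p).symm y))).toReal •
        f ((chartAt Plane p).symm y) = planeAreaDensity (coordMetric h p) y *
      pull p (fun x => chartPartition M p x * f x) y := fun y => by
    rw [ENNReal.toReal_ofReal (show 0 ≤ planeAreaDensity _ y from Real.sqrt_nonneg _),
      ENNReal.toReal_ofReal ((chartPartition M).nonneg p _)]
    rfl
  constructor
  · rw [areaPiece, integrable_withDensity_iff_integrable_smul' hρ'
      (ae_of_all _ fun _ => ENNReal.ofReal_lt_top), integrable_map_measure hae hc,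
      integrable_withDensity_iff_integrable_smul₀' hD' (ae_of_all _ fun _ => ENNReal.ofReal_lt_top)]
    simp only [Function.comp_def, hfun]
    exact integrableOn_mul_pull (hρ.mul hf) (tsupport_chartPartition_mul p f) hD
  · rw [areaPiece, integral_withDensity_eq_integral_toReal_smul hρ'
      (ae_of_all _ fun _ => ENNReal.ofReal_lt_top), integral_map hc hae,
      integral_withDensity_eq_integral_toReal_smul₀ hD'
      (ae_of_all _ fun _ => ENNReal.ofReal_lt_top)]
    simp only [hfun]
    rfl

theorem integrable_areaMeasure {h : FormField M} (hh : IsChartMetric h) {f : M → ℝ}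
    (hf : Continuous f) : Integrable f (areaMeasure h) := by
  rw [areaMeasure_eq, integrable_finsetSum_measure]
  exact fun p _ => (areaPiece_integral hh p hf).1

theorem integral_areaMeasure {h : FormField M} (hh : IsChartMetric h) {f : M → ℝ}
    (hf : Continuous f) : ∫ x, f x ∂(areaMeasure h) =
      ∑ p ∈ chartIndex M, chartIntegral h p fun x => chartPartition M p x * f x := by
  rw [areaMeasure_eq, integral_finsetSum_measure fun p _ => (areaPiece_integral hh p hf).1]
  exact Finset.sum_congr rfl fun p _ => (areaPiece_integral hh p hf).2

/-- The integral of a function supported in a chart domain may be computed in that chart. -/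
theorem integral_areaMeasure_of_tsupport {h : FormField M} (hh : IsChartMetric h) {f : M → ℝ}
    (hf : Continuous f) {q : M} (hq : tsupport f ⊆ (chartAt Plane q).source) :
    ∫ x, f x ∂(areaMeasure h) = chartIntegral h q f := by
  rw [integral_areaMeasure hh hf]
  -- Each summand is supported in both chart domains and can be moved to the chart at `q`, where the
  -- partition functions add up to one.
  have h1 : ∀ p ∈ chartIndex M, chartIntegral h p (fun x => chartPartition M p x * f x) =
      chartIntegral h q fun x => chartPartition M p x * f x := fun p _ =>
    chartIntegral_eq hh
      (fun x hx => tsupport_chartPartition_mul p f (subset_tsupport _ hx))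
      (fun x hx => hq (subset_tsupport _ (right_ne_zero_of_mul hx)))
  rw [Finset.sum_congr rfl h1, ← chartIntegral_sum hh _
    (fun p => (continuous_chartPartition p).fun_mul hf)
    (fun p => (tsupport_mul_subset_right (f := chartPartition M p) (g := f)).trans hq)]
  simp only [← Finset.sum_mul, sum_chartPartition, one_mul]

/-- In dimension two the metric determinant scales by `e^{4u}`, so the area density scales by
`e^{2u}`. -/
theorem integral_area (g₀ : SurfaceMetric M) {u f : M → ℝ}
    (hu : ContMDiff (𝓡 2) 𝓘(ℝ, ℝ) ∞ u) (hf : Continuous f) :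
    ∫ x, f x ∂(area g₀ u) = ∫ x, Real.exp (2 * u x) * f x ∂(areaMeasure g₀.inner) := by
  have hexp : Continuous fun x => Real.exp (2 * u x) :=
    Real.continuous_exp.comp (continuous_const.mul hu.continuous)
  rw [area, integral_areaMeasure (isChartMetric_conformal g₀ hu) hf,
    integral_areaMeasure (isChartMetric_inner g₀) (hexp.fun_mul hf)]
  refine Finset.sum_congr rfl fun p _ => ?_
  refine setIntegral_congr_fun (chartAt Plane p).open_target.measurableSet fun y hy => ?_
  have e : planeAreaDensity (coordMetric (conformal g₀ u) p) y =
      Real.exp (2 * pull p u y) * planeAreaDensity (coordMetric g₀.inner p) y := by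
    have e' : metricDet (coordMetric (conformal g₀ u) p) y =
        Real.exp (2 * pull p u y) ^ 2 * metricDet (coordMetric g₀.inner p) y := by
      simp only [metricDet, metricComp, coordMetric_conformal, smul_apply, smul_eq_mul]
      ring
    rw [planeAreaDensity_eq, planeAreaDensity_eq, e', Real.sqrt_mul (sq_nonneg _),
      Real.sqrt_sq (Real.exp_pos _).le]
  simp only [e, pull]
  ring

/-- The area measure is positive on nonempty open sets. -/
theorem integral_areaMeasure_pos {h : FormField M} (hh : IsChartMetric h) {f : M → ℝ}
    (hf : Continuous f) (h0 : ∀ x, 0 ≤ f x) {x : M} (hx : 0 < f x) :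
    0 < ∫ x, f x ∂(areaMeasure h) := by
  -- Some partition function is positive at `x`; its chart contributes the integral of a nonnegative
  -- function that is nonzero on a nonempty open set.
  obtain ⟨p, hp⟩ := (chartPartition M).exists_pos_of_mem (mem_univ x)
  have hpS : p ∈ chartIndex M := by
    by_contra hc
    exact hp.ne' (chartPartition_eq_zero hc x)
  have hnn : ∀ q : M, ∀ y, 0 ≤ planeAreaDensity (coordMetric h q) y *
      pull q (fun x => chartPartition M q x * f x) y := fun q y =>
    mul_nonneg (Real.sqrt_nonneg _) (mul_nonneg ((chartPartition M).nonneg q _) (h0 _))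
  rw [integral_areaMeasure hh hf]
  refine Finset.sum_pos' (fun q _ => integral_nonneg (hnn q)) ⟨p, hpS, ?_⟩
  have hT := (chartAt Plane p).open_target
  have hD := (hh p).contDiffOn_planeAreaDensity.continuousOn
  have hc := (continuous_chartPartition p).mul hf
  have hxs : x ∈ (chartAt Plane p).source :=
    chartPartition_isSubordinate p (subset_tsupport _ hp.ne')
  rw [chartIntegral, setIntegral_pos_iff_support_of_nonneg_ae (ae_of_all _ (hnn p))
    (integrableOn_mul_pull hc (tsupport_chartPartition_mul p f) hD), inter_comm]
  have ho := (hD.mul (continuousOn_pull hc p)).isOpen_inter_preimage hT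
    (isOpen_compl_singleton (x := (0 : ℝ)))
  refine ho.measure_pos _ ⟨chartAt Plane p x, (chartAt Plane p).map_source hxs, ?_⟩
  rw [mem_preimage, Pi.mul_apply, pull_chart p _ hxs]
  exact (mul_pos ((hh p).planeAreaDensity_pos ((chartAt Plane p).map_source hxs))
    (mul_pos hp hx)).ne'

end Integration

/-! ### Green's identity -/

/-- Integration by parts against the constant function `1`. -/
theorem integral_dirDeriv_eq_zero {X : Plane → ℝ} (hX : ContDiff ℝ ∞ X) (hc : HasCompactSupport X)
    (v : Plane) : Integrable (dirDeriv v X) ∧ ∫ y, dirDeriv v X y = 0 := by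
  have hd : Continuous (dirDeriv v X) :=
    (hX.continuous_fderiv (by simp)).clm_apply continuous_const
  have hi : Integrable (dirDeriv v X) :=
    hd.integrable_of_hasCompactSupport (hc.fderiv_apply ℝ v)
  refine ⟨hi, ?_⟩
  have h := integral_mul_fderiv_eq_neg_fderiv_mul_of_integrable (𝕜 := ℝ) (μ := volume)
    (f := fun _ : Plane => (1 : ℝ)) (g := X) (v := v) (by simp)
    (by simpa using! hi) (by simpa using hX.continuous.integrable_of_hasCompactSupport hc)
    (fun x _ => differentiableAt_const _) (fun x _ => hX.differentiable (by simp) x)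
  simpa [dirDeriv] using h

/-- Extension by zero is smooth on the whole plane because `X` already vanishes on `T` outside a
compact subset of `T`. -/
theorem setIntegral_dirDeriv_eq_zero {X : Plane → ℝ} {T C : Set Plane} (hT : IsOpen T)
    (hX : ContDiffOn ℝ ∞ X T) (hC : IsCompact C) (hCT : C ⊆ T) (hz : ∀ y ∈ T, y ∉ C → X y = 0)
    (v : Plane) : IntegrableOn (dirDeriv v X) T ∧ ∫ y in T, dirDeriv v X y = 0 := by
  have hin : EqOn (T.indicator X) X T := fun y hy => indicator_of_mem hy X
  have hout : ∀ y ∉ C, T.indicator X y = 0 := fun y hy => by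
    by_cases hyT : y ∈ T
    · rw [hin hyT, hz y hyT hy]
    · exact indicator_of_notMem hyT X
  have hs : ContDiff ℝ ∞ (T.indicator X) := by
    rw [contDiff_iff_contDiffAt]
    intro y
    by_cases hy : y ∈ T
    · exact (hX.congr hin).contDiffAt (hT.mem_nhds hy)
    · have hyC : Cᶜ ∈ 𝓝 y := hC.isClosed.isOpen_compl.mem_nhds fun h => hy (hCT h)
      exact (contDiffAt_const (c := (0 : ℝ))).congr_of_eventuallyEq
        (by filter_upwards [hyC] with x hx using hout x hx)
  have hcs : HasCompactSupport (T.indicator X) := HasCompactSupport.intro hC hout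
  obtain ⟨h1, h2⟩ := integral_dirDeriv_eq_zero hs hcs v
  have hd : EqOn (dirDeriv v (T.indicator X)) (dirDeriv v X) T := dirDeriv_congr hT hin v
  have hd0 : ∀ y ∉ T, dirDeriv v (T.indicator X) y = 0 := fun y hy => by
    have hyC : Cᶜ ∈ 𝓝 y := hC.isClosed.isOpen_compl.mem_nhds fun h => hy (hCT h)
    have : T.indicator X =ᶠ[𝓝 y] fun _ => 0 := by
      filter_upwards [hyC] with x hx using hout x hx
    rw [dirDeriv, this.fderiv_eq]
    simp
  refine ⟨h1.integrableOn.congr_fun hd hT.measurableSet, ?_⟩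
  rw [← setIntegral_congr_fun hT.measurableSet hd, setIntegral_eq_integral_of_forall_compl_eq_zero
    hd0, h2]

/-! ### Gradient and Laplacian calculus on the surface, and integration by parts -/

section Surfaces

variable {M : Type*} [TopologicalSpace M] [ChartedSpace Plane M] [IsManifold (𝓡 2) ∞ M]
variable {g₀ : SurfaceMetric M} {a b f g : M → ℝ}

theorem gradInner_comm (g₀ : SurfaceMetric M) (f g : M → ℝ) (x : M) :
    gradInner g₀.inner f g x = gradInner g₀.inner g f x := g₀.symm _ _ _

theorem gradInner_add_left (ha : ContMDiff (𝓡 2) 𝓘(ℝ, ℝ) ∞ a) (hb : ContMDiff (𝓡 2) 𝓘(ℝ, ℝ) ∞ b)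
    (hf : ContMDiff (𝓡 2) 𝓘(ℝ, ℝ) ∞ f) (x : M) :
    gradInner g₀.inner (fun x => a x + b x) f x =
      gradInner g₀.inner a f x + gradInner g₀.inner b f x := by
  have hy := mem_chart_target Plane x
  have hT := (chartAt Plane x).open_target
  have hx : (chartAt Plane x).symm (chartAt Plane x x) = x :=
    (chartAt Plane x).left_inv (mem_chart_source _ x)
  have e := gradInner_symm' g₀ (ha.add hb) hf hy
  have ea := gradInner_symm' g₀ ha hf hy
  have eb := gradInner_symm' g₀ hb hf hy
  rw [hx] at e ea eb
  refine e.trans ?_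
  rw [ea, eb]
  exact SecondOrder.pair_add_left (differentiableAt_of_smoothOn hT (contDiffOn_pull ha x) hy)
    (differentiableAt_of_smoothOn hT (contDiffOn_pull hb x) hy)

theorem gradInner_mul_left (ha : ContMDiff (𝓡 2) 𝓘(ℝ, ℝ) ∞ a) (hb : ContMDiff (𝓡 2) 𝓘(ℝ, ℝ) ∞ b)
    (hf : ContMDiff (𝓡 2) 𝓘(ℝ, ℝ) ∞ f) (x : M) :
    gradInner g₀.inner (fun x => a x * b x) f x =
      gradInner g₀.inner a f x * b x + a x * gradInner g₀.inner b f x := by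
  have hy := mem_chart_target Plane x
  have hT := (chartAt Plane x).open_target
  have hx : (chartAt Plane x).symm (chartAt Plane x x) = x :=
    (chartAt Plane x).left_inv (mem_chart_source _ x)
  have e := gradInner_symm' g₀ hf (ha.mul hb) hy
  have ea := gradInner_symm' g₀ hf ha hy
  have eb := gradInner_symm' g₀ hf hb hy
  rw [hx] at e ea eb
  rw [gradInner_comm g₀ _ f, gradInner_comm g₀ a f, gradInner_comm g₀ b f]
  refine e.trans ?_
  rw [ea, eb]
  refine (SecondOrder.pair_mul_right (differentiableAt_of_smoothOn hT (contDiffOn_pull ha x) hy)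
    (differentiableAt_of_smoothOn hT (contDiffOn_pull hb x) hy)).trans ?_
  rw [pull_chart x b (mem_chart_source _ x), pull_chart x a (mem_chart_source _ x)]

theorem laplacian_add (ha : ContMDiff (𝓡 2) 𝓘(ℝ, ℝ) ∞ a) (hb : ContMDiff (𝓡 2) 𝓘(ℝ, ℝ) ∞ b)
    (x : M) : laplacian g₀ (fun x => a x + b x) x = laplacian g₀ a x + laplacian g₀ b x := by
  have hy := mem_chart_target Plane x
  have hx : (chartAt Plane x).symm (chartAt Plane x x) = x :=
    (chartAt Plane x).left_inv (mem_chart_source _ x)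
  have e := laplacian_symm g₀ (ha.add hb) hy
  have ea := laplacian_symm g₀ ha hy
  have eb := laplacian_symm g₀ hb hy
  rw [hx] at e ea eb
  refine e.trans ?_
  rw [ea, eb]
  exact SecondOrder.op_add (chartAt Plane x).open_target (contDiffOn_pull ha x)
    (contDiffOn_pull hb x) hy

theorem laplacian_const_mul (ha : ContMDiff (𝓡 2) 𝓘(ℝ, ℝ) ∞ a) (c : ℝ) (x : M) :
    laplacian g₀ (fun x => c * a x) x = c * laplacian g₀ a x := by
  have hy := mem_chart_target Plane x
  have hx : (chartAt Plane x).symm (chartAt Plane x x) = x :=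
    (chartAt Plane x).left_inv (mem_chart_source _ x)
  have e := laplacian_symm g₀ (contMDiff_const.mul ha : ContMDiff _ _ _ fun x => c * a x) hy
  have ea := laplacian_symm g₀ ha hy
  rw [hx] at e ea
  refine e.trans ?_
  rw [ea]
  exact SecondOrder.op_const_mul (chartAt Plane x).open_target (contDiffOn_pull ha x) c hy

theorem gradInner_eq_zero {x : M} (hx : x ∉ tsupport b) : gradInner g₀.inner b f x = 0 := by
  have h1 : b =ᶠ[𝓝 x] fun _ => 0 := notMem_tsupport_iff_eventuallyEq.1 hx
  have h2 : differentialAt b x = 0 := by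
    have : mfderiv (𝓡 2) 𝓘(ℝ, ℝ) b x = _ := h1.mfderiv_eq
    exact this.trans mfderiv_const
  rw [gradInner_eq, apply_gradientAt (at_pos g₀ x), h2]
  rfl

variable [T2Space M] [CompactSpace M] [MeasurableSpace M] [BorelSpace M]

/-- In the chart at `q`, the integrand times the area density is the divergence of a vector field
supported in the compact image of the support of `b`. -/
theorem green_of_tsupport (hb : ContMDiff (𝓡 2) 𝓘(ℝ, ℝ) ∞ b) (hf : ContMDiff (𝓡 2) 𝓘(ℝ, ℝ) ∞ f)
    {q : M} (hq : tsupport b ⊆ (chartAt Plane q).source) :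
    ∫ x, (b x * laplacian g₀ f x + gradInner g₀.inner b f x) ∂(areaMeasure g₀.inner) = 0 := by
  have hcont : Continuous fun x => b x * laplacian g₀ f x + gradInner g₀.inner b f x :=
    ((hb.mul (contMDiff_laplacian g₀ hf)).add (contMDiff_gradInner g₀ hb hf)).continuous
  have hsupp : tsupport (fun x => b x * laplacian g₀ f x + gradInner g₀.inner b f x) ⊆
      (chartAt Plane q).source := by
    refine (closure_minimal (fun x hx => ?_) (isClosed_tsupport b)).trans hq
    by_contra hxb
    exact hx (by simp [image_eq_zero_of_notMem_tsupport hxb, gradInner_eq_zero hxb])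
  rw [integral_areaMeasure_of_tsupport (isChartMetric_inner g₀) hcont hsupp, chartIntegral]
  have hG := isPlaneMetricOn_coordMetric g₀ q
  set G := coordMetric g₀.inner q
  set T := (chartAt Plane q).target
  have hb' := contDiffOn_pull hb q
  have hf' := contDiffOn_pull hf q
  have e : ∀ y ∈ T, planeAreaDensity G y *
      pull q (fun x => b x * laplacian g₀ f x + gradInner g₀.inner b f x) y = _ := fun y hy => by
    refine Eq.trans ?_ (hG.sqrt_det_mul_op_add_pair hy hb' hf')
    rw [← laplacian_symm g₀ hf hy, ← gradInner_symm' g₀ hb hf hy]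
    rfl
  have key : ∀ i j k : Fin 2, ∀ v : Plane, _ := fun i j k v =>
    setIntegral_dirDeriv_eq_zero hG.isOpen (X := fun x => pull q b x *
      ((metricComp G i i x * partialDeriv j (pull q f) x
        - metricComp G 0 1 x * partialDeriv k (pull q f) x) * (√(metricDet G x))⁻¹))
      (hb'.mul ((((hG.contDiffOn_metricComp i i).mul (contDiffOn_dirDeriv hG.isOpen hf' _)).sub
        ((hG.contDiffOn_metricComp 0 1).mul (contDiffOn_dirDeriv hG.isOpen hf' _))).mul
        ((hG.contDiffOn_metricDet.sqrt fun y hy => (hG.metricDet_pos hy).ne').inv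
          fun y hy => (Real.sqrt_pos.2 (hG.metricDet_pos hy)).ne')))
      (isCompact_chart_image hq) (chart_image_subset hq)
      (fun y hy hyC => by rw [pull_eq_zero hy hyC, zero_mul]) v
  rw [setIntegral_congr_fun hG.isOpen.measurableSet e,
    integral_add (key 1 0 1 (basisVec 0)).1 (key 0 1 0 (basisVec 1)).1]
  exact (congrArg₂ (· + ·) (key 1 0 1 (basisVec 0)).2 (key 0 1 0 (basisVec 1)).2).trans
    (add_zero 0)

/-- Green's identity on a closed surface. -/
theorem green (ha : ContMDiff (𝓡 2) 𝓘(ℝ, ℝ) ∞ a) (hf : ContMDiff (𝓡 2) 𝓘(ℝ, ℝ) ∞ f) :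
    ∫ x, (a x * laplacian g₀ f x + gradInner g₀.inner a f x) ∂(areaMeasure g₀.inner) = 0 := by
  have hρ : ∀ p : M, ContMDiff (𝓡 2) 𝓘(ℝ, ℝ) ∞ fun x => chartPartition M p x * a x :=
    fun p => (chartPartition M p).contMDiff.mul ha
  -- The identity is linear in `a`, so it is summed over the pieces `ρ_p a`, each supported in one
  -- chart domain; over all of `chartIndex M` the pieces add up to `a`.
  have key : ∀ s : Finset M, ContMDiff (𝓡 2) 𝓘(ℝ, ℝ) ∞
      (fun x => ∑ p ∈ s, chartPartition M p x * a x) ∧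
      ∫ x, ((∑ p ∈ s, chartPartition M p x * a x) * laplacian g₀ f x +
        gradInner g₀.inner (fun x => ∑ p ∈ s, chartPartition M p x * a x) f x)
        ∂(areaMeasure g₀.inner) = 0 := by
    classical
    intro s
    induction s using Finset.induction_on with
    | empty =>
      simp only [Finset.sum_empty]
      refine ⟨contMDiff_const, ?_⟩
      have h0 : ∀ x, gradInner g₀.inner (fun _ => (0 : ℝ)) f x = 0 := fun x =>
        gradInner_eq_zero (by simp [tsupport, Function.support])
      simp [h0]
    | insert p s hp ih =>
      simp only [Finset.sum_insert hp]
      refine ⟨(hρ p).add ih.1, ?_⟩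
      have h1 := green_of_tsupport (g₀ := g₀) (hρ p) hf (tsupport_chartPartition_mul p a)
      have hi : ∀ {b : M → ℝ}, ContMDiff (𝓡 2) 𝓘(ℝ, ℝ) ∞ b → Integrable (fun x =>
          b x * laplacian g₀ f x + gradInner g₀.inner b f x) (areaMeasure g₀.inner) := fun hb =>
        integrable_areaMeasure (isChartMetric_inner g₀)
          ((hb.mul (contMDiff_laplacian g₀ hf)).add (contMDiff_gradInner g₀ hb hf)).continuous
      have h2 := integral_add (hi (hρ p)) (hi ih.1)
      rw [h1, ih.2, add_zero] at h2
      rw [← h2]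
      congr 1
      ext x
      rw [gradInner_add_left (hρ p) ih.1 hf]
      ring
  have h := (key (chartIndex M)).2
  simpa only [← Finset.sum_mul, sum_chartPartition, one_mul] using h

end Surfaces

/-! ### The curvature of the space of conformal factors -/

section Cone

variable {M : Type*} [TopologicalSpace M] [ChartedSpace Plane M] [IsManifold (𝓡 2) ∞ M]
variable {g₀ : SurfaceMetric M} {σ : ℝ} {u φ ψ : M → ℝ}

theorem curv_eq (g₀ : SurfaceMetric M) (u : M → ℝ) (x : M) :
    curv g₀ u x = Real.exp (-(2 * u x)) * curvDensity g₀ u x := by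
  rw [curvDensity, ← mul_assoc, ← Real.exp_add, neg_add_cancel, Real.exp_zero, one_mul]

theorem continuous_curv (hu : ContMDiff (𝓡 2) 𝓘(ℝ, ℝ) ∞ u) : Continuous (curv g₀ u) := by
  rw [funext (curv_eq g₀ u)]
  exact (Real.continuous_exp.comp (continuous_const.mul hu.continuous).neg).mul
    (contMDiff_curvDensity g₀ hu).continuous

theorem continuous_gradInner_conformal {f g : M → ℝ} (hu : ContMDiff (𝓡 2) 𝓘(ℝ, ℝ) ∞ u)
    (hf : ContMDiff (𝓡 2) 𝓘(ℝ, ℝ) ∞ f) (hg : ContMDiff (𝓡 2) 𝓘(ℝ, ℝ) ∞ g) :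
    Continuous (gradInner (conformal g₀ u) f g) := by
  rw [funext (gradInner_conformal g₀ u f g)]
  exact (Real.continuous_exp.comp (continuous_const.mul hu.continuous).neg).mul
    (contMDiff_gradInner g₀ hf hg).continuous

theorem curvDensity_pos_iff {x : M} : 0 < σ * curvDensity g₀ u x ↔ 0 < σ * curv g₀ u x := by
  rw [curvDensity, mul_left_comm]
  exact mul_pos_iff_of_pos_left (Real.exp_pos _)

theorem curvDensity_ne_zero (hu : u ∈ cone g₀ σ) (x : M) : curvDensity g₀ u x ≠ 0 :=
  right_ne_zero_of_mul (curvDensity_pos_iff.2 (hu.2 x)).ne'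

theorem contMDiff_inv_curvDensity (hu : u ∈ cone g₀ σ) :
    ContMDiff (𝓡 2) 𝓘(ℝ, ℝ) ∞ fun x => (curvDensity g₀ u x)⁻¹ := by
  refine contMDiff_of_contDiffOn_pull fun p => ?_
  exact (contDiffOn_pull (contMDiff_curvDensity g₀ hu.1) p).inv
    fun y _ => curvDensity_ne_zero hu _

theorem curvDensity_linearFamily (hu : ContMDiff (𝓡 2) 𝓘(ℝ, ℝ) ∞ u)
    (hφ : ContMDiff (𝓡 2) 𝓘(ℝ, ℝ) ∞ φ) (hψ : ContMDiff (𝓡 2) 𝓘(ℝ, ℝ) ∞ ψ) (s t : ℝ) (x : M) :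
    curvDensity g₀ (fun x => u x + s * φ x + t * ψ x) x =
      curvDensity g₀ u x - s * laplacian g₀ φ x - t * laplacian g₀ ψ x := by
  have hs : ContMDiff (𝓡 2) 𝓘(ℝ, ℝ) ∞ fun x => s * φ x := contMDiff_const.mul hφ
  have ht : ContMDiff (𝓡 2) 𝓘(ℝ, ℝ) ∞ fun x => t * ψ x := contMDiff_const.mul hψ
  have hus : ContMDiff (𝓡 2) 𝓘(ℝ, ℝ) ∞ fun x => u x + s * φ x := hu.add hs
  rw [curvDensity_eq, curvDensity_eq g₀ u, laplacian_add hus ht, laplacian_add hu hs,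
    laplacian_const_mul hφ, laplacian_const_mul hψ]
  ring

/-- The density is affine in the parameters. By compactness `σ k` is at least some `m > 0` at `u`,
and the Laplacians of `φ` and `ψ` are bounded, so positivity persists on an explicit neighbourhood
of the origin. -/
theorem isFamily_linearFamily [CompactSpace M] (hu : u ∈ cone g₀ σ)
    (hφ : ContMDiff (𝓡 2) 𝓘(ℝ, ℝ) ∞ φ) (hψ : ContMDiff (𝓡 2) 𝓘(ℝ, ℝ) ∞ ψ) :
    IsFamily g₀ σ u φ ψ (fun s t x => u x + s * φ x + t * ψ x) := by
  obtain ⟨m, hm, hmk⟩ := isCompact_univ.exists_forall_le'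
    (continuous_const.mul (contMDiff_curvDensity g₀ hu.1).continuous).continuousOn
    (fun x (_ : x ∈ univ) => curvDensity_pos_iff.2 (hu.2 x))
  obtain ⟨B, hB⟩ := isCompact_univ.exists_bound_of_continuousOn
    (continuous_const.mul (contMDiff_laplacian g₀ hφ).continuous :
      Continuous fun x => σ * laplacian g₀ φ x).continuousOn
  obtain ⟨C, hC⟩ := isCompact_univ.exists_bound_of_continuousOn
    (continuous_const.mul (contMDiff_laplacian g₀ hψ).continuous :
      Continuous fun x => σ * laplacian g₀ ψ x).continuousOn
  refine ⟨⟨{r : ℝ × ℝ | |r.1| * B + |r.2| * C < m}, ?_, by simpa using hm, ?_, ?_⟩, ?_, ?_, ?_⟩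
  · exact isOpen_lt (by fun_prop) continuous_const
  · have h1 : ContMDiff (𝓘(ℝ, ℝ × ℝ).prod (𝓡 2)) 𝓘(ℝ, ℝ) ∞ fun q : (ℝ × ℝ) × M => q.1.1 :=
      (contDiff_fst.contMDiff).comp contMDiff_fst
    have h2 : ContMDiff (𝓘(ℝ, ℝ × ℝ).prod (𝓡 2)) 𝓘(ℝ, ℝ) ∞ fun q : (ℝ × ℝ) × M => q.1.2 :=
      (contDiff_snd.contMDiff).comp contMDiff_fst
    exact (((hu.1.comp contMDiff_snd).add (h1.mul (hφ.comp contMDiff_snd))).add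
      (h2.mul (hψ.comp contMDiff_snd))).contMDiffOn
  · rintro ⟨s, t⟩ hr
    refine ⟨(hu.1.add (contMDiff_const.mul hφ)).add (contMDiff_const.mul hψ), fun x => ?_⟩
    rw [← curvDensity_pos_iff, curvDensity_linearFamily hu.1 hφ hψ]
    have h1 : m ≤ σ * curvDensity g₀ u x := hmk x (mem_univ x)
    have h2 : s * (σ * laplacian g₀ φ x) ≤ |s| * B := (le_abs_self _).trans <| by
      rw [abs_mul]
      exact mul_le_mul_of_nonneg_left (hB x (mem_univ x)) (abs_nonneg s)
    have h3 : t * (σ * laplacian g₀ ψ x) ≤ |t| * C := (le_abs_self _).trans <| by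
      rw [abs_mul]
      exact mul_le_mul_of_nonneg_left (hC x (mem_univ x)) (abs_nonneg t)
    have h4 : |s| * B + |t| * C < m := hr
    have h5 : σ * (curvDensity g₀ u x - s * laplacian g₀ φ x - t * laplacian g₀ ψ x) =
      σ * curvDensity g₀ u x - s * (σ * laplacian g₀ φ x) - t * (σ * laplacian g₀ ψ x) := by ring
    rw [h5]
    linarith
  · ext x
    simp
  · ext x
    simp [partialS]
  · ext x
    simp [partialT]

variable [T2Space M] [CompactSpace M] [MeasurableSpace M] [BorelSpace M]

/-- The formal metric in terms of the background area measure. -/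
theorem pairing_eq (hu : ContMDiff (𝓡 2) 𝓘(ℝ, ℝ) ∞ u) {α β : M → ℝ} (hα : Continuous α)
    (hβ : Continuous β) : pairing g₀ σ u α β =
      ∫ x, α x * β x * (σ * curvDensity g₀ u x) ∂(areaMeasure g₀.inner) := by
  rw [pairing, integral_area g₀ hu
    ((hα.fun_mul hβ).fun_mul (continuous_const.fun_mul (continuous_curv hu)))]
  congr 1
  ext x
  rw [curvDensity]
  ring

/-- The curvature along any family, in terms of the background metric. -/
theorem familyCurvature_eq (hu : u ∈ cone g₀ σ)
    (hφ : ContMDiff (𝓡 2) 𝓘(ℝ, ℝ) ∞ φ) (hψ : ContMDiff (𝓡 2) 𝓘(ℝ, ℝ) ∞ ψ)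
    {U : ℝ → ℝ → M → ℝ} (hU : IsFamily g₀ σ u φ ψ U) :
    familyCurvature g₀ σ U = ∫ x, σ * ((curvDensity g₀ u x)⁻¹ *
      (gradInner g₀.inner φ ψ x ^ 2 - gradInner g₀.inner φ φ x * gradInner g₀.inner ψ ψ x))
      ∂(areaMeasure g₀.inner) := by
  have hk := contMDiff_curvDensity g₀ hu.1
  have hki := contMDiff_inv_curvDensity hu
  set k := curvDensity g₀ u with hkdef
  have hk0 : ∀ x, k x ≠ 0 := curvDensity_ne_zero hu
  have hb : ContMDiff (𝓡 2) 𝓘(ℝ, ℝ) ∞ fun x => (k x)⁻¹ * gradInner g₀.inner ψ ψ x :=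
    hki.mul (contMDiff_gradInner g₀ hψ hψ)
  have hc : ContMDiff (𝓡 2) 𝓘(ℝ, ℝ) ∞ fun x => (k x)⁻¹ * gradInner g₀.inner ψ φ x :=
    hki.mul (contMDiff_gradInner g₀ hψ hφ)
  -- After factoring out `k⁻¹`, each bracket has the form `a Δf + ⟨∇a, ∇f⟩ = div(a ∇f)`.
  have hR : curvatureOperator g₀ U (partialT U) 0 0 = fun x => (k x)⁻¹ *
      (((k x)⁻¹ * gradInner g₀.inner ψ ψ x) * laplacian g₀ φ x
        + gradInner g₀.inner (fun x => (k x)⁻¹ * gradInner g₀.inner ψ ψ x) φ x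
        - (((k x)⁻¹ * gradInner g₀.inner ψ φ x) * laplacian g₀ ψ x
        + gradInner g₀.inner (fun x => (k x)⁻¹ * gradInner g₀.inner ψ φ x) ψ x)) := by
    ext x
    rw [curvatureOperator_eq hφ hψ hU]
    simp only [← hkdef]
    have := hk0 x
    generalize gradInner g₀.inner (fun x => (k x)⁻¹ * gradInner g₀.inner ψ ψ x) φ x = P
    generalize gradInner g₀.inner (fun x => (k x)⁻¹ * gradInner g₀.inner ψ φ x) ψ x = Q
    field_simp
    ring
  have hRc : Continuous (curvatureOperator g₀ U (partialT U) 0 0) := by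
    rw [hR]
    exact (hki.mul (((hb.mul (contMDiff_laplacian g₀ hφ)).add (contMDiff_gradInner g₀ hb hφ)).sub
      ((hc.mul (contMDiff_laplacian g₀ hψ)).add (contMDiff_gradInner g₀ hc hψ)))).continuous
  have hφb : ContMDiff (𝓡 2) 𝓘(ℝ, ℝ) ∞ fun x => φ x * ((k x)⁻¹ * gradInner g₀.inner ψ ψ x) :=
    hφ.mul hb
  have hφc : ContMDiff (𝓡 2) 𝓘(ℝ, ℝ) ∞ fun x => φ x * ((k x)⁻¹ * gradInner g₀.inner ψ φ x) :=
    hφ.mul hc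
  -- Green's identity is applied with the coefficient multiplied by `φ`, since `φ div(a ∇f) = div(φ
  -- a ∇f) - a⟨∇φ, ∇f⟩`; the last terms are what survives in `hsum`.
  have h1 := green (g₀ := g₀) hφb hφ
  have h2 := green (g₀ := g₀) hφc hψ
  have hi : ∀ {a f : M → ℝ}, ContMDiff (𝓡 2) 𝓘(ℝ, ℝ) ∞ a → ContMDiff (𝓡 2) 𝓘(ℝ, ℝ) ∞ f →
      Integrable (fun x => σ * (a x * laplacian g₀ f x + gradInner g₀.inner a f x))
        (areaMeasure g₀.inner) := fun ha hf =>
    (integrable_areaMeasure (isChartMetric_inner g₀)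
      ((ha.mul (contMDiff_laplacian g₀ hf)).add
        (contMDiff_gradInner g₀ ha hf)).continuous).const_mul σ
  rw [familyCurvature, hU.2.1, hU.2.2.1, pairing_eq hu.1 hRc hφ.continuous]
  have hrhs : Integrable (fun x => σ * ((k x)⁻¹ *
      (gradInner g₀.inner φ ψ x ^ 2 - gradInner g₀.inner φ φ x * gradInner g₀.inner ψ ψ x)))
      (areaMeasure g₀.inner) :=
    integrable_areaMeasure (isChartMetric_inner g₀) (continuous_const.mul
      (hki.continuous.mul (((contMDiff_gradInner g₀ hφ hψ).continuous.pow 2).sub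
        ((contMDiff_gradInner g₀ hφ hφ).mul (contMDiff_gradInner g₀ hψ hψ)).continuous)))
  have hsum : ∀ x, curvatureOperator g₀ U (partialT U) 0 0 x * φ x * (σ * k x) =
      (σ * ((φ x * ((k x)⁻¹ * gradInner g₀.inner ψ ψ x)) * laplacian g₀ φ x
        + gradInner g₀.inner (fun x => φ x * ((k x)⁻¹ * gradInner g₀.inner ψ ψ x)) φ x)
      - σ * ((φ x * ((k x)⁻¹ * gradInner g₀.inner ψ φ x)) * laplacian g₀ ψ x
        + gradInner g₀.inner (fun x => φ x * ((k x)⁻¹ * gradInner g₀.inner ψ φ x)) ψ x))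
      + σ * ((k x)⁻¹ * (gradInner g₀.inner φ ψ x ^ 2 -
        gradInner g₀.inner φ φ x * gradInner g₀.inner ψ ψ x)) := fun x => by
    rw [gradInner_mul_left hφ hb hφ, gradInner_mul_left hφ hc hψ, hR]
    have := hk0 x
    beta_reduce
    generalize gradInner g₀.inner (fun x => (k x)⁻¹ * gradInner g₀.inner ψ ψ x) φ x = P
    generalize gradInner g₀.inner (fun x => (k x)⁻¹ * gradInner g₀.inner ψ φ x) ψ x = Q
    rw [gradInner_comm g₀ ψ φ]
    field_simp
    ring
  rw [integral_congr_ae (ae_of_all _ hsum)]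
  have d := integral_add ((hi hφb hφ).sub (hi hφc hψ)) hrhs
  have d2 := integral_sub (hi hφb hφ) (hi hφc hψ)
  rw [integral_const_mul, integral_const_mul, h1, h2, mul_zero, sub_zero] at d2
  refine d.trans (?_ : _ + _ = _)
  exact (congrArg (· + _) d2).trans (zero_add _)

/-- The Gram determinant of linearly independent functions is positive. -/
theorem gram_pos (hu : u ∈ cone g₀ σ) (hφ : Continuous φ) (hψ : Continuous ψ)
    (hli : LinearIndependent ℝ ![φ, ψ]) : 0 < gram g₀ σ u φ ψ := by
  rw [LinearIndependent.pair_iff] at hli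
  have hw : Continuous fun x => σ * curvDensity g₀ u x :=
    continuous_const.mul (contMDiff_curvDensity g₀ hu.1).continuous
  have hw0 : ∀ x, 0 < σ * curvDensity g₀ u x := fun x => curvDensity_pos_iff.2 (hu.2 x)
  have hpos : ∀ {f : M → ℝ}, Continuous f → f ≠ 0 → 0 < pairing g₀ σ u f f := fun {f} hf hf0 => by
    obtain ⟨x, hx⟩ := Function.ne_iff.1 hf0
    rw [pairing_eq hu.1 hf hf]
    exact integral_areaMeasure_pos (isChartMetric_inner g₀) ((hf.fun_mul hf).fun_mul hw)
      (fun x => mul_nonneg (mul_self_nonneg _) (hw0 x).le)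
      (mul_pos (mul_self_pos.2 hx) (hw0 x))
  have hint : ∀ {f g : M → ℝ}, Continuous f → Continuous g →
      Integrable (fun x => f x * g x * (σ * curvDensity g₀ u x)) (areaMeasure g₀.inner) :=
    fun hf hg => integrable_areaMeasure (isChartMetric_inner g₀) ((hf.fun_mul hg).fun_mul hw)
  have hψ0 : ψ ≠ 0 := fun h => one_ne_zero (hli 0 1 (by simp [h])).2
  have ha := hpos hψ hψ0
  set a := pairing g₀ σ u ψ ψ with hadef
  set c := pairing g₀ σ u φ ψ with hcdef
  have hf : Continuous fun x => a * φ x - c * ψ x :=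
    (continuous_const.mul hφ).sub (continuous_const.mul hψ)
  -- This is `a` times the component of `φ` orthogonal to `ψ`, with squared norm `a` times the Gram
  -- determinant. Scaling by `a` avoids division.
  have hf0 : (fun x => a * φ x - c * ψ x) ≠ 0 := fun h => ha.ne' (hli a (-c) (by
    rw [← h]
    ext x
    simp
    ring)).1
  have h1 := hpos hf hf0
  have h2 : pairing g₀ σ u (fun x => a * φ x - c * ψ x) (fun x => a * φ x - c * ψ x) =
      a ^ 2 * pairing g₀ σ u φ φ - 2 * a * c * pairing g₀ σ u φ ψ
        + c ^ 2 * pairing g₀ σ u ψ ψ := by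
    have hsub : Integrable (fun x => a ^ 2 * (φ x * φ x * (σ * curvDensity g₀ u x)) -
        2 * a * c * (φ x * ψ x * (σ * curvDensity g₀ u x))) (areaMeasure g₀.inner) :=
      ((hint hφ hφ).const_mul _).sub ((hint hφ hψ).const_mul _)
    rw [pairing_eq hu.1 hf hf, pairing_eq hu.1 hφ hφ, pairing_eq hu.1 hφ hψ,
      pairing_eq hu.1 hψ hψ, ← integral_const_mul, ← integral_const_mul, ← integral_const_mul,
      ← integral_sub ((hint hφ hφ).const_mul _) ((hint hφ hψ).const_mul _),
      ← integral_add hsub ((hint hψ hψ).const_mul _)]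
    congr 1
    ext x
    ring
  have h3 : a ^ 2 * pairing g₀ σ u φ φ - 2 * a * c * pairing g₀ σ u φ ψ
        + c ^ 2 * pairing g₀ σ u ψ ψ = a * gram g₀ σ u φ ψ := by
    rw [gram, ← hadef, ← hcdef]
    ring
  rw [h2, h3] at h1
  exact (mul_pos_iff_of_pos_left ha).1 h1

end Cone

end FormalCurvature

end

/-! ### The theorem, translated back to the metric `g_u` -/

theorem proposition2p3 {M : Type*} [TopologicalSpace M] [T2Space M] [CompactSpace M]
    [MeasurableSpace M] [BorelSpace M] [ChartedSpace FormalCurvature.Plane M]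
    [IsManifold (𝓡 2) ∞ M] (g₀ : FormalCurvature.SurfaceMetric M)
    (σ : ℝ) (hσ : σ = 1 ∨ σ = -1) (u φ ψ : M → ℝ)
    (hu : u ∈ FormalCurvature.cone g₀ σ)
    (hφ : ContMDiff (𝓡 2) 𝓘(ℝ, ℝ) ∞ φ) (hψ : ContMDiff (𝓡 2) 𝓘(ℝ, ℝ) ∞ ψ) :
    -- `K(φ, ψ)` may be computed along any two-parameter family through `u` tangent to `φ, ψ`
    (∀ U : ℝ → ℝ → M → ℝ, FormalCurvature.IsFamily g₀ σ u φ ψ U →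
      FormalCurvature.familyCurvature g₀ σ U = FormalCurvature.sectionalForm g₀ σ u φ ψ) ∧
    FormalCurvature.IsFamily g₀ σ u φ ψ (fun s t x => u x + s * φ x + t * ψ x) ∧
    -- the curvature formula
    Integrable (fun x => 1 / (σ * FormalCurvature.curv g₀ u x) *
        FormalCurvature.wedgeNormSq (FormalCurvature.conformal g₀ u) φ ψ x)
      (FormalCurvature.area g₀ u) ∧
    FormalCurvature.sectionalForm g₀ σ u φ ψ =
      ∫ x, 1 / (σ * FormalCurvature.curv g₀ u x) *
        (-(FormalCurvature.gradInner (FormalCurvature.conformal g₀ u) φ φ x *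
            FormalCurvature.gradInner (FormalCurvature.conformal g₀ u) ψ ψ x)
          + FormalCurvature.gradInner (FormalCurvature.conformal g₀ u) φ ψ x ^ 2)
        ∂(FormalCurvature.area g₀ u) ∧
    FormalCurvature.sectionalForm g₀ σ u φ ψ =
      -∫ x, 1 / (σ * FormalCurvature.curv g₀ u x) *
        FormalCurvature.wedgeNormSq (FormalCurvature.conformal g₀ u) φ ψ x
        ∂(FormalCurvature.area g₀ u) ∧
    FormalCurvature.sectionalForm g₀ σ u φ ψ ≤ 0 ∧
    -- the normalized sectional curvature of the plane spanned by `φ, ψ`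
    (LinearIndependent ℝ ![φ, ψ] →
      0 < FormalCurvature.gram g₀ σ u φ ψ ∧
      FormalCurvature.sectionalCurvature g₀ σ u φ ψ ≤ 0) := by
  have hfam := FormalCurvature.isFamily_linearFamily hu hφ hψ
  have hKc : Continuous fun x => 1 / (σ * FormalCurvature.curv g₀ u x) :=
    continuous_const.div (continuous_const.mul (FormalCurvature.continuous_curv hu.1))
      fun x => (hu.2 x).ne'
  have hgc : ∀ {f g : M → ℝ}, ContMDiff (𝓡 2) 𝓘(ℝ, ℝ) ∞ f → ContMDiff (𝓡 2) 𝓘(ℝ, ℝ) ∞ g →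
      Continuous (FormalCurvature.gradInner (FormalCurvature.conformal g₀ u) f g) :=
    fun hf hg => FormalCurvature.continuous_gradInner_conformal hu.1 hf hg
  have hwc : Continuous fun x => 1 / (σ * FormalCurvature.curv g₀ u x) *
      FormalCurvature.wedgeNormSq (FormalCurvature.conformal g₀ u) φ ψ x := by
    simp only [FormalCurvature.wedgeNormSq_conformal]
    exact hKc.mul (((hgc hφ hφ).mul (hgc hψ hψ)).sub ((hgc hφ hψ).pow 2))
  -- The background formula carries `σ k⁻¹` and the claim carries `(σ K_u)⁻¹`; they match because
  -- `σ` is its own inverse.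
  have hσ2 : σ * σ = 1 := by
    rcases hσ with rfl | rfl <;> norm_num
  have hformula : FormalCurvature.sectionalForm g₀ σ u φ ψ =
      ∫ x, 1 / (σ * FormalCurvature.curv g₀ u x) *
        (-(FormalCurvature.gradInner (FormalCurvature.conformal g₀ u) φ φ x *
            FormalCurvature.gradInner (FormalCurvature.conformal g₀ u) ψ ψ x)
          + FormalCurvature.gradInner (FormalCurvature.conformal g₀ u) φ ψ x ^ 2)
        ∂(FormalCurvature.area g₀ u) := by
    rw [FormalCurvature.sectionalForm, FormalCurvature.familyCurvature_eq hu hφ hψ hfam,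
      FormalCurvature.integral_area g₀ hu.1 (hKc.fun_mul
        (((hgc hφ hφ).fun_mul (hgc hψ hψ)).fun_neg.fun_add ((hgc hφ hψ).fun_pow 2)))]
    congr 1
    ext x
    have hk := FormalCurvature.curvDensity_ne_zero hu x
    have hσ0 : σ ≠ 0 := left_ne_zero_of_mul (hσ2.trans_ne one_ne_zero)
    have hE := (Real.exp_pos (2 * u x)).ne'
    rw [FormalCurvature.curv_eq, FormalCurvature.gradInner_conformal,
      FormalCurvature.gradInner_conformal, FormalCurvature.gradInner_conformal, Real.exp_neg]
    field_simp
    linear_combination (FormalCurvature.gradInner g₀.inner φ ψ x ^ 2 -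
      FormalCurvature.gradInner g₀.inner φ φ x * FormalCurvature.gradInner g₀.inner ψ ψ x) * hσ2
  have hwedge : FormalCurvature.sectionalForm g₀ σ u φ ψ =
      -∫ x, 1 / (σ * FormalCurvature.curv g₀ u x) *
        FormalCurvature.wedgeNormSq (FormalCurvature.conformal g₀ u) φ ψ x
        ∂(FormalCurvature.area g₀ u) := by
    rw [hformula, ← integral_neg]
    congr 1
    ext x
    rw [FormalCurvature.wedgeNormSq_conformal]
    ring
  have hnonpos : FormalCurvature.sectionalForm g₀ σ u φ ψ ≤ 0 := by
    rw [hwedge, neg_nonpos]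
    -- The squared norm of the wedge is a square over a positive Gram determinant.
    refine integral_nonneg fun x => mul_nonneg (one_div_pos.2 (hu.2 x)).le ?_
    exact div_nonneg (sq_nonneg _) (FormalCurvature.det_pos
      (fun v w => congrArg (Real.exp (2 * u x) * ·) (g₀.symm x v w))
      (FormalCurvature.conformal_at_pos g₀ u x)).le
  refine ⟨fun U hU => ?_, hfam, ?_, hformula, hwedge, hnonpos, fun hli => ?_⟩
  · rw [FormalCurvature.sectionalForm, FormalCurvature.familyCurvature_eq hu hφ hψ hU,
      FormalCurvature.familyCurvature_eq hu hφ hψ hfam]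
  · exact FormalCurvature.integrable_areaMeasure (FormalCurvature.isChartMetric_conformal g₀ hu.1)
      hwc
  · have hg := FormalCurvature.gram_pos hu hφ.continuous hψ.continuous hli
    exact ⟨hg, div_nonpos_of_nonpos_of_nonneg hnonpos hg.le⟩
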